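/- Let $0<L_1<L_2<L_3$, $\Omega=(0,L_1)\cup(L_2,L_3)$, and let $a,b,\mu_1,\mu_2,\tau>0$. For $g:[0,\infty)\to[0,\infty)$ write $(g*h)(t)=\int_0^t g(t-s)h(s)\,ds$, $(g\,\square\,h)(t)=\int_0^t g(t-s)|h(t)-h(s)|^2\,ds$, $\beta(t)=a-\int_0^t g(s)\,ds$ and $\beta_0=a-\int_0^\infty g(s)\,ds$. Assume: (G1) $g$ is $C^1$ on $[0,\infty)$, $g\ge 0$, $g(0)>0$, $\beta(t)>0$ for all $t\ge0$, and $\beta_0>0$; (G2) $\xi:[0,\infty)\to[0,\infty)$ is nonincreasing and differentiable, $g'(t)\le-\xi(t)g(t)$ for all $t\ge 0$, and $\int_0^\infty\xi(t)\,dt=+\infty$. Let $(u,v)$ be a regular solution of the transmission problem $$u_{tt}-au_{xx}+g*u_{xx}+\mu_1u_t(x,t)+\mu_2u_t(x,t-\tau)=0\ \text{ in }\Omega\times(0,\infty),\qquad v_{tt}-bv_{xx}=0\ \text{ in }(L_1,L_2)\times(0,\infty),$$ with, for $t>0$, $$u(0,t)=u(L_3,t)=0,\qquad u(L_i,t)=v(L_i,t),\qquad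 au_x(L_i,t)-(g*u_x(L_i,\cdot))(t)=bv_x(L_i,t)\quad(i=1,2),$$ and initial data $u(x,0)=u_0(x)$, $u_t(x,0)=u_1(x)$ and $u_t(x,t-\tau)=f_0(x,t-\tau)$ for $t\in[0,\tau]$ ($x\in\Omega$), $v(x,0)=v_0(x)$, $v_t(x,0)=v_1(x)$ ($x\in(L_1,L_2)$), where $f_0\in L^2(\Omega\times(-\tau,0))$. Here regular means that, on each of the intervals $I=(0,L_1),(L_2,L_3)$ for $u$ and $I=(L_1,L_2)$ for $v$, the solution belongs to $C([0,\infty);H^2(I))\cap C^1([0,\infty);H^1(I))\cap C^2([0,\infty);L^2(I))$; the two equations hold for every $t>0$ and almost every $x$. Let $\zeta$ satisfy $\tau\mu_2<\zeta<\tau(2\mu_1-\mu_2)$ and, with $z(x,\rho,t)=u_t(x,t-\tau\rho)$, define the energy $$E(t)=\tfrac12\int_\Omega u_t^2\,dx+\tfrac12\beta(t)\int_\Omega u_x^2\,dx+\tfrac12\int_\Omega (g\,\square\,u_x)(t)\,dx+\tfrac12\int_{L_1}^{L_2}\left[v_t^2+bv_x^2\right]dx+\tfrac{\zeta}{2}\int_\Omega\int_0^1z^2(x,\rho,t)\,d\rho\,dx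 .$$ Assume $\mu_2<\mu_1$ and $$b>\frac{4(L_2-L_1)}{L_1+L_3-L_2}\,\beta_0,\qquad a>\frac{4(L_2-L_1)}{L_1+L_3-L_2}\,\beta_0 .$$ Then there exist constants $\gamma_0,\gamma_2>0$ such that, for all $t\ge0$ and all $\gamma_1\in(0,\gamma_0)$, $$E(t)\le\gamma_2\,e^{-\gamma_1\int_0^t\xi(s)\,ds}.$$ -/

import Mathlib

open MeasureTheory Set Filter Topology

noncomputable section

namespace ViscoTransmission

/-- The damped part `Ω = (0, L₁) ∪ (L₂, L₃)` of the body. -/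
def Omega (L₁ L₂ L₃ : ℝ) : Set ℝ := Ioo 0 L₁ ∪ Ioo L₂ L₃

/-! ### Regular functions of `(x, t)` -/

/-- `t ↦ f(·, t)` is a continuous curve `[0, ∞) → L²(p, q)`. -/
def L2Continuous (p q : ℝ) (f : ℝ → ℝ → ℝ) : Prop :=
  (∀ t, 0 ≤ t → MemLp (fun x => f x t) 2 (volume.restrict (Ioo p q))) ∧
  ∀ t, 0 ≤ t →
    Tendsto (fun s => eLpNorm (fun x => f x s - f x t) 2 (volume.restrict (Ioo p q)))
      (𝓝[Ici 0] t) (𝓝 0)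

/-- The curve `t ↦ f(·, t)` is differentiable on `[0, ∞)` in the norm of `L²(p, q)`
(one-sidedly at `t = 0`), and its derivative is `t ↦ f'(·, t)`. -/
def L2HasDeriv (p q : ℝ) (f f' : ℝ → ℝ → ℝ) : Prop :=
  ∀ t, 0 ≤ t →
    Tendsto (fun s => eLpNorm (fun x => (s - t)⁻¹ * (f x s - f x t) - f' x t) 2
        (volume.restrict (Ioo p q)))
      (𝓝[Ici 0 \ {t}] t) (𝓝 0)

/-- For every `t ≥ 0` the function `f(·, t)` is absolutely continuous on `[p, q]` with
(weak) derivative `f'(·, t)`. -/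
def HasSpaceDeriv (p q : ℝ) (f f' : ℝ → ℝ → ℝ) : Prop :=
  ∀ t, 0 ≤ t →
    IntervalIntegrable (fun x => f' x t) volume p q ∧
    ∀ x ∈ Icc p q, ∀ y ∈ Icc p q, f y t - f x t = ∫ r in x..y, f' r t

/-- A function of `(x, t)` together with its derivatives up to second order.
What these functions have to satisfy is stated in `Motion.IsRegularOn`. -/
structure Motion where
  /-- the function `w` -/
  val : ℝ → ℝ → ℝ
  /-- `w_x` -/
  dx : ℝ → ℝ → ℝ
  /-- `w_t` -/
  dt : ℝ → ℝ → ℝ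
  /-- `w_xx` -/
  dxx : ℝ → ℝ → ℝ
  /-- `w_xt` -/
  dxt : ℝ → ℝ → ℝ
  /-- `w_tt` -/
  dtt : ℝ → ℝ → ℝ

/-- `w ∈ C([0,∞); H²(p,q)) ∩ C¹([0,∞); H¹(p,q)) ∩ C²([0,∞); L²(p,q))`, and the other
components of `w` are its derivatives. For `t ≥ 0`, the functions `w`, `w_x`, `w_t` are taken in
their continuous representatives, so that their boundary values are meaningful; `w_xx` is taken in
a jointly measurable representative. -/
structure Motion.IsRegularOn (w : Motion) (p q : ℝ) : Prop where
  val_dx : HasSpaceDeriv p q w.val w.dx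
  dx_dxx : HasSpaceDeriv p q w.dx w.dxx
  dt_dxt : HasSpaceDeriv p q w.dt w.dxt
  val_dt : L2HasDeriv p q w.val w.dt
  dx_dxt : L2HasDeriv p q w.dx w.dxt
  dt_dtt : L2HasDeriv p q w.dt w.dtt
  cont_val : L2Continuous p q w.val
  cont_dx : L2Continuous p q w.dx
  cont_dt : L2Continuous p q w.dt
  cont_dxx : L2Continuous p q w.dxx
  cont_dxt : L2Continuous p q w.dxt
  cont_dtt : L2Continuous p q w.dtt
  meas_dxx : AEStronglyMeasurable (fun z : ℝ × ℝ => w.dxx z.1 z.2)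
    ((volume.restrict (Ioo p q)).prod (volume.restrict (Ioi 0)))

/-! ### The relaxation function -/

/-- `(g * h)(t) = ∫₀ᵗ g(t - s) h(s) ds`. -/
def conv (g h : ℝ → ℝ) (t : ℝ) : ℝ := ∫ s in (0 : ℝ)..t, g (t - s) * h s

/-- `(g □ h)(t) = ∫₀ᵗ g(t - s) |h(t) - h(s)|² ds`. -/
def box (g h : ℝ → ℝ) (t : ℝ) : ℝ := ∫ s in (0 : ℝ)..t, g (t - s) * |h t - h s| ^ 2

/-- `β(t) = a - ∫₀ᵗ g(s) ds`. -/
def beta (a : ℝ) (g : ℝ → ℝ) (t : ℝ) : ℝ := a - ∫ s in (0 : ℝ)..t, g s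

/-- `β₀ = a - ∫₀^∞ g(s) ds`. -/
def beta0 (a : ℝ) (g : ℝ → ℝ) : ℝ := a - ∫ s in Ioi (0 : ℝ), g s

/-- Assumptions on the relaxation function `g : [0, ∞) → [0, ∞)`. (Since `g ≥ 0`, positivity of `β` makes `g` integrable on `(0, ∞)`.) -/
structure G1 (a : ℝ) (g : ℝ → ℝ) : Prop where
  contDiff : ContDiffOn ℝ 1 g (Ici 0)
  nonneg : ∀ t, 0 ≤ t → 0 ≤ g t
  pos_zero : 0 < g 0
  beta_pos : ∀ t, 0 ≤ t → 0 < beta a g t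
  beta0_pos : 0 < beta0 a g

/-- The nonincreasing differentiable rate function `ξ : [0, ∞) → [0, ∞)` satisfies `g' ≤ -ξ g` and
has infinite integral. -/
structure G2 (g ξ : ℝ → ℝ) : Prop where
  nonneg : ∀ t, 0 ≤ t → 0 ≤ ξ t
  antitone : AntitoneOn ξ (Ici 0)
  differentiable : DifferentiableOn ℝ ξ (Ici 0)
  deriv_le : ∀ t, 0 ≤ t → derivWithin g (Ici 0) t ≤ -ξ t * g t
  integral_infinite : Tendsto (fun t => ∫ s in (0 : ℝ)..t, ξ s) atTop atTop

/-! ### The transmission problem -/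

/-- `(u, v)` is a regular solution of the transmission problem with viscoelastic term, frictional
damping `μ₁ u_t`, delay term `μ₂ u_t(t - τ)` and initial data `u₀, u₁, v₀, v₁, f₀`.
For `t ∈ [-τ, 0]` the values of `u.dt` are the prescribed history `f₀` of the velocity. -/
structure IsRegularSolution (L₁ L₂ L₃ a b μ₁ μ₂ τ : ℝ) (g : ℝ → ℝ)
    (u₀ u₁ v₀ v₁ : ℝ → ℝ) (f₀ : ℝ → ℝ → ℝ) (u v : Motion) : Prop where
  regular_u_left : u.IsRegularOn 0 L₁
  regular_u_right : u.IsRegularOn L₂ L₃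
  regular_v : v.IsRegularOn L₁ L₂
  /-- the history of the velocity is square integrable on `Ω × (-τ, 0)` -/
  history_memLp : MemLp (fun z : ℝ × ℝ => f₀ z.1 z.2) 2
    ((volume.restrict (Omega L₁ L₂ L₃)).prod (volume.restrict (Ioo (-τ) 0)))
  /-- `u_tt - a u_xx + g * u_xx + μ₁ u_t + μ₂ u_t(t - τ) = 0` in `Ω` -/
  eq_u : ∀ t, 0 < t → ∀ᵐ x ∂(volume.restrict (Omega L₁ L₂ L₃)),
    u.dtt x t - a * u.dxx x t + conv g (u.dxx x) t + μ₁ * u.dt x t + μ₂ * u.dt x (t - τ) = 0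
  /-- `v_tt - b v_xx = 0` in `(L₁, L₂)` -/
  eq_v : ∀ t, 0 < t → ∀ᵐ x ∂(volume.restrict (Ioo L₁ L₂)), v.dtt x t - b * v.dxx x t = 0
  /-- boundary conditions `u(0, t) = u(L₃, t) = 0` -/
  boundary_left : ∀ t, 0 < t → u.val 0 t = 0
  boundary_right : ∀ t, 0 < t → u.val L₃ t = 0
  /-- continuity of the displacement, `u(Lᵢ, t) = v(Lᵢ, t)` -/
  displacement_left : ∀ t, 0 < t → u.val L₁ t = v.val L₁ t
  displacement_right : ∀ t, 0 < t → u.val L₂ t = v.val L₂ t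
  /-- continuity of the stress, `a u_x(Lᵢ, t) - (g * u_x(Lᵢ, ·))(t) = b v_x(Lᵢ, t)` -/
  stress_left : ∀ t, 0 < t → a * u.dx L₁ t - conv g (u.dx L₁) t = b * v.dx L₁ t
  stress_right : ∀ t, 0 < t → a * u.dx L₂ t - conv g (u.dx L₂) t = b * v.dx L₂ t
  /-- initial conditions -/
  initial_u : ∀ x ∈ Omega L₁ L₂ L₃, u.val x 0 = u₀ x
  initial_ut : ∀ x ∈ Omega L₁ L₂ L₃, u.dt x 0 = u₁ x
  initial_history : ∀ x ∈ Omega L₁ L₂ L₃, ∀ t ∈ Icc 0 τ, u.dt x (t - τ) = f₀ x (t - τ)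
  initial_v : ∀ x ∈ Ioo L₁ L₂, v.val x 0 = v₀ x
  initial_vt : ∀ x ∈ Ioo L₁ L₂, v.dt x 0 = v₁ x

/-- `z(x, ρ, t) = u_t(x, t - τ ρ)`. -/
def delayed (τ : ℝ) (u : Motion) (x ρ t : ℝ) : ℝ := u.dt x (t - τ * ρ)

/-- The energy `E(t)`. -/
def energy (L₁ L₂ L₃ a b τ ζ : ℝ) (g : ℝ → ℝ) (u v : Motion) (t : ℝ) : ℝ :=
  (1 / 2) * (∫ x in Omega L₁ L₂ L₃, u.dt x t ^ 2)
  + (1 / 2) * beta a g t * (∫ x in Omega L₁ L₂ L₃, u.dx x t ^ 2)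
  + (1 / 2) * (∫ x in Omega L₁ L₂ L₃, box g (u.dx x) t)
  + (1 / 2) * (∫ x in L₁..L₂, (v.dt x t ^ 2 + b * v.dx x t ^ 2))
  + (ζ / 2) * (∫ x in Omega L₁ L₂ L₃, ∫ ρ in (0 : ℝ)..1, delayed τ u x ρ t ^ 2)

end ViscoTransmission

end

/-! The energy dissipates only part of itself: for `t > τ`, `E' ≤ -c₀ (‖u_t(t)‖² + ‖u_t(t - τ)‖²) +
½ ∫ g' □ u_x`, with `c₀ > 0` exactly because of the range of `ζ`. The strain `u_x` and the whole
undamped part `v` have to be recovered from other functionals. The Lyapunov functional is `L = N E +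
α β₀ D - F + J`.

The virial `D = ∫ u u_t + ∫ v v_t` produces `-β ‖u_x‖² - b ‖v_x‖²` at the price of `‖u_t‖² +
‖v_t‖²`. The multiplier functional is `F = α ∫ u_t q σ + b ∫ v_t q v_x`, where `σ = a u_x - g * u_x`
is the stress. The weight `q` is continuous and affine on each of the three intervals, with slope
`1` on `Ω` and slope `-κ` on `(L₁, L₂)`, where `κ = (L₁ + L₃ - L₂) / (2 (L₂ - L₁))`. Then `-F'`
contains `-κ/2 (b² ‖v_x‖² + b ‖v_t‖²)` at the price of `α/2 (‖σ‖² + a ‖u_t‖²)`. Stress and velocity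
are continuous across the interfaces, so the boundary terms there have a good sign when `α ≥ 1` and
`α a ≥ b`; hence `α = max 1 (b / a)`. The balance of `‖v_t‖²` then needs `α β₀ < κ b / 2`, which is
what the two lower bounds on `b` and `a` say together. The balance of `‖u_x‖²` is `-α β₀ β + α β² /
2`, negative once `β ≤ 3/2 β₀`, that is, for large times. Finally `J`, a ramp-weighted integral of
`‖u_t‖²` over the delay window, yields the delay part of the energy.

What remains is `L' ≤ -c E + C₁ (g □ u_x)`. The memory term is not dissipated, but monotonicity of
`ξ` gives `ξ (g □ u_x) ≤ -(g' □ u_x) ≤ -2 E'`, so `ξ L + 2 C₁ E` satisfies a differential inequality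
with rate proportional to `ξ` (`exists_decay_of_lyapunov`).

The argument is run for curves in Hilbert spaces (`CoupledSystem.exists_energy_decay`);
`exists_coupledSystem` shows that a regular solution provides such curves in `L²(Ω)` and `L²(L₁,
L₂)`. The velocity history is only square integrable, so the identities are used for `t > τ`; on the
initial time interval the energy is merely bounded. -/

noncomputable section

namespace ViscoTransmission

/-! ### Convolution in time with a `C¹` kernel. -/

section Kernel

variable {E : Type*} [NormedAddCommGroup E] [NormedSpace ℝ E]

/-- The convolution `∫₀ᵗ g(t - s) f(s) ds` of a scalar kernel with a vector valued curve. -/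
def vconv (g : ℝ → ℝ) (f : ℝ → E) (t : ℝ) : E := ∫ s in (0 : ℝ)..t, g (t - s) • f s

theorem continuous_vconv {g : ℝ → ℝ} {f : ℝ → E} (hg : Continuous g) (hf : Continuous f) :
    Continuous (vconv g f) := by
  unfold vconv
  exact intervalIntegral.continuous_parametric_intervalIntegral_of_continuous
    (f := fun t s => g (t - s) • f s) (by simp only [Function.uncurry_def]; fun_prop) continuous_id

/-- Split `∫₀ʳ = ∫₀ᵗ + ∫ₜʳ`. On the fixed interval one differentiates under the integral sign; on
the short one the kernel may be frozen at `r = t`, up to an error `o(r - t)`. -/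
theorem hasDerivAt_vconv [CompleteSpace E] {g g' : ℝ → ℝ} {f : ℝ → E} (hg : ∀ t, HasDerivAt g (g' t) t)
    (hg' : Continuous g') (hf : Continuous f) (t : ℝ) :
    HasDerivAt (vconv g f) (g 0 • f t + vconv g' f t) t := by
  have hgc : Continuous g := continuous_iff_continuousAt.2 fun t => (hg t).continuousAt
  have hii : ∀ r a b : ℝ, IntervalIntegrable (fun s => g (r - s) • f s) volume a b := fun r a b =>
    (Continuous.intervalIntegrable (by fun_prop) _ _)
  have h1 : HasDerivAt (fun r => ∫ s in (0 : ℝ)..t, g (r - s) • f s) (vconv g' f t) t := by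
    have hcF : Continuous (fun z : ℝ × ℝ => ‖g' (z.1 - z.2) • f z.2‖) := by fun_prop
    obtain ⟨C, hC⟩ := ((isCompact_Icc (a := t - 1) (b := t + 1)).prod
      (isCompact_uIcc (a := (0 : ℝ)) (b := t))).exists_bound_of_continuousOn hcF.continuousOn
    refine (intervalIntegral.hasDerivAt_integral_of_dominated_loc_of_deriv_le (𝕜 := ℝ)
      (F := fun r s => g (r - s) • f s) (F' := fun r s => g' (r - s) • f s)
      (s := Icc (t - 1) (t + 1)) (bound := fun _ => C) (Icc_mem_nhds (by linarith) (by linarith))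
      ?_ (hii _ _ _) ?_ ?_ (by simp) ?_).2
    · exact Eventually.of_forall fun r => (intervalIntegrable_iff.1 (hii r 0 t)).aestronglyMeasurable
    · exact (Continuous.aestronglyMeasurable (by fun_prop))
    · refine Eventually.of_forall fun s hs r hr => ?_
      simpa using hC (r, s) ⟨hr, uIoc_subset_uIcc hs⟩
    · refine Eventually.of_forall fun s _ r _ => ?_
      have := ((hg (r - s)).comp r ((hasDerivAt_id r).sub_const s)).smul_const (f s)
      simpa using this
  have h2 : HasDerivAt (fun r => ∫ s in t..r, g (r - s) • f s) (g 0 • f t) t := by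
    have h3 : HasDerivAt (fun r => ∫ s in t..r, g (t - s) • f s) (g 0 • f t) t := by
      have := intervalIntegral.integral_hasDerivAt_right (hii t t t)
        (Continuous.stronglyMeasurableAtFilter (by fun_prop) _ _)
        (Continuous.continuousAt (by fun_prop : Continuous fun s => g (t - s) • f s))
      simpa using this
    -- The integrand is jointly continuous and vanishes at `r = s = t`, so it is at most `c` on an
    -- interval of length `|r - t|`.
    have h4 : HasDerivAt (fun r => ∫ s in t..r, (g (r - s) - g (t - s)) • f s) 0 t := by
      rw [hasDerivAt_iff_isLittleO]
      simp only [intervalIntegral.integral_same, sub_zero, smul_zero]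
      rw [Asymptotics.isLittleO_iff]
      intro c hc
      have hcF : Continuous (fun z : ℝ × ℝ => (g (z.1 - z.2) - g (t - z.2)) • f z.2) := by fun_prop
      have := hcF.tendsto (t, t)
      simp only [sub_self, zero_smul] at this
      obtain ⟨ε, hε, hball⟩ := Metric.eventually_nhds_iff.1
        ((Metric.tendsto_nhds.1 this) c hc)
      filter_upwards [Metric.ball_mem_nhds t hε] with r hr
      rw [Metric.mem_ball, Real.dist_eq] at hr
      rw [Real.norm_eq_abs]
      refine intervalIntegral.norm_integral_le_of_norm_le_const fun s hs => ?_
      have hs' : |s - t| ≤ |r - t| := abs_sub_left_of_mem_uIcc (uIoc_subset_uIcc hs)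
      have := hball (y := (r, s)) (by
        rw [Prod.dist_eq, Real.dist_eq, Real.dist_eq]
        exact max_lt hr (lt_of_le_of_lt hs' hr))
      rw [dist_zero_right] at this
      exact this.le
    have h5 := h3.add h4
    rw [add_zero] at h5
    refine h5.congr_of_eventuallyEq (Eventually.of_forall fun r => ?_)
    show _ = (∫ s in t..r, g (t - s) • f s) + ∫ s in t..r, (g (r - s) - g (t - s)) • f s
    rw [← intervalIntegral.integral_add (hii _ _ _)
      (Continuous.intervalIntegrable (by fun_prop) _ _)]
    refine intervalIntegral.integral_congr fun s _ => ?_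
    simp only [sub_smul]; abel
  have h6 := h2.add h1
  refine h6.congr_of_eventuallyEq (Eventually.of_forall fun r => ?_)
  show _ = (∫ s in t..r, g (r - s) • f s) + ∫ s in (0 : ℝ)..t, g (r - s) • f s
  rw [add_comm, intervalIntegral.integral_add_adjacent_intervals (hii _ _ _) (hii _ _ _)]
  rfl

theorem integral_kernel_reflect (g : ℝ → ℝ) (t : ℝ) :
    ∫ s in (0 : ℝ)..t, g (t - s) = ∫ s in (0 : ℝ)..t, g s := by
  rw [intervalIntegral.integral_comp_sub_left (fun s => g s) t]; simp

end Kernel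

/-! ### The memory functional and the memory remainder. -/

section Memory

variable {H : Type*} [NormedAddCommGroup H] [InnerProductSpace ℝ H] [CompleteSpace H]

/-- The memory functional `∫₀ᵗ g(t - s) ‖f(t) - f(s)‖² ds` of a curve. -/
def vbox (g : ℝ → ℝ) (f : ℝ → H) (t : ℝ) : ℝ := ∫ s in (0 : ℝ)..t, g (t - s) * ‖f t - f s‖ ^ 2

/-- The memory remainder `∫₀ᵗ g(t - s) (f(t) - f(s)) ds`. -/
def memory (g : ℝ → ℝ) (f : ℝ → H) (t : ℝ) : H := (∫ s in (0 : ℝ)..t, g s) • f t - vconv g f t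

/-- Expanding the square leaves only convolutions, to which `hasDerivAt_vconv` applies; in the
energy the term `(∫ g) ‖f‖²` then cancels against the one in `β ‖f‖²`. -/
theorem vbox_eq {g : ℝ → ℝ} {f : ℝ → H} (hg : Continuous g) (hf : Continuous f) (t : ℝ) :
    vbox g f t = (∫ s in (0 : ℝ)..t, g s) * ‖f t‖ ^ 2 - 2 * inner ℝ (f t) (vconv g f t)
      + vconv g (fun s => ‖f s‖ ^ 2) t := by
  have e1 : (∫ s in (0 : ℝ)..t, g s) * ‖f t‖ ^ 2 = ∫ s in (0 : ℝ)..t, g (t - s) * ‖f t‖ ^ 2 := by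
    rw [intervalIntegral.integral_mul_const, integral_kernel_reflect]
  have e2 : inner ℝ (f t) (vconv g f t) = ∫ s in (0 : ℝ)..t, g (t - s) * inner ℝ (f t) (f s) := by
    have := (innerSL ℝ (f t)).intervalIntegral_comp_comm (μ := volume) (a := 0) (b := t)
      (f := fun s => g (t - s) • f s) (Continuous.intervalIntegrable (by fun_prop) _ _)
    simp only [innerSL_apply_apply, inner_smul_right] at this
    rw [vconv, this]
  rw [e1, e2, vbox, vconv, ← intervalIntegral.integral_const_mul,
    ← intervalIntegral.integral_sub, ← intervalIntegral.integral_add]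
  · congr 1; ext s
    rw [norm_sub_sq_real, smul_eq_mul]; ring
  all_goals exact Continuous.intervalIntegrable (by fun_prop) _ _

theorem memory_eq {g : ℝ → ℝ} {f : ℝ → H} (hg : Continuous g) (hf : Continuous f) (t : ℝ) :
    memory g f t = ∫ s in (0 : ℝ)..t, g (t - s) • (f t - f s) := by
  rw [memory, ← integral_kernel_reflect, ← intervalIntegral.integral_smul_const, vconv,
    ← intervalIntegral.integral_sub]
  · simp only [smul_sub]
  all_goals exact Continuous.intervalIntegrable (by fun_prop) _ _

theorem vbox_nonneg {g : ℝ → ℝ} {f : ℝ → H} (hg : ∀ t, 0 ≤ t → 0 ≤ g t) {t : ℝ} (ht : 0 ≤ t) :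
    0 ≤ vbox g f t :=
  intervalIntegral.integral_nonneg ht fun s hs =>
    mul_nonneg (hg _ (by linarith [hs.2])) (by positivity)

/-- Weighted Cauchy–Schwarz: `∫ g (h - x)²` is a nonnegative quadratic polynomial in `x`, so its
discriminant is nonpositive. -/
theorem sq_integral_mul_le {g h : ℝ → ℝ} {a b : ℝ} (hab : a ≤ b) (hg : Continuous g)
    (hh : Continuous h) (hg0 : ∀ s ∈ Icc a b, 0 ≤ g s) :
    (∫ s in a..b, g s * h s) ^ 2 ≤ (∫ s in a..b, g s) * ∫ s in a..b, g s * h s ^ 2 := by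
  have key : ∀ x : ℝ, 0 ≤ (∫ s in a..b, g s) * (x * x) + (-2 * ∫ s in a..b, g s * h s) * x
      + ∫ s in a..b, g s * h s ^ 2 := by
    intro x
    have h0 : 0 ≤ ∫ s in a..b, g s * (h s - x) ^ 2 :=
      intervalIntegral.integral_nonneg hab fun s hs => mul_nonneg (hg0 s hs) (sq_nonneg _)
    have e : ∫ s in a..b, g s * (h s - x) ^ 2 = (∫ s in a..b, g s) * (x * x)
        + (-2 * ∫ s in a..b, g s * h s) * x + ∫ s in a..b, g s * h s ^ 2 := by
      rw [← intervalIntegral.integral_const_mul, ← intervalIntegral.integral_mul_const,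
        ← intervalIntegral.integral_mul_const, ← intervalIntegral.integral_add,
        ← intervalIntegral.integral_add]
      · congr 1; ext s; ring
      all_goals exact Continuous.intervalIntegrable (by fun_prop) _ _
    rwa [e] at h0
  have := discrim_le_zero key
  rw [discrim] at this
  nlinarith

theorem norm_memory_sq_le {g : ℝ → ℝ} {f : ℝ → H} (hg : Continuous g) (hf : Continuous f)
    (hg0 : ∀ t, 0 ≤ t → 0 ≤ g t) {t : ℝ} (ht : 0 ≤ t) :
    ‖memory g f t‖ ^ 2 ≤ (∫ s in (0 : ℝ)..t, g s) * vbox g f t := by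
  have hpos : ∀ s ∈ Icc 0 t, 0 ≤ g (t - s) := fun s hs => hg0 _ (by linarith [hs.2])
  have h1 : ‖memory g f t‖ ≤ ∫ s in (0 : ℝ)..t, g (t - s) * ‖f t - f s‖ := by
    rw [memory_eq hg hf]
    refine (intervalIntegral.norm_integral_le_integral_norm ht).trans (le_of_eq ?_)
    refine intervalIntegral.integral_congr fun s hs => ?_
    rw [uIcc_of_le ht] at hs
    simp only [norm_smul, Real.norm_eq_abs, abs_of_nonneg (hpos s hs)]
  calc ‖memory g f t‖ ^ 2 ≤ (∫ s in (0 : ℝ)..t, g (t - s) * ‖f t - f s‖) ^ 2 := by gcongr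
    _ ≤ _ := by
      have := sq_integral_mul_le ht (g := fun s => g (t - s)) (h := fun s => ‖f t - f s‖)
        (by fun_prop) (by fun_prop) hpos
      rwa [integral_kernel_reflect] at this

end Memory

/-! ### The abstract system and the derivatives of its functionals. -/

/-- A viscoelastic wave system written with curves in Hilbert spaces: `U, V, A` are the displacement,
velocity and acceleration of the damped part, `P, Q` the strain and its rate; `U', V', A', P', Q'`
(here `Uv, …`) belong to the undamped part. The operators `M` and `Mv` are the multipliers used to
observe the undamped part. -/
structure CoupledSystem {H K : Type*} [NormedAddCommGroup H] [InnerProductSpace ℝ H]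
    [NormedAddCommGroup K] [InnerProductSpace ℝ K]
    (a b μ₁ μ₂ τ α κ c : ℝ) (g : ℝ → ℝ) (M : H →L[ℝ] H) (Mv : K →L[ℝ] K)
    (U V A P Q : ℝ → H) (Uv Vv Av Pv Qv : ℝ → K) : Prop where
  cont_V : Continuous V
  cont_P : Continuous P
  deriv_U : ∀ t, 0 < t → HasDerivAt U (V t) t
  deriv_V : ∀ t, 0 < t → HasDerivAt V (A t) t
  deriv_P : ∀ t, 0 < t → HasDerivAt P (Q t) t
  deriv_Uv : ∀ t, 0 < t → HasDerivAt Uv (Vv t) t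
  deriv_Vv : ∀ t, 0 < t → HasDerivAt Vv (Av t) t
  deriv_Pv : ∀ t, 0 < t → HasDerivAt Pv (Qv t) t
  power : ∀ t, τ < t →
    inner ℝ (A t + μ₁ • V t + μ₂ • V (t - τ)) (V t) + inner ℝ (a • P t - vconv g P t) (Q t)
      + inner ℝ (Av t) (Vv t) + b * inner ℝ (Pv t) (Qv t) = 0
  virial : ∀ t, τ < t →
    inner ℝ (A t + μ₁ • V t + μ₂ • V (t - τ)) (U t) + inner ℝ (a • P t - vconv g P t) (P t)
      + inner ℝ (Av t) (Uv t) + b * inner ℝ (Pv t) (Pv t) = 0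
  multiplier : ∀ t, τ < t →
    -(α * (inner ℝ (A t + μ₁ • V t + μ₂ • V (t - τ)) (M (a • P t - vconv g P t))
        + a * inner ℝ (V t) (M (Q t))))
      - b * (inner ℝ (Av t) (Mv (Pv t)) + inner ℝ (Vv t) (Mv (Qv t)))
    ≤ α / 2 * (‖a • P t - vconv g P t‖ ^ 2 + a * ‖V t‖ ^ 2)
      - κ / 2 * (b ^ 2 * ‖Pv t‖ ^ 2 + b * ‖Vv t‖ ^ 2)
  poincare : ∀ t, τ < t → ‖U t‖ ≤ c * ‖P t‖
  poincare_v : ∀ t, τ < t → ‖Uv t‖ ≤ c * (‖P t‖ + ‖Pv t‖)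
  norm_M : ∀ x, ‖M x‖ ≤ c * ‖x‖
  norm_Mv : ∀ x, ‖Mv x‖ ≤ c * ‖x‖

section Functionals

variable {H K : Type*} [NormedAddCommGroup H] [InnerProductSpace ℝ H] [CompleteSpace H]
  [NormedAddCommGroup K] [InnerProductSpace ℝ K]

/-- The energy of a coupled system. -/
def systemEnergy (a b τ ζ : ℝ) (g : ℝ → ℝ) (V P : ℝ → H) (Vv Pv : ℝ → K) (t : ℝ) : ℝ :=
  1 / 2 * ‖V t‖ ^ 2 + 1 / 2 * (a - ∫ s in (0 : ℝ)..t, g s) * ‖P t‖ ^ 2 + 1 / 2 * vbox g P t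
    + 1 / 2 * (‖Vv t‖ ^ 2 + b * ‖Pv t‖ ^ 2) + ζ / (2 * τ) * ∫ s in (t - τ)..t, ‖V s‖ ^ 2

theorem hasDerivAt_integral_delay {f : ℝ → ℝ} (hf : Continuous f) (τ t : ℝ) :
    HasDerivAt (fun r => ∫ s in (r - τ)..r, f s) (f t - f (t - τ)) t := by
  have h1 : ∀ x, HasDerivAt (fun r => ∫ s in (0 : ℝ)..r, f s) (f x) x := fun x =>
    intervalIntegral.integral_hasDerivAt_right (hf.intervalIntegrable _ _)
      (hf.stronglyMeasurableAtFilter _ _) hf.continuousAt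
  have h2 := (h1 (t - τ)).comp t ((hasDerivAt_id t).sub_const τ)
  have h3 := (h1 t).sub h2
  rw [mul_one] at h3
  refine h3.congr_of_eventuallyEq (Eventually.of_forall fun r => ?_)
  exact (intervalIntegral.integral_interval_sub_left (hf.intervalIntegrable _ _)
    (hf.intervalIntegrable _ _)).symm

/-- The weight is `0` at the old end of the window and `τ` at the new end, and it decreases at unit
speed in `r`. Hence no delayed value appears, and `-∫ f` over the window supplies the decay of the
delay part of the energy. -/
theorem hasDerivAt_integral_ramp {f : ℝ → ℝ} (hf : Continuous f) (τ t : ℝ) :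
    HasDerivAt (fun r => ∫ s in (r - τ)..r, (s - r + τ) * f s)
      (τ * f t - ∫ s in (t - τ)..t, f s) t := by
  have h1 := hasDerivAt_integral_delay (f := fun s => s * f s) (by fun_prop) τ t
  have h2 := ((hasDerivAt_id t).const_sub τ).mul (hasDerivAt_integral_delay hf τ t)
  have h3 := h1.add h2
  have e : t * f t - (t - τ) * f (t - τ)
      + (-1 * (∫ s in (t - τ)..t, f s) + (τ - id t) * (f t - f (t - τ)))
      = τ * f t - ∫ s in (t - τ)..t, f s := by simp only [id]; ring
  rw [e] at h3
  refine h3.congr_of_eventuallyEq (Eventually.of_forall fun r => ?_)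
  simp only [Pi.add_apply, Pi.mul_apply, id]
  rw [← intervalIntegral.integral_const_mul, ← intervalIntegral.integral_add]
  · refine intervalIntegral.integral_congr fun s _ => ?_
    ring
  all_goals exact Continuous.intervalIntegrable (by fun_prop) _ _

variable {a b μ₁ μ₂ τ α κ c : ℝ} {g g' : ℝ → ℝ} {M : H →L[ℝ] H} {Mv : K →L[ℝ] K}
  {U V A P Q : ℝ → H} {Uv Vv Av Pv Qv : ℝ → K}

/-- The power balance removes the acceleration and the strain rate; differentiating the memory
leaves only `½ g' □ P` and `-½ g ‖P‖²`. -/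
theorem hasDerivAt_energy (hg : ∀ t, HasDerivAt g (g' t) t) (hg' : Continuous g') (hτ : 0 < τ)
    (h : CoupledSystem a b μ₁ μ₂ τ α κ c g M Mv U V A P Q Uv Vv Av Pv Qv) (ζ : ℝ) {t : ℝ}
    (ht : τ < t) :
    HasDerivAt (systemEnergy a b τ ζ g V P Vv Pv)
      (-μ₁ * ‖V t‖ ^ 2 - μ₂ * inner ℝ (V (t - τ)) (V t) + 1 / 2 * vbox g' P t
        - 1 / 2 * g t * ‖P t‖ ^ 2 + ζ / (2 * τ) * (‖V t‖ ^ 2 - ‖V (t - τ)‖ ^ 2)) t := by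
  have hgc : Continuous g := continuous_iff_continuousAt.2 fun t => (hg t).continuousAt
  have ht0 : 0 < t := hτ.trans ht
  have hV := h.cont_V
  have hP := h.cont_P
  have d1 := (h.deriv_V t ht0).norm_sq
  have d2 := (h.deriv_P t ht0).norm_sq
  have d3 := (h.deriv_P t ht0).inner ℝ (hasDerivAt_vconv hg hg' hP t)
  have d4 := hasDerivAt_vconv hg hg' (f := fun s => ‖P s‖ ^ 2) (by fun_prop) t
  have d5 := (h.deriv_Vv t ht0).norm_sq
  have d6 := (h.deriv_Pv t ht0).norm_sq
  have d7 := hasDerivAt_integral_delay (f := fun s => ‖V s‖ ^ 2) (by fun_prop) τ t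
  have D := (((((d1.const_mul (1 / 2)).add (d2.const_mul (a / 2))).sub d3).add
    (d4.const_mul (1 / 2))).add ((d5.add (d6.const_mul b)).const_mul (1 / 2))).add
      (d7.const_mul (ζ / (2 * τ)))
  refine (D.congr_of_eventuallyEq (Eventually.of_forall fun r => ?_)).congr_deriv ?_
  · simp only [systemEnergy, Pi.add_apply, Pi.sub_apply]
    rw [vbox_eq hgc hP]
    ring
  have hpow := h.power t ht
  rw [vbox_eq hg' hP]
  have hFTC : ∫ s in (0 : ℝ)..t, g' s = g t - g 0 :=
    intervalIntegral.integral_eq_sub_of_hasDerivAt (fun x _ => hg x) (hg'.intervalIntegrable _ _)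
  rw [hFTC]
  simp only [inner_add_left, inner_add_right, inner_sub_left, real_inner_smul_left,
    real_inner_smul_right, real_inner_self_eq_norm_sq, smul_eq_mul] at hpow ⊢
  linarith [real_inner_comm (V t) (A t), real_inner_comm (vconv g P t) (Q t),
    real_inner_comm (Vv t) (Av t)]

theorem hasDerivAt_virial (hτ : 0 < τ)
    (h : CoupledSystem a b μ₁ μ₂ τ α κ c g M Mv U V A P Q Uv Vv Av Pv Qv) {t : ℝ} (ht : τ < t) :
    HasDerivAt (fun r => inner ℝ (U r) (V r) + inner ℝ (Uv r) (Vv r))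
      (‖V t‖ ^ 2 + ‖Vv t‖ ^ 2 - (a - ∫ s in (0 : ℝ)..t, g s) * ‖P t‖ ^ 2
        - inner ℝ (memory g P t) (P t) - b * ‖Pv t‖ ^ 2
        - μ₁ * inner ℝ (V t) (U t) - μ₂ * inner ℝ (V (t - τ)) (U t)) t := by
  have ht0 : 0 < t := hτ.trans ht
  have D := ((h.deriv_U t ht0).inner ℝ (h.deriv_V t ht0)).add
    ((h.deriv_Uv t ht0).inner ℝ (h.deriv_Vv t ht0))
  refine D.congr_deriv ?_
  have hv := h.virial t ht
  simp only [memory, inner_add_left, inner_sub_left, real_inner_smul_left,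
    real_inner_self_eq_norm_sq] at hv ⊢
  rw [real_inner_comm (A t) (U t), real_inner_comm (Av t) (Uv t)]
  linarith

/-- The stress rate `a Q - g(0) P - g' * P` is regrouped as `a Q - g(t) P + memory g' P`, since `∫₀ᵗ
g' = g(t) - g(0)`. The last term is controlled by `-vbox g'`, which the energy dissipates. -/
theorem hasDerivAt_multiplier (hg : ∀ t, HasDerivAt g (g' t) t) (hg' : Continuous g') (hτ : 0 < τ)
    (h : CoupledSystem a b μ₁ μ₂ τ α κ c g M Mv U V A P Q Uv Vv Av Pv Qv) {t : ℝ} (ht : τ < t) :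
    HasDerivAt (fun r => α * inner ℝ (V r) (M (a • P r - vconv g P r))
        + b * inner ℝ (Vv r) (Mv (Pv r)))
      (α * (inner ℝ (A t) (M (a • P t - vconv g P t)) + a * inner ℝ (V t) (M (Q t))
          - g t * inner ℝ (V t) (M (P t)) + inner ℝ (V t) (M (memory g' P t)))
        + b * (inner ℝ (Av t) (Mv (Pv t)) + inner ℝ (Vv t) (Mv (Qv t)))) t := by
  have ht0 : 0 < t := hτ.trans ht
  have dS := ((h.deriv_P t ht0).const_smul a).sub (hasDerivAt_vconv hg hg' h.cont_P t)
  have D := (((h.deriv_V t ht0).inner ℝ (M.hasFDerivAt.comp_hasDerivAt t dS)).const_mul α).add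
    (((h.deriv_Vv t ht0).inner ℝ (Mv.hasFDerivAt.comp_hasDerivAt t
      (h.deriv_Pv t ht0))).const_mul b)
  refine D.congr_deriv ?_
  have hFTC : ∫ s in (0 : ℝ)..t, g' s = g t - g 0 :=
    intervalIntegral.integral_eq_sub_of_hasDerivAt (fun x _ => hg x) (hg'.intervalIntegrable _ _)
  simp only [memory, hFTC, map_sub, map_add, map_smul, inner_sub_right, inner_add_right,
    real_inner_smul_right, Pi.sub_apply, Pi.smul_apply, Function.comp_apply]
  ring

end Functionals

/-! ### From a Lyapunov functional to decay at the rate `∫ ξ`. -/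

/-- A Lyapunov functional whose dissipation is only delayed by a memory term `B` with
`ξ B ≤ -2 E'` forces decay of the energy at the rate `∫ ξ`. -/
theorem exists_decay_of_lyapunov {ξ E E' L L' B : ℝ → ℝ} {T c C C₁ : ℝ} (hT : 0 < T)
    (hξ0 : ∀ t, 0 ≤ t → 0 ≤ ξ t) (hξ : AntitoneOn ξ (Ici 0)) (hξd : DifferentiableOn ℝ ξ (Ici 0))
    (hE : ∀ t, T ≤ t → HasDerivAt E (E' t) t) (hL : ∀ t, T ≤ t → HasDerivAt L (L' t) t)
    (hc : 0 < c) (hC : 0 < C) (hC₁ : 0 < C₁)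
    (hE0 : ∀ t, T ≤ t → 0 ≤ E t) (hEL : ∀ t, T ≤ t → E t ≤ L t) (hLE : ∀ t, T ≤ t → L t ≤ C * E t)
    (hL' : ∀ t, T ≤ t → L' t ≤ -c * E t + C₁ * B t)
    (hB : ∀ t, T ≤ t → ξ t * B t ≤ -2 * E' t) :
    ∃ γ C₂ : ℝ, 0 < γ ∧ ∀ t, T ≤ t → E t ≤ C₂ * Real.exp (-γ * ∫ s in (0 : ℝ)..t, ξ s) := by
  have hξc : ContinuousOn ξ (Ici 0) := hξd.continuousOn
  have hξi : ∀ x y, 0 ≤ x → 0 ≤ y → IntervalIntegrable ξ volume x y := fun x y hx hy =>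
    (hξc.mono fun s hs => (le_min hx hy).trans hs.1).intervalIntegrable
  have hξ' : ∀ t, T ≤ t → HasDerivAt ξ (deriv ξ t) t ∧ deriv ξ t ≤ 0 := by
    intro t ht
    have h0 : 0 < t := hT.trans_le ht
    have hd := (hξd t h0.le).differentiableAt (Ici_mem_nhds h0)
    refine ⟨hd.hasDerivAt, ?_⟩
    have := hξ.derivWithin_nonpos (x := t)
    rwa [hd.derivWithin ((uniqueDiffOn_Ici (0 : ℝ)) t h0.le)] at this
  have hΞ : ∀ t, T ≤ t → HasDerivAt (fun r => ∫ s in (0 : ℝ)..r, ξ s) (ξ t) t := by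
    intro t ht
    have h0 : 0 < t := hT.trans_le ht
    exact intervalIntegral.integral_hasDerivAt_right (hξi 0 t le_rfl h0.le)
      (hξc.stronglyMeasurableAtFilter_nhdsWithin measurableSet_Ici t |>.filter_mono
        (by rw [nhdsWithin_eq_nhds.2 (Ici_mem_nhds h0)])) (hξc.continuousAt (Ici_mem_nhds h0))
  set K : ℝ := ξ 0 * C + 2 * C₁ with hK
  have hKpos : 0 < K := by
    have := mul_nonneg (hξ0 0 le_rfl) hC.le
    positivity
  set γ : ℝ := c / K with hγ
  have hγ0 : 0 < γ := by positivity
  -- Adding `2 C₁ E` to `ξ L` cancels the memory term: `C₁ ξ B ≤ -2 C₁ E'`. The term `ξ' L` is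
  -- nonpositive, so `Φ' ≤ -c ξ E ≤ -γ ξ Φ`, and `Ψ` below, which carries the integrating factor, is
  -- nonincreasing.
  set Φ : ℝ → ℝ := fun t => ξ t * L t + 2 * C₁ * E t with hΦ
  have hΦK : ∀ t, T ≤ t → Φ t ≤ K * E t := by
    intro t ht
    have h0 : 0 ≤ t := hT.le.trans ht
    have h1 : ξ t ≤ ξ 0 := hξ (mem_Ici.2 le_rfl) h0 h0
    have h2 : ξ t * L t ≤ ξ 0 * (C * E t) :=
      mul_le_mul h1 (hLE t ht) ((hE0 t ht).trans (hEL t ht)) (hξ0 0 le_rfl)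
    simp only [hΦ, hK]; nlinarith
  have hΦd : ∀ t, T ≤ t → HasDerivAt Φ (deriv ξ t * L t + ξ t * L' t + 2 * C₁ * E' t) t :=
    fun t ht => ((hξ' t ht).1.mul (hL t ht)).add ((hE t ht).const_mul (2 * C₁))
  set Ψ : ℝ → ℝ := fun t => Φ t * Real.exp (γ * ∫ s in (0 : ℝ)..t, ξ s) with hΨ
  have hΨd : ∀ t, T ≤ t → HasDerivAt Ψ
      ((deriv ξ t * L t + ξ t * L' t + 2 * C₁ * E' t) * Real.exp (γ * ∫ s in (0 : ℝ)..t, ξ s)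
        + Φ t * (Real.exp (γ * ∫ s in (0 : ℝ)..t, ξ s) * (γ * ξ t))) t :=
    fun t ht => (hΦd t ht).mul (((hΞ t ht).const_mul γ).exp)
  have hΨ' : ∀ t, T ≤ t → ((deriv ξ t * L t + ξ t * L' t + 2 * C₁ * E' t)
      * Real.exp (γ * ∫ s in (0 : ℝ)..t, ξ s)
        + Φ t * (Real.exp (γ * ∫ s in (0 : ℝ)..t, ξ s) * (γ * ξ t))) ≤ 0 := by
    intro t ht
    have hx := Real.exp_pos (γ * ∫ s in (0 : ℝ)..t, ξ s)
    have h0 := hξ0 t (hT.le.trans ht)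
    have h1 : deriv ξ t * L t ≤ 0 :=
      mul_nonpos_of_nonpos_of_nonneg (hξ' t ht).2 ((hE0 t ht).trans (hEL t ht))
    have h2 : ξ t * L' t ≤ ξ t * (-c * E t + C₁ * B t) := mul_le_mul_of_nonneg_left (hL' t ht) h0
    have h3 : C₁ * (ξ t * B t) ≤ C₁ * (-2 * E' t) := mul_le_mul_of_nonneg_left (hB t ht) hC₁.le
    have h4 : Φ t * (γ * ξ t) ≤ c * (ξ t * E t) := by
      have : Φ t * (γ * ξ t) ≤ K * E t * (γ * ξ t) :=
        mul_le_mul_of_nonneg_right (hΦK t ht) (by positivity)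
      have e : K * E t * (γ * ξ t) = c * (ξ t * E t) := by rw [hγ]; field_simp
      linarith
    have h5 : deriv ξ t * L t + ξ t * L' t + 2 * C₁ * E' t + Φ t * (γ * ξ t) ≤ 0 := by linarith
    calc _ = (deriv ξ t * L t + ξ t * L' t + 2 * C₁ * E' t + Φ t * (γ * ξ t))
          * Real.exp (γ * ∫ s in (0 : ℝ)..t, ξ s) := by ring
      _ ≤ 0 := mul_nonpos_of_nonpos_of_nonneg h5 hx.le
  have hanti : AntitoneOn Ψ (Ici T) := by
    refine antitoneOn_of_deriv_nonpos (convex_Ici T)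
      (fun t ht => (hΨd t ht).continuousAt.continuousWithinAt) (fun t ht => ?_) fun t ht => ?_
    · rw [interior_Ici] at ht
      exact (hΨd t (mem_Ioi.1 ht).le).differentiableAt.differentiableWithinAt
    · rw [interior_Ici] at ht
      rw [(hΨd t (mem_Ioi.1 ht).le).deriv]
      exact hΨ' t (mem_Ioi.1 ht).le
  refine ⟨γ, Ψ T / (2 * C₁), hγ0, fun t ht => ?_⟩
  have h1 : Ψ t ≤ Ψ T := hanti (mem_Ici.2 le_rfl) ht ht
  have hx := Real.exp_pos (γ * ∫ s in (0 : ℝ)..t, ξ s)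
  have h2 : 2 * C₁ * E t ≤ Φ t := by
    have := mul_nonneg (hξ0 t (hT.le.trans ht)) ((hE0 t ht).trans (hEL t ht))
    simp only [hΦ]; linarith
  have h3 : 2 * C₁ * E t * Real.exp (γ * ∫ s in (0 : ℝ)..t, ξ s) ≤ Ψ T :=
    (mul_le_mul_of_nonneg_right h2 hx.le).trans h1
  rw [neg_mul, Real.exp_neg, ← div_eq_mul_inv, div_div, le_div_iff₀ (by positivity)]
  linarith

/-! ### The dissipation inequality between numbers. -/

theorem mul_le_young {K η x y : ℝ} (hη : 0 < η) : K * (x * y) ≤ η * y ^ 2 + K ^ 2 / (4 * η) * x ^ 2 := by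
  have h : 0 ≤ (2 * η * y - K * x) ^ 2 / (4 * η) := by positivity
  have e : (2 * η * y - K * x) ^ 2 / (4 * η) = η * y ^ 2 + K ^ 2 / (4 * η) * x ^ 2 - K * (x * y) := by
    field_simp; ring
  linarith

/-- The dissipation inequality behind the Lyapunov functional, as an inequality between numbers. -/
theorem exists_dissipation_constants {a b α β₀ κ c₀ τ K g₀ : ℝ} (ha : 0 < a) (hb : 0 < b) (hα : 0 < α)
    (hβ₀ : 0 < β₀) (hκ : α * β₀ < κ * b / 2) (hc₀ : 0 < c₀) (hτ : 0 < τ) (hK : 0 < K)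
    (hg₀ : 0 < g₀) :
    ∃ N₀ c C : ℝ, 0 < N₀ ∧ 0 < c ∧ 0 < C ∧ ∀ N β v z p r e y q B B' Z : ℝ, N₀ ≤ N → β₀ ≤ β →
      β ≤ 3 / 2 * β₀ → r ^ 2 ≤ a * B → e ^ 2 ≤ g₀ * B' → 0 ≤ B → 0 ≤ B' → 0 ≤ Z →
      N * (-c₀ * (v ^ 2 + z ^ 2) - 1 / 2 * B') + α * β₀ * (v ^ 2 + y ^ 2 - β * p ^ 2 - b * q ^ 2)
        + (α / 2 * (β ^ 2 * p ^ 2 + r ^ 2 + a * v ^ 2) - κ / 2 * (b ^ 2 * q ^ 2 + b * y ^ 2))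
        + (τ * v ^ 2 - Z) + K * (v * p + z * p + r * p + v * r + z * r + v * e)
      ≤ -c * (v ^ 2 + p ^ 2 + y ^ 2 + q ^ 2 + Z) + C * B := by
  -- The strain balance provides `-6 η p²`; the three cross terms with `p` cost `η p²` each, and `-3
  -- η p²` survives.
  set η : ℝ := α * β₀ ^ 2 / 16 with hη
  have hη0 : 0 < η := by positivity
  set Y : ℝ := K ^ 2 / (4 * η) with hY
  have hY0 : 0 < Y := by positivity
  have hκ0 : 0 < κ := by
    by_contra h
    have : κ * b ≤ 0 := mul_nonpos_of_nonpos_of_nonneg (not_lt.1 h) hb.le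
    linarith [mul_pos hα hβ₀]
  -- The four entries are the reserves left for `v²` and `Z`, `p²`, `y²`, and `q²`; the third is
  -- positive by `hκ`.
  set c : ℝ := min (min 1 (3 * η)) (min (κ * b / 2 - α * β₀) (κ * b ^ 2 / 2)) with hc
  have hcpos : 0 < c := by
    refine lt_min (lt_min one_pos (by positivity)) (lt_min (by linarith) (by positivity))
  have c1 : c ≤ 1 := (min_le_left _ _).trans (min_le_left _ _)
  have c2 : c ≤ 3 * η := (min_le_left _ _).trans (min_le_right _ _)
  have c3 : c ≤ κ * b / 2 - α * β₀ := (min_le_right _ _).trans (min_le_left _ _)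
  have c4 : c ≤ κ * b ^ 2 / 2 := (min_le_right _ _).trans (min_le_right _ _)
  -- `N₁` makes the friction absorb all terms in `v²` and `z²`; the additional `K * g₀` in the
  -- witness lets `N B' / 2` absorb `K e² / 2`.
  set N₁ : ℝ := (α * β₀ + α * a / 2 + τ + Y + K + 1) / c₀ with hN₁
  have hN₁0 : 0 < N₁ := by positivity
  refine ⟨N₁ + K * g₀, c, a * (α / 2 + Y + K), by positivity, hcpos, by positivity, ?_⟩
  intro N β v z p r e y q B B' Z hN hβ hβ' hr he hB hB' hZ
  have hNc : α * β₀ + α * a / 2 + τ + Y + K + 1 ≤ N * c₀ := by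
    rw [← div_le_iff₀ hc₀]
    have : 0 < K * g₀ := by positivity
    linarith
  have hNK : K * g₀ ≤ N := by linarith
  have y1 := mul_le_young (K := K) (x := v) (y := p) hη0
  have y2 := mul_le_young (K := K) (x := z) (y := p) hη0
  have y3 := mul_le_young (K := K) (x := r) (y := p) hη0
  have y4 : K * (v * r) ≤ K / 2 * (v ^ 2 + r ^ 2) := by linarith [mul_nonneg hK.le (sq_nonneg (v - r))]
  have y5 : K * (z * r) ≤ K / 2 * (z ^ 2 + r ^ 2) := by linarith [mul_nonneg hK.le (sq_nonneg (z - r))]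
  have y6 : K * (v * e) ≤ K / 2 * (v ^ 2 + e ^ 2) := by linarith [mul_nonneg hK.le (sq_nonneg (v - e))]
  rw [← hY] at y1 y2 y3
  -- On `[β₀, 3/2 β₀]` the concave function `β₀ β - β² / 2` is smallest at the right end, where it
  -- is `3/8 β₀²`.
  have p1 : α * β₀ * (-β * p ^ 2) + α / 2 * (β ^ 2 * p ^ 2) ≤ -(6 * η) * p ^ 2 := by
    have : 3 / 8 * β₀ ^ 2 ≤ β₀ * β - β ^ 2 / 2 := by
      linarith [mul_nonneg (sub_nonneg.2 hβ) (sub_nonneg.2 hβ'), mul_le_mul_of_nonneg_left hβ' hβ₀.le]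
    have h2 := mul_le_mul_of_nonneg_left this (mul_nonneg hα.le (sq_nonneg p))
    rw [hη]; linarith
  have e1 : K / 2 * e ^ 2 ≤ N / 2 * B' := by
    have h1 : K / 2 * e ^ 2 ≤ K / 2 * (g₀ * B') := mul_le_mul_of_nonneg_left he (by positivity)
    have h2 : K * g₀ * B' ≤ N * B' := mul_le_mul_of_nonneg_right hNK hB'
    linarith
  have r1 : (α / 2 + Y + K) * r ^ 2 ≤ (α / 2 + Y + K) * (a * B) :=
    mul_le_mul_of_nonneg_left hr (by positivity)
  have v1 : (α * β₀ + α * a / 2 + τ + Y + K + 1) * v ^ 2 ≤ N * c₀ * v ^ 2 :=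
    mul_le_mul_of_nonneg_right hNc (sq_nonneg v)
  have z1 : (α * β₀ + α * a / 2 + τ + Y + K + 1) * z ^ 2 ≤ N * c₀ * z ^ 2 :=
    mul_le_mul_of_nonneg_right hNc (sq_nonneg z)
  have z2 : 0 ≤ (α * β₀ + α * a / 2 + τ + K / 2 + 1) * z ^ 2 := by positivity
  have k1 := mul_le_mul_of_nonneg_right c1 (sq_nonneg v)
  have k2 := mul_le_mul_of_nonneg_right c2 (sq_nonneg p)
  have k3 := mul_le_mul_of_nonneg_right c3 (sq_nonneg y)
  have k4 := mul_le_mul_of_nonneg_right c4 (sq_nonneg q)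
  have k5 := mul_le_mul_of_nonneg_right c1 hZ
  have k6 : 0 ≤ α * β₀ * (b * q ^ 2) := by positivity
  clear_value η Y c N₁
  linarith

/-! ### Decay of the energy of the abstract system. -/

section Decay

variable {H K : Type*} [NormedAddCommGroup H] [InnerProductSpace ℝ H] [CompleteSpace H]
  [NormedAddCommGroup K] [InnerProductSpace ℝ K]
  {a b μ₁ μ₂ τ ζ α κ c β₀ : ℝ} {g g' ξ : ℝ → ℝ} {M : H →L[ℝ] H} {Mv : K →L[ℝ] K}
  {U V A P Q : ℝ → H} {Uv Vv Av Pv Qv : ℝ → K}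

theorem vbox_neg (g : ℝ → ℝ) (f : ℝ → H) (t : ℝ) : vbox (fun s => -g s) f t = -vbox g f t := by
  simp [vbox]

theorem memory_neg (g : ℝ → ℝ) (f : ℝ → H) (t : ℝ) : memory (fun s => -g s) f t = -memory g f t := by
  simp only [memory, vconv, neg_smul, intervalIntegral.integral_neg]; abel

/-- Since `t - s ≤ t` and `ξ` is nonincreasing, `ξ(t) g(t - s) ≤ ξ(t - s) g(t - s) ≤ -g'(t - s)`.
This turns the dissipation of `g'` into control of the memory. -/
theorem mul_vbox_le (hg : Continuous g) (hg' : Continuous g') {f : ℝ → H} (hf : Continuous f)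
    (hg0 : ∀ t, 0 ≤ t → 0 ≤ g t) (hξ : AntitoneOn ξ (Ici 0)) (hgξ : ∀ t, 0 ≤ t → g' t ≤ -ξ t * g t)
    {t : ℝ} (ht : 0 ≤ t) : ξ t * vbox g f t ≤ -vbox g' f t := by
  rw [vbox, vbox, ← intervalIntegral.integral_const_mul, ← intervalIntegral.integral_neg]
  refine intervalIntegral.integral_mono_on ht
    (Continuous.intervalIntegrable (by fun_prop) _ _)
    (Continuous.intervalIntegrable (by fun_prop) _ _) fun s hs => ?_
  have h0 : 0 ≤ t - s := by linarith [hs.2]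
  have h1 : ξ t * g (t - s) ≤ -g' (t - s) := by
    have := mul_le_mul_of_nonneg_right (hξ h0 ht (by linarith [hs.1] : t - s ≤ t)) (hg0 _ h0)
    linarith [hgξ _ h0]
  have := mul_le_mul_of_nonneg_right h1 (sq_nonneg ‖f t - f s‖)
  linarith

/-- Cauchy–Schwarz for the nonnegative kernel `-g'`, whose mass on `[0, t]` is `g 0 - g t ≤ g 0`. -/
theorem norm_memory_deriv_sq_le (hg : ∀ t, HasDerivAt g (g' t) t) (hg' : Continuous g')
    {f : ℝ → H} (hf : Continuous f) (hg0 : ∀ t, 0 ≤ t → 0 ≤ g t) (hg'0 : ∀ t, 0 ≤ t → g' t ≤ 0)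
    {t : ℝ} (ht : 0 ≤ t) : ‖memory g' f t‖ ^ 2 ≤ g 0 * -vbox g' f t := by
  have h := norm_memory_sq_le (g := fun s => -g' s) (f := f) hg'.neg hf
    (fun t ht => by simpa using hg'0 t ht) ht
  have h0 := vbox_nonneg (g := fun s => -g' s) (f := f) (fun t ht => by simpa using hg'0 t ht) ht
  rw [memory_neg, norm_neg, vbox_neg] at h
  rw [vbox_neg] at h0
  have hFTC : ∫ s in (0 : ℝ)..t, g' s = g t - g 0 :=
    intervalIntegral.integral_eq_sub_of_hasDerivAt (fun x _ => hg x) (hg'.intervalIntegrable _ _)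
  rw [intervalIntegral.integral_neg, hFTC] at h
  exact h.trans (mul_le_mul_of_nonneg_right (by linarith [hg0 t ht]) h0)

theorem neg_inner_le (x y : H) : -inner ℝ x y ≤ ‖x‖ * ‖y‖ := by
  have := abs_real_inner_le_norm x y
  linarith [neg_abs_le (inner ℝ x y)]

/-- Young's inequality splits the delayed friction evenly between `V t` and `V (t - τ)`. Both
entries of the minimum are positive exactly when `τ μ₂ < ζ < τ (2 μ₁ - μ₂)`. -/
theorem CoupledSystem.energy_deriv_le
    (hμ₂ : 0 < μ₂) (hg0 : ∀ t, 0 ≤ t → 0 ≤ g t) {t : ℝ} (ht : 0 ≤ t) :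
    -μ₁ * ‖V t‖ ^ 2 - μ₂ * inner ℝ (V (t - τ)) (V t) + 1 / 2 * vbox g' P t
        - 1 / 2 * g t * ‖P t‖ ^ 2 + ζ / (2 * τ) * (‖V t‖ ^ 2 - ‖V (t - τ)‖ ^ 2)
      ≤ -min (μ₁ - μ₂ / 2 - ζ / (2 * τ)) (ζ / (2 * τ) - μ₂ / 2)
          * (‖V t‖ ^ 2 + ‖V (t - τ)‖ ^ 2) - 1 / 2 * -vbox g' P t := by
  have h1 := mul_le_mul_of_nonneg_left (neg_inner_le (V (t - τ)) (V t)) hμ₂.le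
  have h2 : μ₂ * (‖V (t - τ)‖ * ‖V t‖) ≤ μ₂ / 2 * (‖V (t - τ)‖ ^ 2 + ‖V t‖ ^ 2) := by
    linarith [mul_nonneg hμ₂.le (sq_nonneg (‖V (t - τ)‖ - ‖V t‖))]
  have h3 := mul_nonneg (hg0 t ht) (sq_nonneg ‖P t‖)
  have h4 := mul_le_mul_of_nonneg_right
    (min_le_left (μ₁ - μ₂ / 2 - ζ / (2 * τ)) (ζ / (2 * τ) - μ₂ / 2)) (sq_nonneg ‖V t‖)
  have h5 := mul_le_mul_of_nonneg_right
    (min_le_right (μ₁ - μ₂ / 2 - ζ / (2 * τ)) (ζ / (2 * τ) - μ₂ / 2)) (sq_nonneg ‖V (t - τ)‖)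
  linarith

theorem CoupledSystem.virial_deriv_le (hμ₁ : 0 < μ₁) (hμ₂ : 0 < μ₂)
    (h : CoupledSystem a b μ₁ μ₂ τ α κ c g M Mv U V A P Q Uv Vv Av Pv Qv) {t : ℝ} (ht : τ < t) :
    ‖V t‖ ^ 2 + ‖Vv t‖ ^ 2 - (a - ∫ s in (0 : ℝ)..t, g s) * ‖P t‖ ^ 2
        - inner ℝ (memory g P t) (P t) - b * ‖Pv t‖ ^ 2
        - μ₁ * inner ℝ (V t) (U t) - μ₂ * inner ℝ (V (t - τ)) (U t)
      ≤ ‖V t‖ ^ 2 + ‖Vv t‖ ^ 2 - (a - ∫ s in (0 : ℝ)..t, g s) * ‖P t‖ ^ 2 - b * ‖Pv t‖ ^ 2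
        + (‖memory g P t‖ * ‖P t‖ + μ₁ * c * (‖V t‖ * ‖P t‖)
          + μ₂ * c * (‖V (t - τ)‖ * ‖P t‖)) := by
  have hU := h.poincare t ht
  have h1 := neg_inner_le (memory g P t) (P t)
  have h2 : -inner ℝ (V t) (U t) ≤ ‖V t‖ * (c * ‖P t‖) := (neg_inner_le _ _).trans (by gcongr)
  have h3 : -inner ℝ (V (t - τ)) (U t) ≤ ‖V (t - τ)‖ * (c * ‖P t‖) :=
    (neg_inner_le _ _).trans (by gcongr)
  have h2' := mul_le_mul_of_nonneg_left h2 hμ₁.le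
  have h3' := mul_le_mul_of_nonneg_left h3 hμ₂.le
  linarith

/-- With the stress written as `β P + memory g P`, the main part is kept sharp, because its
constants have to be compared with the virial. Everything else is a product containing a small or
dissipated factor, for which crude constants suffice. -/
theorem CoupledSystem.neg_multiplier_deriv_le (hα : 0 < α) (hμ₁ : 0 < μ₁) (hμ₂ : 0 < μ₂) (hc : 0 < c)
    (h : CoupledSystem a b μ₁ μ₂ τ α κ c g M Mv U V A P Q Uv Vv Av Pv Qv) {t : ℝ} (ht : τ < t)
    (hgt : 0 ≤ g t) (hg0 : g t ≤ g 0) (hβ : 0 ≤ a - ∫ s in (0 : ℝ)..t, g s)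
    (hβa : a - ∫ s in (0 : ℝ)..t, g s ≤ a) :
    -(α * (inner ℝ (A t) (M (a • P t - vconv g P t)) + a * inner ℝ (V t) (M (Q t))
          - g t * inner ℝ (V t) (M (P t)) + inner ℝ (V t) (M (memory g' P t)))
        + b * (inner ℝ (Av t) (Mv (Pv t)) + inner ℝ (Vv t) (Mv (Qv t))))
      ≤ (α / 2 * ((a - ∫ s in (0 : ℝ)..t, g s) ^ 2 * ‖P t‖ ^ 2 + ‖memory g P t‖ ^ 2
            + a * ‖V t‖ ^ 2)
          - κ / 2 * (b ^ 2 * ‖Pv t‖ ^ 2 + b * ‖Vv t‖ ^ 2))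
        + (α * a * (‖memory g P t‖ * ‖P t‖) + α * c * (μ₁ * a + g 0) * (‖V t‖ * ‖P t‖)
          + α * c * μ₂ * a * (‖V (t - τ)‖ * ‖P t‖) + α * c * μ₁ * (‖V t‖ * ‖memory g P t‖)
          + α * c * μ₂ * (‖V (t - τ)‖ * ‖memory g P t‖)
          + α * c * (‖V t‖ * ‖memory g' P t‖)) := by
  set β := a - ∫ s in (0 : ℝ)..t, g s with hβdef
  have hS : a • P t - vconv g P t = β • P t + memory g P t := by
    rw [memory, hβdef, sub_smul]; abel
  have hm := h.multiplier t ht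
  rw [hS] at hm ⊢
  have hn : ‖β • P t + memory g P t‖ ^ 2 ≤ β ^ 2 * ‖P t‖ ^ 2
      + 2 * a * (‖memory g P t‖ * ‖P t‖) + ‖memory g P t‖ ^ 2 := by
    have h1 : ‖β • P t + memory g P t‖ ≤ β * ‖P t‖ + ‖memory g P t‖ := by
      refine (norm_add_le _ _).trans ?_
      rw [norm_smul, Real.norm_of_nonneg hβ]
    have h2 := mul_self_le_mul_self (norm_nonneg _) h1
    have h3 := mul_le_mul_of_nonneg_right hβa
      (mul_nonneg (norm_nonneg (memory g P t)) (norm_nonneg (P t)))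
    linarith
  have hn' := mul_le_mul_of_nonneg_left hn (by positivity : 0 ≤ α / 2)
  have hMP : ∀ x : H, inner ℝ x (M (P t)) ≤ c * (‖x‖ * ‖P t‖) := fun x =>
    (real_inner_le_norm _ _).trans (by
      have := mul_le_mul_of_nonneg_left (h.norm_M (P t)) (norm_nonneg x); linarith)
  have hMr : ∀ x y : H, inner ℝ x (M y) ≤ c * (‖x‖ * ‖y‖) := fun x y =>
    (real_inner_le_norm _ _).trans (by
      have := mul_le_mul_of_nonneg_left (h.norm_M y) (norm_nonneg x); linarith)
  have hMS : ∀ x : H, inner ℝ x (M (β • P t + memory g P t))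
      ≤ c * a * (‖x‖ * ‖P t‖) + c * (‖x‖ * ‖memory g P t‖) := by
    intro x
    rw [map_add, map_smul, inner_add_right, real_inner_smul_right]
    have h1 := mul_le_mul_of_nonneg_left (hMP x) hβ
    have h2 := mul_le_mul_of_nonneg_right hβa
      (by positivity : 0 ≤ c * (‖x‖ * ‖P t‖))
    linarith [hMr x (memory g P t)]
  have e1 := mul_le_mul_of_nonneg_left (hMS (V t)) (by positivity : 0 ≤ α * μ₁)
  have e2 := mul_le_mul_of_nonneg_left (hMS (V (t - τ))) (by positivity : 0 ≤ α * μ₂)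
  have e3 : α * (g t * inner ℝ (V t) (M (P t))) ≤ α * c * g 0 * (‖V t‖ * ‖P t‖) := by
    have h1 := mul_le_mul_of_nonneg_left (hMP (V t)) (by positivity : 0 ≤ α * g t)
    have h2 := mul_le_mul_of_nonneg_right hg0 (by positivity : 0 ≤ α * (c * (‖V t‖ * ‖P t‖)))
    linarith
  have e4 := mul_le_mul_of_nonneg_left (hMr (V t) (-memory g' P t)) hα.le
  rw [map_neg, inner_neg_right, norm_neg] at e4
  simp only [inner_add_left, real_inner_smul_left] at hm
  linarith

end Decay

section Decay

variable {H K : Type*} [NormedAddCommGroup H] [InnerProductSpace ℝ H] [CompleteSpace H]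
  [NormedAddCommGroup K] [InnerProductSpace ℝ K]
  {a b μ₁ μ₂ τ ζ α κ c β₀ : ℝ} {g g' ξ : ℝ → ℝ} {M : H →L[ℝ] H} {Mv : K →L[ℝ] K}
  {U V A P Q : ℝ → H} {Uv Vv Av Pv Qv : ℝ → K}

/-- Makes `N E` dominate the non-energy terms of the Lyapunov functional for large `N`; the Poincaré
bounds and the boundedness of `M`, `Mv` reduce it to products of energy norms. -/
theorem CoupledSystem.abs_perturbation_le (ha : 0 < a) (hb : 0 < b) (hα : 0 < α) (hβ₀ : 0 < β₀)
    (hc : 0 < c) (h : CoupledSystem a b μ₁ μ₂ τ α κ c g M Mv U V A P Q Uv Vv Av Pv Qv) {t : ℝ}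
    (ht : τ < t) (hβ : 0 ≤ a - ∫ s in (0 : ℝ)..t, g s) (hβa : a - ∫ s in (0 : ℝ)..t, g s ≤ a)
    (hr : ‖memory g P t‖ ^ 2 ≤ a * vbox g P t) :
    |α * β₀ * (inner ℝ (U t) (V t) + inner ℝ (Uv t) (Vv t))
        - (α * inner ℝ (V t) (M (a • P t - vconv g P t)) + b * inner ℝ (Vv t) (Mv (Pv t)))|
      ≤ (α * β₀ * (2 * c) + α * c * (a + 1) + b * c) * (‖V t‖ ^ 2 + ‖P t‖ ^ 2 + vbox g P t
          + ‖Vv t‖ ^ 2 + ‖Pv t‖ ^ 2) := by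
  have hS : a • P t - vconv g P t
      = (a - ∫ s in (0 : ℝ)..t, g s) • P t + memory g P t := by
    rw [memory, sub_smul]; abel
  have hSn : ‖a • P t - vconv g P t‖ ≤ a * ‖P t‖ + ‖memory g P t‖ := by
    rw [hS]
    refine (norm_add_le _ _).trans ?_
    rw [norm_smul, Real.norm_of_nonneg hβ]
    gcongr
  have i1 : |inner ℝ (U t) (V t)| ≤ c * ‖P t‖ * ‖V t‖ :=
    (abs_real_inner_le_norm _ _).trans (by gcongr; exact h.poincare t ht)
  have i2 : |inner ℝ (Uv t) (Vv t)| ≤ c * (‖P t‖ + ‖Pv t‖) * ‖Vv t‖ :=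
    (abs_real_inner_le_norm _ _).trans (by gcongr; exact h.poincare_v t ht)
  have i3 : |inner ℝ (V t) (M (a • P t - vconv g P t))|
      ≤ ‖V t‖ * (c * (a * ‖P t‖ + ‖memory g P t‖)) :=
    (abs_real_inner_le_norm _ _).trans (by gcongr; exact (h.norm_M _).trans (by gcongr))
  have i4 : |inner ℝ (Vv t) (Mv (Pv t))| ≤ ‖Vv t‖ * (c * ‖Pv t‖) :=
    (abs_real_inner_le_norm _ _).trans (by gcongr; exact h.norm_Mv _)
  generalize inner ℝ (U t) (V t) = x₁ at *
  generalize inner ℝ (Uv t) (Vv t) = x₂ at *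
  generalize inner ℝ (V t) (M (a • P t - vconv g P t)) = x₃ at *
  generalize inner ℝ (Vv t) (Mv (Pv t)) = x₄ at *
  have hB : 0 ≤ vbox g P t := by
    have := (sq_nonneg _).trans hr
    exact nonneg_of_mul_nonneg_right this ha
  generalize vbox g P t = B at *
  generalize ‖memory g P t‖ = r at *
  generalize ‖V t‖ = v at *
  generalize ‖P t‖ = p at *
  generalize ‖Vv t‖ = y at *
  generalize ‖Pv t‖ = q at *
  have hA : |α * β₀ * (x₁ + x₂) - (α * x₃ + b * x₄)|
      ≤ α * β₀ * (|x₁| + |x₂|) + (α * |x₃| + b * |x₄|) := by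
    refine (abs_sub _ _).trans (add_le_add ?_ ((abs_add_le _ _).trans ?_))
    · rw [abs_mul, abs_of_pos (by positivity : 0 < α * β₀)]
      exact mul_le_mul_of_nonneg_left (abs_add_le _ _) (by positivity)
    · rw [abs_mul, abs_mul, abs_of_pos hα, abs_of_pos hb]
  have b1 : |x₁| ≤ c * (v ^ 2 + p ^ 2) := by
    linarith [mul_nonneg hc.le (sq_nonneg (v - p)), mul_nonneg hc.le (sq_nonneg v),
      mul_nonneg hc.le (sq_nonneg p)]
  have b2 : |x₂| ≤ c * (p ^ 2 + q ^ 2 + y ^ 2) := by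
    linarith [mul_nonneg hc.le (sq_nonneg (y - p)), mul_nonneg hc.le (sq_nonneg (y - q)),
      mul_nonneg hc.le (sq_nonneg p), mul_nonneg hc.le (sq_nonneg q)]
  have b3 : |x₃| ≤ c * (a + 1) * (v ^ 2 + p ^ 2 + B) := by
    have hca : 0 < c * a := by positivity
    have hcr := mul_le_mul_of_nonneg_left hr hc.le
    linarith [mul_nonneg hca.le (sq_nonneg (v - p)), mul_nonneg hc.le (sq_nonneg (v - r)),
      mul_nonneg hc.le (sq_nonneg p), mul_nonneg hc.le (sq_nonneg v), mul_nonneg hc.le hB,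
      mul_nonneg hca.le (sq_nonneg v), mul_nonneg hca.le (sq_nonneg p), mul_nonneg hca.le hB]
  have b4 : |x₄| ≤ c * (y ^ 2 + q ^ 2) := by
    linarith [mul_nonneg hc.le (sq_nonneg (y - q)), mul_nonneg hc.le (sq_nonneg y),
      mul_nonneg hc.le (sq_nonneg q)]
  set X := v ^ 2 + p ^ 2 + B + y ^ 2 + q ^ 2 with hX
  have s1 : |x₁| + |x₂| ≤ 2 * c * X := by
    have : 0 ≤ c * (v ^ 2 + 2 * B + y ^ 2 + q ^ 2) := by positivity
    rw [hX]; linarith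
  have s3 : |x₃| ≤ c * (a + 1) * X := b3.trans
    (mul_le_mul_of_nonneg_left (by rw [hX]; linarith [sq_nonneg y, sq_nonneg q]) (by positivity))
  have s4 : |x₄| ≤ c * X := b4.trans (by
    rw [hX]; gcongr; linarith [sq_nonneg v, sq_nonneg p])
  have f1 := mul_le_mul_of_nonneg_left s1 (by positivity : 0 ≤ α * β₀)
  have f3 := mul_le_mul_of_nonneg_left s3 hα.le
  have f4 := mul_le_mul_of_nonneg_left s4 hb.le
  linarith

theorem exists_energy_equivalence {a b β₀ e : ℝ} (hb : 0 < b) (hβ₀ : 0 < β₀) (ha : 0 < a)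
    (he : 0 < e) :
    ∃ k C : ℝ, 0 < k ∧ 0 < C ∧ ∀ β v p B y q Z : ℝ, β₀ ≤ β → β ≤ a → 0 ≤ B → 0 ≤ Z →
      k * (v ^ 2 + p ^ 2 + B + y ^ 2 + q ^ 2 + Z)
        ≤ 1 / 2 * v ^ 2 + 1 / 2 * β * p ^ 2 + 1 / 2 * B + 1 / 2 * (y ^ 2 + b * q ^ 2) + e * Z ∧
      1 / 2 * v ^ 2 + 1 / 2 * β * p ^ 2 + 1 / 2 * B + 1 / 2 * (y ^ 2 + b * q ^ 2) + e * Z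
        ≤ C * (v ^ 2 + p ^ 2 + B + y ^ 2 + q ^ 2 + Z) := by
  refine ⟨min (min (1 / 2) (β₀ / 2)) (min (b / 2) e), 1 / 2 + a + b + e, by positivity,
    by positivity, fun β v p B y q Z h1 h2 hB hZ => ⟨?_, ?_⟩⟩
  · set k := min (min (1 / 2) (β₀ / 2)) (min (b / 2) e)
    have c1 : k ≤ 1 / 2 := (min_le_left _ _).trans (min_le_left _ _)
    have c2 : k ≤ β₀ / 2 := (min_le_left _ _).trans (min_le_right _ _)
    have c3 : k ≤ b / 2 := (min_le_right _ _).trans (min_le_left _ _)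
    have c4 : k ≤ e := (min_le_right _ _).trans (min_le_right _ _)
    linarith [mul_le_mul_of_nonneg_right c1 (sq_nonneg v),
      mul_le_mul_of_nonneg_right (c2.trans (by linarith : β₀ / 2 ≤ β / 2)) (sq_nonneg p),
      mul_le_mul_of_nonneg_right c1 hB, mul_le_mul_of_nonneg_right c1 (sq_nonneg y),
      mul_le_mul_of_nonneg_right c3 (sq_nonneg q), mul_le_mul_of_nonneg_right c4 hZ]
  · have := mul_le_mul_of_nonneg_right h2 (sq_nonneg p)
    have h3 : 0 ≤ v ^ 2 + B + y ^ 2 + q ^ 2 + Z := by positivity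
    have h4 : 0 ≤ v ^ 2 + p ^ 2 + B + y ^ 2 + Z := by positivity
    have h5 : 0 ≤ v ^ 2 + p ^ 2 + B + y ^ 2 + q ^ 2 := by positivity
    linarith [sq_nonneg p, sq_nonneg q, mul_nonneg hb.le (sq_nonneg q), mul_nonneg ha.le h3,
      mul_nonneg ha.le (sq_nonneg p), mul_nonneg hb.le h4, mul_nonneg he.le h5]

theorem integral_ramp_bounds {f : ℝ → ℝ} (hf : Continuous f) (hf0 : ∀ s, 0 ≤ f s) {τ : ℝ} (hτ : 0 < τ)
    (t : ℝ) : 0 ≤ ∫ s in (t - τ)..t, (s - t + τ) * f s ∧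
      ∫ s in (t - τ)..t, (s - t + τ) * f s ≤ τ * ∫ s in (t - τ)..t, f s := by
  constructor
  · exact intervalIntegral.integral_nonneg (by linarith) fun s hs =>
      mul_nonneg (by linarith [hs.1]) (hf0 s)
  · rw [← intervalIntegral.integral_const_mul]
    refine intervalIntegral.integral_mono_on (by linarith)
      (Continuous.intervalIntegrable (by fun_prop) _ _)
      (Continuous.intervalIntegrable (by fun_prop) _ _) fun s hs => ?_
    exact mul_le_mul_of_nonneg_right (by linarith [hs.2]) (hf0 s)

/-- General decay of the energy of a coupled system. -/
theorem CoupledSystem.exists_energy_decay (ha : 0 < a) (hb : 0 < b) (hμ₁ : 0 < μ₁) (hμ₂ : 0 < μ₂)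
    (hτ : 0 < τ) (hζ : τ * μ₂ < ζ) (hζ' : ζ < τ * (2 * μ₁ - μ₂)) (hα : 0 < α) (hc : 0 < c)
    (hβ₀ : 0 < β₀) (hκ : α * β₀ < κ * b / 2)
    (hg : ∀ t, HasDerivAt g (g' t) t) (hg' : Continuous g') (hg0 : ∀ t, 0 ≤ t → 0 ≤ g t)
    (hg00 : 0 < g 0)
    (hξ0 : ∀ t, 0 ≤ t → 0 ≤ ξ t) (hξ : AntitoneOn ξ (Ici 0)) (hξd : DifferentiableOn ℝ ξ (Ici 0))
    (hgξ : ∀ t, 0 ≤ t → g' t ≤ -ξ t * g t)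
    (hβ : ∀ t, 0 ≤ t → β₀ ≤ a - ∫ s in (0 : ℝ)..t, g s)
    (hβlim : ∀ᶠ t in atTop, a - ∫ s in (0 : ℝ)..t, g s ≤ 3 / 2 * β₀)
    (h : CoupledSystem a b μ₁ μ₂ τ α κ c g M Mv U V A P Q Uv Vv Av Pv Qv) :
    ∃ T γ C : ℝ, τ < T ∧ 0 < γ ∧ ∀ t, T ≤ t →
      systemEnergy a b τ ζ g V P Vv Pv t ≤ C * Real.exp (-γ * ∫ s in (0 : ℝ)..t, ξ s) := by
  have hgc : Continuous g := continuous_iff_continuousAt.2 fun t => (hg t).continuousAt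
  have hg'0 : ∀ t, 0 ≤ t → g' t ≤ 0 := fun t ht =>
    (hgξ t ht).trans (by rw [neg_mul]; exact neg_nonpos.2 (mul_nonneg (hξ0 t ht) (hg0 t ht)))
  have hganti : AntitoneOn g (Ici 0) :=
    antitoneOn_of_deriv_nonpos (convex_Ici 0) hgc.continuousOn
      (fun t _ => (hg t).differentiableAt.differentiableWithinAt) fun t ht => by
        rw [interior_Ici] at ht
        rw [(hg t).deriv]; exact hg'0 t (mem_Ioi.1 ht).le
  have hG0 : ∀ t, 0 ≤ t → 0 ≤ ∫ s in (0 : ℝ)..t, g s := fun t ht =>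
    intervalIntegral.integral_nonneg ht fun s hs => hg0 s hs.1
  set c₀ := min (μ₁ - μ₂ / 2 - ζ / (2 * τ)) (ζ / (2 * τ) - μ₂ / 2) with hc₀
  have hc₀pos : 0 < c₀ := by
    have e1 : ζ / (2 * τ) < μ₁ - μ₂ / 2 := by rw [div_lt_iff₀ (by positivity)]; linarith
    have e2 : μ₂ / 2 < ζ / (2 * τ) := by rw [lt_div_iff₀ (by positivity)]; linarith
    exact lt_min (by linarith) (by linarith)
  have hζ0 : 0 < ζ := (mul_pos hτ hμ₂).trans hζ
  -- The sum of the coefficients of all cross terms in the virial and multiplier estimates, so that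
  -- a single constant serves for every product.
  set K₁ : ℝ := α * β₀ * (1 + μ₁ * c + μ₂ * c) + α * a + α * c * (μ₁ * a + g 0)
    + α * c * μ₂ * a + α * c * μ₁ + α * c * μ₂ + α * c with hK₁
  have hK₁0 : 0 < K₁ := by positivity
  obtain ⟨N₀, c₁, C₁, hN₀, hc₁, hC₁, hdiss⟩ := exists_dissipation_constants ha hb hα hβ₀ hκ hc₀pos hτ
    hK₁0 hg00
  obtain ⟨k, C₂, hk, hC₂, hequiv⟩ := exists_energy_equivalence hb hβ₀ ha
    (show 0 < ζ / (2 * τ) by positivity)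
  set K₂ : ℝ := α * β₀ * (2 * c) + α * c * (a + 1) + b * c with hK₂
  have hK₂0 : 0 < K₂ := by positivity
  -- `N₀` secures the dissipation inequality, `K₂ / k` absorbs the perturbation, and the extra `1`
  -- gives `E ≤ L`.
  set N : ℝ := N₀ + K₂ / k + 1 with hN
  have hNN₀ : N₀ ≤ N := by
    have : 0 < K₂ / k := by positivity
    linarith
  have hV := h.cont_V
  have hP := h.cont_P
  obtain ⟨T₁, hT₁⟩ := eventually_atTop.1 hβlim
  -- After `T₁` one has `β ≤ 3/2 β₀`; after `τ + 1` the delayed time is positive, so that the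
  -- identities of the system hold.
  set T := max T₁ (τ + 1) with hT
  have hTτ : τ < T := by have := le_max_right T₁ (τ + 1); linarith
  have hT0 : 0 < T := hτ.trans hTτ
  set En := systemEnergy a b τ ζ g V P Vv Pv with hEn
  set X : ℝ → ℝ := fun t => ‖V t‖ ^ 2 + ‖P t‖ ^ 2 + vbox g P t + ‖Vv t‖ ^ 2 + ‖Pv t‖ ^ 2
    + ∫ s in (t - τ)..t, ‖V s‖ ^ 2 with hX
  have hB : ∀ t, T ≤ t → 0 ≤ vbox g P t := fun t ht => vbox_nonneg hg0 (hT0.le.trans ht)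
  have hZ : ∀ t, 0 ≤ ∫ s in (t - τ)..t, ‖V s‖ ^ 2 := fun t =>
    intervalIntegral.integral_nonneg (by linarith) fun s _ => by positivity
  have hXE : ∀ t, T ≤ t → k * X t ≤ En t ∧ En t ≤ C₂ * X t := fun t ht =>
    hequiv _ _ _ _ _ _ _ (hβ t (hT0.le.trans ht)) (by linarith [hG0 t (hT0.le.trans ht)])
      (hB t ht) (hZ t)
  have hX0 : ∀ t, T ≤ t → 0 ≤ X t := fun t ht => by
    have := hB t ht
    have := hZ t
    simp only [hX]; positivity
  have hr : ∀ t, T ≤ t → ‖memory g P t‖ ^ 2 ≤ a * vbox g P t := fun t ht =>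
    (norm_memory_sq_le hgc hP hg0 (hT0.le.trans ht)).trans
      (mul_le_mul_of_nonneg_right (by linarith [hβ t (hT0.le.trans ht)]) (hB t ht))
  set D : ℝ → ℝ := fun r => inner ℝ (U r) (V r) + inner ℝ (Uv r) (Vv r) with hD
  set F : ℝ → ℝ := fun r => α * inner ℝ (V r) (M (a • P r - vconv g P r))
        + b * inner ℝ (Vv r) (Mv (Pv r)) with hF
  set J : ℝ → ℝ := fun r => ∫ s in (r - τ)..r, (s - r + τ) * ‖V s‖ ^ 2 with hJ
  have hpert : ∀ t, T ≤ t → |α * β₀ * D t - F t| ≤ K₂ * X t := fun t ht =>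
    (h.abs_perturbation_le ha hb hα hβ₀ hc (hTτ.trans_le ht)
      (hβ₀.le.trans (hβ t (hT0.le.trans ht))) (by linarith [hG0 t (hT0.le.trans ht)])
      (hr t ht)).trans (mul_le_mul_of_nonneg_left (by simp only [hX]; linarith [hZ t]) hK₂0.le)
  have hJb : ∀ t, 0 ≤ J t ∧ J t ≤ τ * ∫ s in (t - τ)..t, ‖V s‖ ^ 2 := fun t =>
    integral_ramp_bounds (by fun_prop) (fun s => by positivity) hτ t
  have hE0 : ∀ t, T ≤ t → 0 ≤ En t := fun t ht => (mul_nonneg hk.le (hX0 t ht)).trans (hXE t ht).1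
  have hXE' : ∀ t, T ≤ t → X t ≤ En t / k := fun t ht => by
    rw [le_div_iff₀ hk]; linarith [(hXE t ht).1]
  suffices hdecay : ∃ γ C : ℝ, 0 < γ ∧ ∀ t, T ≤ t →
      En t ≤ C * Real.exp (-γ * ∫ s in (0 : ℝ)..t, ξ s) by
    obtain ⟨γ, C, hγ, hdecay⟩ := hdecay
    exact ⟨T, γ, C, hTτ, hγ, hdecay⟩
  -- The dissipation inequality does not bound `vbox g P`, whereas `X` contains it. Replacing its
  -- left-over by `-c₁ X` costs `c₁ * vbox g P`, hence `C₁ + c₁`; `En ≤ C₂ X` then gives the rate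
  -- `c₁ / C₂`.
  refine exists_decay_of_lyapunov (ξ := ξ) (E := En)
    (E' := fun t => -μ₁ * ‖V t‖ ^ 2 - μ₂ * inner ℝ (V (t - τ)) (V t) + 1 / 2 * vbox g' P t
        - 1 / 2 * g t * ‖P t‖ ^ 2 + ζ / (2 * τ) * (‖V t‖ ^ 2 - ‖V (t - τ)‖ ^ 2))
    (L := fun t => N * En t + α * β₀ * D t - F t + J t) (B := vbox g P)
    (T := T) (c := c₁ / C₂) (C := N + (K₂ + τ) / k) (C₁ := C₁ + c₁) hT0 hξ0 hξ hξd
    (fun t ht => hasDerivAt_energy hg hg' hτ h ζ (hTτ.trans_le ht))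
    (fun t ht => ((((hasDerivAt_energy hg hg' hτ h ζ (hTτ.trans_le ht)).const_mul N).add
      ((hasDerivAt_virial hτ h (hTτ.trans_le ht)).const_mul (α * β₀))).sub
        (hasDerivAt_multiplier hg hg' hτ h (hTτ.trans_le ht))).add
          (hasDerivAt_integral_ramp (by fun_prop) τ t))
    (by positivity) (by positivity) (by positivity) hE0
    (fun t ht => ?_) (fun t ht => ?_) (fun t ht => ?_) (fun t ht => ?_)
  · have h1 := neg_le_of_abs_le (hpert t ht)
    have h2 := mul_le_mul_of_nonneg_left (hXE' t ht) hK₂0.le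
    have h3 : K₂ * (En t / k) = K₂ / k * En t := by ring
    have h4 := mul_nonneg hN₀.le (hE0 t ht)
    simp only [hN]
    linarith [(hJb t).1]
  · have h1 := le_of_abs_le (hpert t ht)
    have h2 := mul_le_mul_of_nonneg_left (hXE' t ht) (by positivity : 0 ≤ K₂ + τ)
    have h3 : (K₂ + τ) * (En t / k) = (K₂ + τ) / k * En t := by ring
    have h4 : τ * ∫ s in (t - τ)..t, ‖V s‖ ^ 2 ≤ τ * X t := by
      refine mul_le_mul_of_nonneg_left ?_ hτ.le
      have := hB t ht
      simp only [hX]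
      have : 0 ≤ ‖V t‖ ^ 2 + ‖P t‖ ^ 2 + vbox g P t + ‖Vv t‖ ^ 2 + ‖Pv t‖ ^ 2 := by positivity
      linarith
    linarith [(hJb t).2]
  · have ht0 : 0 ≤ t := hT0.le.trans ht
    have d1 := CoupledSystem.energy_deriv_le (μ₁ := μ₁) (ζ := ζ) (τ := τ) (V := V) (P := P)
      (g' := g') hμ₂ hg0 ht0
    simp only [← hc₀] at d1
    have d2 := h.virial_deriv_le hμ₁ hμ₂ (hTτ.trans_le ht)
    have d3 := h.neg_multiplier_deriv_le (g' := g') hα hμ₁ hμ₂ hc (hTτ.trans_le ht)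
      (hg0 t ht0) (hganti (mem_Ici.2 le_rfl) ht0 ht0) (hβ₀.le.trans (hβ t ht0))
      (by linarith [hG0 t ht0])
    have he := norm_memory_deriv_sq_le hg hg' hP hg0 hg'0 ht0
    have hB' : 0 ≤ -vbox g' P t :=
      nonneg_of_mul_nonneg_right ((sq_nonneg _).trans he) hg00
    have hd := hdiss N (a - ∫ s in (0 : ℝ)..t, g s) ‖V t‖ ‖V (t - τ)‖ ‖P t‖ ‖memory g P t‖
      ‖memory g' P t‖ ‖Vv t‖ ‖Pv t‖ (vbox g P t) (-vbox g' P t) (∫ s in (t - τ)..t, ‖V s‖ ^ 2)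
      hNN₀ (hβ t ht0) (hT₁ t ((le_max_left _ _).trans ht)) (hr t ht) he (hB t ht) hB' (hZ t)
    have d1' := mul_le_mul_of_nonneg_left d1 (by positivity : 0 ≤ N)
    have d2' := mul_le_mul_of_nonneg_left d2 (by positivity : 0 ≤ α * β₀)
    have x : ∀ {k : ℝ} (x : ℝ), 0 ≤ x → k ≤ K₁ → k * x ≤ K₁ * x := fun x hx hk =>
      mul_le_mul_of_nonneg_right hk hx
    have q1 := x (k := α * β₀ * (μ₁ * c) + α * c * (μ₁ * a + g 0)) (‖V t‖ * ‖P t‖) (by positivity) (by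
      have : 0 ≤ α * β₀ * (1 + μ₂ * c) + α * a
        + α * c * μ₂ * a + α * c * μ₁ + α * c * μ₂ + α * c := by positivity
      rw [hK₁]; linarith)
    have q2 := x (k := α * β₀ * (μ₂ * c) + α * c * μ₂ * a) (‖V (t - τ)‖ * ‖P t‖) (by positivity) (by
      have : 0 ≤ α * β₀ * (1 + μ₁ * c) + α * a + α * c * (μ₁ * a + g 0)
        + α * c * μ₁ + α * c * μ₂ + α * c := by positivity
      rw [hK₁]; linarith)
    have q3 := x (k := α * β₀ + α * a) (‖memory g P t‖ * ‖P t‖) (by positivity) (by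
      have : 0 ≤ α * β₀ * (μ₁ * c + μ₂ * c) + α * c * (μ₁ * a + g 0)
        + α * c * μ₂ * a + α * c * μ₁ + α * c * μ₂ + α * c := by positivity
      rw [hK₁]; linarith)
    have q4 := x (k := α * c * μ₁) (‖V t‖ * ‖memory g P t‖) (by positivity) (by
      have : 0 ≤ α * β₀ * (1 + μ₁ * c + μ₂ * c) + α * a + α * c * (μ₁ * a + g 0)
        + α * c * μ₂ * a + α * c * μ₂ + α * c := by positivity
      rw [hK₁]; linarith)
    have q5 := x (k := α * c * μ₂) (‖V (t - τ)‖ * ‖memory g P t‖) (by positivity) (by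
      have : 0 ≤ α * β₀ * (1 + μ₁ * c + μ₂ * c) + α * a + α * c * (μ₁ * a + g 0)
        + α * c * μ₂ * a + α * c * μ₁ + α * c := by positivity
      rw [hK₁]; linarith)
    have q6 := x (k := α * c) (‖V t‖ * ‖memory g' P t‖) (by positivity) (by
      have : 0 ≤ α * β₀ * (1 + μ₁ * c + μ₂ * c) + α * a + α * c * (μ₁ * a + g 0)
        + α * c * μ₂ * a + α * c * μ₁ + α * c * μ₂ := by positivity
      rw [hK₁]; linarith)
    have hfin : c₁ / C₂ * En t ≤ c₁ * X t := by
      have := mul_le_mul_of_nonneg_left (hXE t ht).2 (by positivity : 0 ≤ c₁ / C₂)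
      have e : c₁ / C₂ * (C₂ * X t) = c₁ * X t := by field_simp
      linarith
    simp only [hX] at hfin
    generalize -μ₁ * ‖V t‖ ^ 2 - μ₂ * inner ℝ (V (t - τ)) (V t) + 1 / 2 * vbox g' P t
        - 1 / 2 * g t * ‖P t‖ ^ 2 + ζ / (2 * τ) * (‖V t‖ ^ 2 - ‖V (t - τ)‖ ^ 2) = dE at d1' ⊢
    generalize ‖V t‖ ^ 2 + ‖Vv t‖ ^ 2 - (a - ∫ s in (0 : ℝ)..t, g s) * ‖P t‖ ^ 2
        - inner ℝ (memory g P t) (P t) - b * ‖Pv t‖ ^ 2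
        - μ₁ * inner ℝ (V t) (U t) - μ₂ * inner ℝ (V (t - τ)) (U t) = dD at d2' ⊢
    generalize α * (inner ℝ (A t) (M (a • P t - vconv g P t)) + a * inner ℝ (V t) (M (Q t))
          - g t * inner ℝ (V t) (M (P t)) + inner ℝ (V t) (M (memory g' P t)))
        + b * (inner ℝ (Av t) (Mv (Pv t)) + inner ℝ (Vv t) (Mv (Qv t))) = dF at d3 ⊢
    generalize a - ∫ s in (0 : ℝ)..t, g s = β at *
    clear_value K₁ N c₀
    linarith
  · have hb1 := mul_vbox_le hgc hg' hP hg0 hξ hgξ (hT0.le.trans ht)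
    have d1 := CoupledSystem.energy_deriv_le (μ₁ := μ₁) (ζ := ζ) (τ := τ) (V := V) (P := P)
      (g' := g') hμ₂ hg0 (hT0.le.trans ht)
    have : 0 ≤ c₀ * (‖V t‖ ^ 2 + ‖V (t - τ)‖ ^ 2) := by positivity
    simp only [← hc₀] at d1
    linarith

end Decay

/-! ### Absolutely continuous functions of one variable. -/

/-- `F` is absolutely continuous on `[p, q]` with derivative `f`. -/
def PrimitiveOn (p q : ℝ) (F f : ℝ → ℝ) : Prop :=
  IntervalIntegrable f volume p q ∧ ∀ x ∈ Icc p q, ∀ y ∈ Icc p q, F y - F x = ∫ r in x..y, f r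

namespace PrimitiveOn

variable {p q : ℝ} {F f G h : ℝ → ℝ}

theorem mono_left (hF : PrimitiveOn p q F f) {x y : ℝ} (hx : x ∈ Icc p q) (hy : y ∈ Icc p q)
    (hxy : x ≤ y) : PrimitiveOn x y F f := by
  refine ⟨hF.1.mono_set ?_, fun x' hx' y' hy' => hF.2 _ ⟨hx.1.trans hx'.1, hx'.2.trans hy.2⟩ _
    ⟨hx.1.trans hy'.1, hy'.2.trans hy.2⟩⟩
  rw [uIcc_of_le hxy, uIcc_of_le (hx.1.trans hx.2)]
  exact Icc_subset_Icc hx.1 hy.2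

theorem intervalIntegrable (hF : PrimitiveOn p q F f) {x y : ℝ} (hx : x ∈ Icc p q)
    (hy : y ∈ Icc p q) : IntervalIntegrable f volume x y := by
  refine hF.1.mono_set ?_
  rw [uIcc_of_le (hx.1.trans hx.2)]
  exact uIcc_subset_Icc hx hy

theorem const_mul (hF : PrimitiveOn p q F f) (c : ℝ) :
    PrimitiveOn p q (fun x => c * F x) fun x => c * f x :=
  ⟨hF.1.const_mul c, fun x hx y hy => by
    rw [intervalIntegral.integral_const_mul, ← hF.2 x hx y hy]; ring⟩

theorem sub (hF : PrimitiveOn p q F f) (hG : PrimitiveOn p q G h) :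
    PrimitiveOn p q (fun x => F x - G x) fun x => f x - h x :=
  ⟨hF.1.sub hG.1, fun x hx y hy => by
    rw [intervalIntegral.integral_sub (hF.intervalIntegrable hx hy) (hG.intervalIntegrable hx hy),
      ← hF.2 x hx y hy, ← hG.2 x hx y hy]; ring⟩

theorem congr_ae (hF : PrimitiveOn p q F f) {f' : ℝ → ℝ} (hpq : p ≤ q)
    (h : f =ᵐ[volume.restrict (Ioo p q)] f') : PrimitiveOn p q F f' := by
  have h' : ∀ᵐ x, x ∈ Ioc p q → f x = f' x := by
    rw [← ae_restrict_iff' measurableSet_Ioc, ← restrict_Ioo_eq_restrict_Ioc]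
    exact h
  refine ⟨hF.1.congr_ae ?_, fun x hx y hy => ?_⟩
  · rw [uIoc_of_le hpq]
    rwa [← restrict_Ioo_eq_restrict_Ioc]
  · rw [hF.2 x hx y hy]
    refine intervalIntegral.integral_congr_ae ?_
    filter_upwards [h'] with r hr hr'
    refine hr ⟨?_, ?_⟩
    · exact (le_min hx.1 hy.1).trans_lt hr'.1
    · exact hr'.2.trans (max_le hx.2 hy.2)

theorem continuousOn (hF : PrimitiveOn p q F f) (hpq : p ≤ q) : ContinuousOn F (Icc p q) := by
  have h1 : ContinuousOn (fun x => F p + ∫ r in p..x, f r) (Icc p q) := by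
    have := intervalIntegral.continuousOn_primitive_interval' hF.1 left_mem_uIcc
    rw [uIcc_of_le hpq] at this
    exact continuousOn_const.add this
  refine h1.congr fun x hx => ?_
  simp only
  rw [← hF.2 p ⟨le_rfl, hpq⟩ x hx]; ring

/-- Integration by parts. -/
theorem integral_mul_add (hF : PrimitiveOn p q F f) (hG : PrimitiveOn p q G h) (hpq : p ≤ q) :
    IntervalIntegrable (fun x => f x * G x + F x * h x) volume p q ∧
    ∫ x in p..q, (f x * G x + F x * h x) = F q * G q - F p * G p := by
  have hp : p ∈ Icc p q := ⟨le_rfl, hpq⟩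
  have hq : q ∈ Icc p q := ⟨hpq, le_rfl⟩
  have hI : uIcc p q = Icc p q := uIcc_of_le hpq
  refine ⟨?_, ?_⟩
  · refine (hF.1.mul_continuousOn ?_).add (hG.1.continuousOn_mul ?_) <;> rw [hI]
    · exact hG.continuousOn hpq
    · exact hF.continuousOn hpq
  have hconst : ∀ c : ℝ, AbsolutelyContinuousOnInterval (fun _ : ℝ => c) p q := fun c =>
    (LipschitzWith.const c).lipschitzOnWith.absolutelyContinuousOnInterval
  -- `F` is known only on `[p, q]`, so integration by parts is applied to `F p + ∫ f`, which agrees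
  -- with it there and has derivative `f` almost everywhere.
  have hF1 := (hconst (F p)).fun_add
    (hF.1.absolutelyContinuousOnInterval_intervalIntegral left_mem_uIcc)
  have hG1 := (hconst (G p)).fun_add
    (hG.1.absolutelyContinuousOnInterval_intervalIntegral left_mem_uIcc)
  have key := hF1.integral_deriv_mul_eq_sub hG1
  have eF : ∀ x ∈ Icc p q, F p + ∫ r in p..x, f r = F x := fun x hx => by
    rw [← hF.2 p hp x hx]; ring
  have eG : ∀ x ∈ Icc p q, G p + ∫ r in p..x, h r = G x := fun x hx => by
    rw [← hG.2 p hp x hx]; ring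
  rw [eF q hq, eG q hq, eF p hp, eG p hp] at key
  rw [← key]
  refine intervalIntegral.integral_congr_ae ?_
  filter_upwards [hF.1.ae_hasDerivAt_integral, hG.1.ae_hasDerivAt_integral] with x h1 h2 hx
  have hx' : x ∈ uIcc p q := uIoc_subset_uIcc hx
  have hx2 : x ∈ Icc p q := hI ▸ hx'
  rw [((h1 hx' p left_mem_uIcc).const_add _).deriv, ((h2 hx' p left_mem_uIcc).const_add _).deriv,
    eF x hx2, eG x hx2]

theorem mul (hF : PrimitiveOn p q F f) (hG : PrimitiveOn p q G h) (hpq : p ≤ q) :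
    PrimitiveOn p q (fun x => F x * G x) fun x => f x * G x + F x * h x := by
  refine ⟨(hF.integral_mul_add hG hpq).1, fun x hx y hy => ?_⟩
  rcases le_total x y with hxy | hxy
  · rw [((hF.mono_left hx hy hxy).integral_mul_add (hG.mono_left hx hy hxy) hxy).2]
  · rw [intervalIntegral.integral_symm,
      ((hF.mono_left hy hx hxy).integral_mul_add (hG.mono_left hy hx hxy) hxy).2]
    ring

theorem affine (p q κ d : ℝ) : PrimitiveOn p q (fun x => κ * x + d) fun _ => κ :=
  ⟨by simp, fun x _ y _ => by simp; ring⟩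

/-- The multiplier identity `∫ k F' F = ½ [k F²] - (κ/2) ∫ F²` for an affine weight `k`. -/
theorem integral_affine_mul (hF : PrimitiveOn p q F f) (hpq : p ≤ q) (κ d : ℝ) :
    ∫ x in p..q, f x * ((κ * x + d) * F x)
      = 1 / 2 * ((κ * q + d) * F q ^ 2 - (κ * p + d) * F p ^ 2)
        - κ / 2 * ∫ x in p..q, F x * F x := by
  have h1 := (hF.integral_mul_add ((affine p q κ d).mul hF hpq) hpq).2
  have hc := hF.continuousOn hpq
  have hcu : ContinuousOn F (uIcc p q) := by rwa [uIcc_of_le hpq]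
  have i1 : IntervalIntegrable (fun x => f x * ((κ * x + d) * F x)) volume p q :=
    hF.1.mul_continuousOn (by fun_prop)
  have i2 : IntervalIntegrable (fun x => F x * F x) volume p q :=
    ContinuousOn.intervalIntegrable (by fun_prop)
  have e : ∀ x, f x * ((κ * x + d) * F x) + F x * (κ * F x + (κ * x + d) * f x)
      = 2 * (f x * ((κ * x + d) * F x)) + κ * (F x * F x) := fun x => by ring
  simp only [e] at h1
  rw [intervalIntegral.integral_add (i1.const_mul 2) (i2.const_mul κ),
    intervalIntegral.integral_const_mul, intervalIntegral.integral_const_mul] at h1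
  linarith

end PrimitiveOn

/-! ### `L²` bounds and the Sobolev inequality. -/

/-- The norm of `L²(p, q)`. -/
def l2norm (p q : ℝ) (f : ℝ → ℝ) : ℝ := (eLpNorm f 2 (volume.restrict (Ioo p q))).toReal

theorem integral_abs_le_l2norm {p q : ℝ} (hpq : p ≤ q) {f : ℝ → ℝ}
    (hf : MemLp f 2 (volume.restrict (Ioo p q))) :
    IntervalIntegrable f volume p q ∧ ∫ x in p..q, |f x| ≤ √(q - p) * l2norm p q f := by
  have hi : Integrable f (volume.restrict (Ioo p q)) := hf.integrable (by norm_num)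
  have hi' : IntervalIntegrable f volume p q := by
    rw [intervalIntegrable_iff_integrableOn_Ioo_of_le hpq]; exact hi
  refine ⟨hi', ?_⟩
  have h1 := eLpNorm_le_eLpNorm_mul_rpow_measure_univ (p := 1) (q := 2) (by norm_num) hf.1
  rw [eLpNorm_one_eq_lintegral_enorm] at h1
  have h2 : ∫ x in p..q, |f x| = (∫⁻ x in Ioo p q, ‖f x‖ₑ).toReal := by
    rw [intervalIntegral.integral_of_le hpq, ← restrict_Ioo_eq_restrict_Ioc,
      ← integral_norm_eq_lintegral_enorm hf.1]
    rfl
  rw [h2]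
  have h3 := ENNReal.toReal_mono (by
    refine ENNReal.mul_ne_top hf.2.ne (ENNReal.rpow_ne_top_of_nonneg (by norm_num) ?_)
    simp) h1
  refine h3.trans (le_of_eq ?_)
  rw [ENNReal.toReal_mul, mul_comm, l2norm]
  congr 1
  rw [← ENNReal.toReal_rpow, Measure.restrict_apply_univ, Real.volume_Ioo,
    ENNReal.toReal_ofReal (by linarith), Real.sqrt_eq_rpow]
  norm_num

theorem PrimitiveOn.abs_le_abs_add_integral {p q : ℝ} {F f : ℝ → ℝ} (hF : PrimitiveOn p q F f)
    {x y : ℝ} (hx : x ∈ Icc p q) (hy : y ∈ Icc p q) : |F x| ≤ |F y| + ∫ r in p..q, |f r| := by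
  have h3 : |F x - F y| ≤ ∫ r in p..q, |f r| := by
    rw [hF.2 y hy x hx]
    refine (intervalIntegral.norm_integral_le_abs_integral_norm (f := f)).trans ?_
    simp only [Real.norm_eq_abs]
    have h4 : ∀ {u w : ℝ}, u ∈ Icc p q → w ∈ Icc p q → u ≤ w →
        abs (∫ r in u..w, |f r|) ≤ ∫ r in p..q, |f r| := by
      intro u w hu hw huw
      rw [abs_of_nonneg (intervalIntegral.integral_nonneg huw fun _ _ => abs_nonneg _)]
      exact intervalIntegral.integral_mono_interval hu.1 huw hw.2
        (Eventually.of_forall fun _ => abs_nonneg _) hF.1.abs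
    rcases le_total y x with h | h
    · exact h4 hy hx h
    · rw [intervalIntegral.integral_symm, abs_neg]
      exact h4 hx hy h
  have := abs_sub_abs_le_abs_sub (F x) (F y)
  linarith

/-- The one-dimensional Sobolev inequality. -/
theorem PrimitiveOn.abs_le {p q : ℝ} (hpq : p < q) {F f : ℝ → ℝ} (hF : PrimitiveOn p q F f)
    (h1 : MemLp F 2 (volume.restrict (Ioo p q))) (h2 : MemLp f 2 (volume.restrict (Ioo p q)))
    {x : ℝ} (hx : x ∈ Icc p q) :
    |F x| ≤ √(q - p) / (q - p) * l2norm p q F + √(q - p) * l2norm p q f := by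
  have i1 := integral_abs_le_l2norm hpq.le h1
  have i2 := integral_abs_le_l2norm hpq.le h2
  -- Average `|F x| ≤ |F y| + ∫ |f|` over `y`.
  have h5 := intervalIntegral.integral_mono_on (μ := volume) (a := p) (b := q)
    (f := fun _ => |F x|) (g := fun y => |F y| + ∫ r in p..q, |f r|) hpq.le (by simp)
    (i1.1.abs.add (by simp)) fun y hy => hF.abs_le_abs_add_integral hx hy
  rw [intervalIntegral.integral_add i1.1.abs (by simp)] at h5
  simp only [intervalIntegral.integral_const, smul_eq_mul] at h5
  have hpos : 0 < q - p := by linarith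
  have h6 : |F x| ≤ (∫ y in p..q, |F y|) / (q - p) + ∫ r in p..q, |f r| := by
    rw [div_add' _ _ _ hpos.ne', le_div_iff₀ hpos]; linarith
  refine h6.trans (add_le_add ?_ i2.2)
  rw [div_mul_eq_mul_div]
  exact div_le_div_of_nonneg_right i1.2 hpos.le

theorem PrimitiveOn.abs_le_abs_add {p q : ℝ} (hpq : p ≤ q) {F f : ℝ → ℝ} (hF : PrimitiveOn p q F f)
    (h2 : MemLp f 2 (volume.restrict (Ioo p q))) {x y : ℝ} (hx : x ∈ Icc p q) (hy : y ∈ Icc p q) :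
    |F x| ≤ |F y| + √(q - p) * l2norm p q f := by
  linarith [hF.abs_le_abs_add_integral hx hy, (integral_abs_le_l2norm hpq h2).2]

/-! ### Pointwise continuity and time derivatives of regular functions. -/

section Pointwise

variable {p q : ℝ} {f f' ft ft' : ℝ → ℝ → ℝ}

theorem tendsto_l2norm_zero {ι : Type*} {l : Filter ι} {F : ι → ℝ → ℝ}
    (h : Tendsto (fun i => eLpNorm (F i) 2 (volume.restrict (Ioo p q))) l (𝓝 0)) :
    Tendsto (fun i => l2norm p q (F i)) l (𝓝 0) := by
  exact (ENNReal.tendsto_toReal ENNReal.zero_ne_top).comp h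

/-- The Sobolev inequality for `f(·, s) - f(·, t₀)` makes the convergence in time uniform in `x`;
joint continuity follows from continuity in `x` at the single time `t₀`. -/
theorem continuousOn_of_spaceDeriv (hpq : p < q) (h : HasSpaceDeriv p q f f')
    (hf : L2Continuous p q f) (hf' : L2Continuous p q f') :
    ContinuousOn (fun z : ℝ × ℝ => f z.1 z.2) (Icc p q ×ˢ Ici 0) := by
  rintro ⟨x₀, t₀⟩ ⟨hx₀, ht₀⟩
  have ht₀' : 0 ≤ t₀ := ht₀
  have hc : ContinuousOn (fun x => f x t₀) (Icc p q) :=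
    PrimitiveOn.continuousOn (f := fun x => f' x t₀) (h t₀ ht₀) hpq.le
  have h1 : Tendsto (fun s => √(q - p) / (q - p) * l2norm p q (fun x => f x s - f x t₀)
      + √(q - p) * l2norm p q (fun x => f' x s - f' x t₀)) (𝓝[Ici 0] t₀) (𝓝 0) := by
    have := ((tendsto_l2norm_zero (hf.2 t₀ ht₀)).const_mul (√(q - p) / (q - p))).add
      ((tendsto_l2norm_zero (hf'.2 t₀ ht₀)).const_mul (√(q - p)))
    simpa using this
  rw [ContinuousWithinAt, nhdsWithin_prod_eq]
  have h2 : Tendsto (fun z : ℝ × ℝ => f z.1 z.2 - f z.1 t₀) (𝓝[Icc p q] x₀ ×ˢ 𝓝[Ici 0] t₀)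
      (𝓝 0) := by
    refine squeeze_zero_norm' ?_ (h1.comp tendsto_snd)
    have e1 : ∀ᶠ z : ℝ × ℝ in 𝓝[Icc p q] x₀ ×ˢ 𝓝[Ici 0] t₀, z.1 ∈ Icc p q :=
      tendsto_fst.eventually self_mem_nhdsWithin
    have e2 : ∀ᶠ z : ℝ × ℝ in 𝓝[Icc p q] x₀ ×ˢ 𝓝[Ici 0] t₀, z.2 ∈ Ici (0 : ℝ) :=
      tendsto_snd.eventually self_mem_nhdsWithin
    filter_upwards [e1, e2] with z hz1 hz2
    exact PrimitiveOn.abs_le hpq (PrimitiveOn.sub (h z.2 hz2) (h t₀ ht₀))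
      ((hf.1 _ hz2).sub (hf.1 _ ht₀)) ((hf'.1 _ hz2).sub (hf'.1 _ ht₀)) hz1
  have h3 := h2.add (Tendsto.comp (hc x₀ hx₀) (tendsto_fst (g := 𝓝[Ici 0] t₀)))
  simpa using h3

/-- The Sobolev inequality applied to the error of the difference quotient gives a derivative at
every point, endpoints included. The boundary conditions can therefore be differentiated in time. -/
theorem hasDerivAt_of_spaceDeriv (hpq : p < q) (h : HasSpaceDeriv p q f f')
    (ht : HasSpaceDeriv p q ft ft') (hd : L2HasDeriv p q f ft) (hd' : L2HasDeriv p q f' ft')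
    (hf : L2Continuous p q f) (hf' : L2Continuous p q f') (hft : L2Continuous p q ft)
    (hft' : L2Continuous p q ft') {x t : ℝ} (hx : x ∈ Icc p q) (ht0 : 0 < t) :
    HasDerivAt (f x) (ft x t) t := by
  have hw : HasDerivWithinAt (f x) (ft x t) (Ici 0) t := by
    rw [hasDerivWithinAt_iff_tendsto_slope, tendsto_iff_norm_sub_tendsto_zero]
    have h1 : Tendsto (fun s => √(q - p) / (q - p)
          * l2norm p q (fun x => (s - t)⁻¹ * (f x s - f x t) - ft x t)
        + √(q - p) * l2norm p q (fun x => (s - t)⁻¹ * (f' x s - f' x t) - ft' x t))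
        (𝓝[Ici 0 \ {t}] t) (𝓝 0) := by
      have := ((tendsto_l2norm_zero (hd t ht0.le)).const_mul (√(q - p) / (q - p))).add
        ((tendsto_l2norm_zero (hd' t ht0.le)).const_mul (√(q - p)))
      simpa using this
    refine squeeze_zero' (Eventually.of_forall fun s => norm_nonneg _) ?_ h1
    filter_upwards [self_mem_nhdsWithin] with s hs
    have hs0 : 0 ≤ s := hs.1
    rw [slope_def_field, Real.norm_eq_abs, div_eq_inv_mul]
    exact PrimitiveOn.abs_le hpq
      (((PrimitiveOn.sub (h s hs0) (h t ht0.le)).const_mul (s - t)⁻¹).sub (ht t ht0.le))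
      ((((hf.1 _ hs0).sub (hf.1 _ ht0.le)).const_mul _).sub (hft.1 _ ht0.le))
      ((((hf'.1 _ hs0).sub (hf'.1 _ ht0.le)).const_mul _).sub (hft'.1 _ ht0.le)) hx
  exact hw.hasDerivAt (Ici_mem_nhds ht0)

end Pointwise

/-! ### Functions of `(x, t)` as curves in `L²`. -/

section Curves

variable {ν : Measure ℝ} {f f' h : ℝ → ℝ → ℝ}

/-- The curve `t ↦ f(·, t)` in `L²(ν)`, frozen at `t = 0` for negative times. -/
def l2curve (ν : Measure ℝ) (f : ℝ → ℝ → ℝ) (hf : ∀ t, 0 ≤ t → MemLp (fun x => f x t) 2 ν) (t : ℝ) :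
    Lp ℝ 2 ν :=
  (hf (max t 0) (le_max_right _ _)).toLp (fun x => f x (max t 0))

theorem l2curve_of_nonneg (hf : ∀ t, 0 ≤ t → MemLp (fun x => f x t) 2 ν) {t : ℝ} (ht : 0 ≤ t) :
    l2curve ν f hf t = (hf t ht).toLp (fun x => f x t) := by
  simp only [l2curve, max_eq_left ht]

theorem coeFn_l2curve (hf : ∀ t, 0 ≤ t → MemLp (fun x => f x t) 2 ν) {t : ℝ} (ht : 0 ≤ t) :
    l2curve ν f hf t =ᵐ[ν] fun x => f x t := by
  rw [l2curve_of_nonneg hf ht]; exact MemLp.coeFn_toLp _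

theorem inner_toLp {F G : ℝ → ℝ} (hF : MemLp F 2 ν) (hG : MemLp G 2 ν) :
    inner ℝ (hF.toLp F) (hG.toLp G) = ∫ x, F x * G x ∂ν := by
  rw [L2.inner_def]
  refine integral_congr_ae ?_
  filter_upwards [hF.coeFn_toLp, hG.coeFn_toLp] with x h1 h2
  rw [h1, h2]
  simp [mul_comm]

theorem inner_l2curve (hf : ∀ t, 0 ≤ t → MemLp (fun x => f x t) 2 ν)
    (hh : ∀ t, 0 ≤ t → MemLp (fun x => h x t) 2 ν) {s t : ℝ} (hs : 0 ≤ s) (ht : 0 ≤ t) :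
    inner ℝ (l2curve ν f hf s) (l2curve ν h hh t) = ∫ x, f x s * h x t ∂ν := by
  rw [l2curve_of_nonneg hf hs, l2curve_of_nonneg hh ht, inner_toLp]

theorem norm_sq_l2curve (hf : ∀ t, 0 ≤ t → MemLp (fun x => f x t) 2 ν) {t : ℝ} (ht : 0 ≤ t) :
    ‖l2curve ν f hf t‖ ^ 2 = ∫ x, f x t ^ 2 ∂ν := by
  rw [← real_inner_self_eq_norm_sq, inner_l2curve hf hf ht ht]
  simp only [sq]

theorem norm_l2curve_sub_sq (hf : ∀ t, 0 ≤ t → MemLp (fun x => f x t) 2 ν) {s t : ℝ} (hs : 0 ≤ s)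
    (ht : 0 ≤ t) : ‖l2curve ν f hf s - l2curve ν f hf t‖ ^ 2 = ∫ x, (f x s - f x t) ^ 2 ∂ν := by
  rw [l2curve_of_nonneg hf hs, l2curve_of_nonneg hf ht, ← MemLp.toLp_sub,
    ← real_inner_self_eq_norm_sq, inner_toLp]
  simp only [Pi.sub_apply, sq]

theorem continuous_l2curve (hf : ∀ t, 0 ≤ t → MemLp (fun x => f x t) 2 ν)
    (hc : ∀ t, 0 ≤ t → Tendsto (fun s => eLpNorm (fun x => f x s - f x t) 2 ν) (𝓝[Ici 0] t) (𝓝 0)) :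
    Continuous (l2curve ν f hf) := by
  have hon : ContinuousOn (l2curve ν f hf) (Ici 0) := by
    intro t ht
    rw [ContinuousWithinAt, tendsto_iff_edist_tendsto_0]
    refine (hc t ht).congr' ?_
    filter_upwards [self_mem_nhdsWithin] with s hs
    rw [l2curve_of_nonneg hf hs, l2curve_of_nonneg hf ht, Lp.edist_toLp_toLp]
    rfl
  have h2 := hon.comp_continuous (f := fun t : ℝ => max t 0) (by fun_prop) fun t => le_max_right t 0
  refine h2.congr fun t => ?_
  simp [l2curve]

theorem hasDerivAt_l2curve (hf : ∀ t, 0 ≤ t → MemLp (fun x => f x t) 2 ν)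
    (hf' : ∀ t, 0 ≤ t → MemLp (fun x => f' x t) 2 ν)
    (hd : ∀ t, 0 ≤ t → Tendsto (fun s => eLpNorm
      (fun x => (s - t)⁻¹ * (f x s - f x t) - f' x t) 2 ν) (𝓝[Ici 0 \ {t}] t) (𝓝 0))
    {t : ℝ} (ht : 0 < t) : HasDerivAt (l2curve ν f hf) (l2curve ν f' hf' t) t := by
  have hw : HasDerivWithinAt (l2curve ν f hf) (l2curve ν f' hf' t) (Ici 0) t := by
    rw [hasDerivWithinAt_iff_tendsto_slope, tendsto_iff_edist_tendsto_0]
    refine (hd t ht.le).congr' ?_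
    filter_upwards [self_mem_nhdsWithin] with s hs
    rw [slope_def_module, l2curve_of_nonneg hf hs.1, l2curve_of_nonneg hf ht.le,
      l2curve_of_nonneg hf' ht.le, ← MemLp.toLp_sub, ← MemLp.toLp_const_smul, Lp.edist_toLp_toLp]
    rfl
  exact hw.hasDerivAt (Ici_mem_nhds ht)

theorem integrable_prod_of_slices [SFinite ν] {G : ℝ → ℝ → ℝ} {a b C : ℝ}
    (hG : AEStronglyMeasurable (fun z : ℝ × ℝ => G z.1 z.2) (ν.prod (volume.restrict (Ioc a b))))
    (h1 : ∀ s ∈ Ioc a b, Integrable (fun x => G x s) ν)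
    (h2 : ∀ s ∈ Ioc a b, ∫ x, ‖G x s‖ ∂ν ≤ C) :
    Integrable (fun z : ℝ × ℝ => G z.1 z.2) (ν.prod (volume.restrict (Ioc a b))) := by
  rw [integrable_prod_iff' hG]
  refine ⟨(ae_restrict_iff' measurableSet_Ioc).2 (Eventually.of_forall h1), ?_⟩
  refine Integrable.mono' (g := fun _ => C) (by simp) hG.norm.prod_swap.integral_prod_right' ?_
  refine (ae_restrict_iff' measurableSet_Ioc).2 (Eventually.of_forall fun s hs => ?_)
  rw [Real.norm_of_nonneg (integral_nonneg fun _ => norm_nonneg _)]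
  exact h2 s hs

end Curves

/-! ### Agreement of vector valued and pointwise time integrals. -/

section Fubini

variable {ν : Measure ℝ} [IsFiniteMeasure ν] {f : ℝ → ℝ → ℝ}

theorem aestronglyMeasurable_prod_mono {a b : ℝ} (ha : 0 ≤ a)
    (hm : AEStronglyMeasurable (fun z : ℝ × ℝ => f z.1 z.2) (ν.prod (volume.restrict (Ioi 0)))) :
    AEStronglyMeasurable (fun z : ℝ × ℝ => f z.1 z.2) (ν.prod (volume.restrict (Ioc a b))) :=
  hm.mono_measure (Measure.prod_mono le_rfl
    (Measure.restrict_mono (fun _ hx => ha.trans_lt hx.1) le_rfl))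

theorem integrable_conv_integrand (hf : ∀ t, 0 ≤ t → MemLp (fun x => f x t) 2 ν)
    (hc : Continuous (l2curve ν f hf))
    (hm : AEStronglyMeasurable (fun z : ℝ × ℝ => f z.1 z.2) (ν.prod (volume.restrict (Ioi 0))))
    {g : ℝ → ℝ} (hg : Continuous g) (t : ℝ) :
    Integrable (fun z : ℝ × ℝ => g (t - z.2) * f z.1 z.2) (ν.prod (volume.restrict (Ioc 0 t))) := by
  -- By `|f| ≤ (1 + f²) / 2` the `L¹` norm of a slice is bounded by a continuous function of `s`,
  -- built from the `L²` norm.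
  obtain ⟨C, hC⟩ := (isCompact_Icc (a := 0) (b := t)).exists_bound_of_continuousOn
    (f := fun s => |g (t - s)| * ((ν.real univ + ‖l2curve ν f hf s‖ ^ 2) / 2))
    (by fun_prop : Continuous _).continuousOn
  have hi : ∀ s, 0 ≤ s → Integrable (fun x => f x s) ν := fun s hs => (hf s hs).integrable (by norm_num)
  refine integrable_prod_of_slices (G := fun x s => g (t - s) * f x s) (C := C) ?_ ?_ ?_
  · exact (Continuous.aestronglyMeasurable (f := fun z : ℝ × ℝ => g (t - z.2)) (by fun_prop)).mul
      (aestronglyMeasurable_prod_mono le_rfl hm)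
  · exact fun s hs => (hi s hs.1.le).const_mul _
  · intro s hs
    refine le_trans ?_ ((le_abs_self _).trans (hC s ⟨hs.1.le, hs.2⟩))
    simp only [norm_mul, Real.norm_eq_abs]
    rw [integral_const_mul]
    refine mul_le_mul_of_nonneg_left ?_ (abs_nonneg _)
    rw [norm_sq_l2curve hf hs.1.le]
    have h2 : Integrable (fun x => f x s ^ 2) ν := (hf s hs.1.le).integrable_sq
    calc ∫ x, |f x s| ∂ν ≤ ∫ x, (1 + f x s ^ 2) / 2 ∂ν := by
          refine integral_mono (hi s hs.1.le).abs (((integrable_const 1).add h2).div_const 2)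
            fun x => ?_
          simp only
          nlinarith [sq_nonneg (|f x s| - 1), sq_abs (f x s)]
      _ = _ := by
          rw [integral_div, integral_add (integrable_const 1) h2]
          simp

/-- Both sides have the same integral over every measurable set: pairing with an indicator commutes
with the Bochner integral, and Fubini does the same for the pointwise convolution. -/
theorem vconv_ae_eq (hf : ∀ t, 0 ≤ t → MemLp (fun x => f x t) 2 ν)
    (hc : Continuous (l2curve ν f hf))
    (hm : AEStronglyMeasurable (fun z : ℝ × ℝ => f z.1 z.2) (ν.prod (volume.restrict (Ioi 0))))
    {g : ℝ → ℝ} (hg : Continuous g) {t : ℝ} (ht : 0 ≤ t) :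
    ⇑(vconv g (l2curve ν f hf) t) =ᵐ[ν] fun x => conv g (f x) t := by
  have hI := integrable_conv_integrand hf hc hm hg t
  have hconv : ∀ x, conv g (f x) t = ∫ s in Ioc 0 t, g (t - s) * f x s := fun x =>
    intervalIntegral.integral_of_le ht
  refine Integrable.ae_eq_of_forall_setIntegral_eq _ _ ((Lp.memLp _).integrable (by norm_num))
    (hI.integral_prod_left.congr (Eventually.of_forall fun x => (hconv x).symm)) fun s hs _ => ?_
  have e1 : ∀ F : Lp ℝ 2 ν, ∫ x in s, F x ∂ν
      = inner ℝ (indicatorConstLp 2 hs (measure_ne_top ν s) (1 : ℝ)) F := fun F =>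
    (L2.inner_indicatorConstLp_one (𝕜 := ℝ) hs (measure_ne_top ν s) F).symm
  rw [e1]
  have e2 := (innerSL ℝ (indicatorConstLp 2 hs (measure_ne_top ν s) (1 : ℝ))).intervalIntegral_comp_comm
    (μ := volume) (a := 0) (b := t) (f := fun r => g (t - r) • l2curve ν f hf r)
    (Continuous.intervalIntegrable (by fun_prop) _ _)
  simp only [innerSL_apply_apply, inner_smul_right] at e2
  rw [vconv, ← e2, intervalIntegral.integral_of_le ht]
  have hI' : Integrable (fun z : ℝ × ℝ => g (t - z.2) * f z.1 z.2)
      ((ν.restrict s).prod (volume.restrict (Ioc 0 t))) :=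
    hI.mono_measure (Measure.prod_mono Measure.restrict_le_self le_rfl)
  simp only [hconv]
  rw [integral_integral_swap (f := fun x r => g (t - r) * f x r) hI']
  refine setIntegral_congr_fun measurableSet_Ioc fun r hr => ?_
  rw [← e1, integral_const_mul]
  congr 1
  exact integral_congr_ae (ae_restrict_of_ae (coeFn_l2curve hf hr.1.le))

theorem vbox_eq_integral (hf : ∀ t, 0 ≤ t → MemLp (fun x => f x t) 2 ν)
    (hc : Continuous (l2curve ν f hf))
    (hm : AEStronglyMeasurable (fun z : ℝ × ℝ => f z.1 z.2) (ν.prod (volume.restrict (Ioi 0))))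
    {g : ℝ → ℝ} (hg : Continuous g) {t : ℝ} (ht : 0 ≤ t) :
    vbox g (l2curve ν f hf) t = ∫ x, box g (f x) t ∂ν := by
  obtain ⟨C, hC⟩ := (isCompact_Icc (a := 0) (b := t)).exists_bound_of_continuousOn
    (f := fun s => |g (t - s)| * ‖l2curve ν f hf t - l2curve ν f hf s‖ ^ 2)
    (by fun_prop : Continuous _).continuousOn
  have hsq : ∀ s, 0 ≤ s → Integrable (fun x => |f x t - f x s| ^ 2) ν := fun s hs => by
    simpa only [sq_abs, Pi.sub_apply] using ((hf t ht).sub (hf s hs)).integrable_sq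
  have hI : Integrable (fun z : ℝ × ℝ => g (t - z.2) * |f z.1 t - f z.1 z.2| ^ 2)
      (ν.prod (volume.restrict (Ioc 0 t))) := by
    refine integrable_prod_of_slices (G := fun x s => g (t - s) * |f x t - f x s| ^ 2) (C := C)
      ?_ ?_ ?_
    · refine (Continuous.aestronglyMeasurable (f := fun z : ℝ × ℝ => g (t - z.2))
        (by fun_prop)).mul ?_
      have h1 : AEStronglyMeasurable (fun z : ℝ × ℝ => f z.1 t)
        (ν.prod (volume.restrict (Ioc 0 t))) := (hf t ht).1.comp_fst
      have := (h1.sub (aestronglyMeasurable_prod_mono (b := t) le_rfl hm)).norm.pow 2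
      exact this
    · exact fun s hs => (hsq s hs.1.le).const_mul _
    · intro s hs
      refine le_trans (le_of_eq ?_) ((le_abs_self _).trans (hC s ⟨hs.1.le, hs.2⟩))
      rw [norm_l2curve_sub_sq hf ht hs.1.le]
      simp only [norm_mul, Real.norm_eq_abs, abs_pow, abs_abs]
      rw [integral_const_mul]
      simp only [sq_abs]
  have hbox : ∀ x, box g (f x) t = ∫ s in Ioc 0 t, g (t - s) * |f x t - f x s| ^ 2 := fun x =>
    intervalIntegral.integral_of_le ht
  simp only [hbox]
  rw [integral_integral_swap (f := fun x s => g (t - s) * |f x t - f x s| ^ 2) hI, vbox,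
    intervalIntegral.integral_of_le ht]
  refine setIntegral_congr_fun measurableSet_Ioc fun s hs => ?_
  rw [norm_l2curve_sub_sq hf ht hs.1.le, integral_const_mul]
  simp only [sq_abs]

theorem integrable_sq_prod (hf : ∀ t, 0 ≤ t → MemLp (fun x => f x t) 2 ν)
    (hc : Continuous (l2curve ν f hf))
    (hm : AEStronglyMeasurable (fun z : ℝ × ℝ => f z.1 z.2) (ν.prod (volume.restrict (Ioi 0))))
    {a b : ℝ} (ha : 0 ≤ a) :
    Integrable (fun z : ℝ × ℝ => f z.1 z.2 ^ 2) (ν.prod (volume.restrict (Ioc a b))) := by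
  obtain ⟨C, hC⟩ := (isCompact_Icc (a := a) (b := b)).exists_bound_of_continuousOn
    (f := fun s => ‖l2curve ν f hf s‖ ^ 2) (by fun_prop : Continuous _).continuousOn
  refine integrable_prod_of_slices (G := fun x s => f x s ^ 2) (C := C) ?_ ?_ ?_
  · exact (aestronglyMeasurable_prod_mono ha hm).pow 2
  · exact fun s hs => (hf s (ha.trans hs.1.le)).integrable_sq
  · intro s hs
    refine le_trans (le_of_eq ?_) ((le_abs_self _).trans (hC s ⟨hs.1.le, hs.2⟩))
    rw [norm_sq_l2curve hf (ha.trans hs.1.le)]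
    simp only [norm_pow, Real.norm_eq_abs, sq_abs]

theorem integral_norm_sq_l2curve (hf : ∀ t, 0 ≤ t → MemLp (fun x => f x t) 2 ν)
    (hc : Continuous (l2curve ν f hf))
    (hm : AEStronglyMeasurable (fun z : ℝ × ℝ => f z.1 z.2) (ν.prod (volume.restrict (Ioi 0))))
    {a b : ℝ} (ha : 0 ≤ a) (hab : a ≤ b) :
    ∫ s in a..b, ‖l2curve ν f hf s‖ ^ 2 = ∫ x, (∫ s in a..b, f x s ^ 2) ∂ν := by
  simp only [intervalIntegral.integral_of_le hab]
  rw [integral_integral_swap (f := fun x s => f x s ^ 2) (integrable_sq_prod hf hc hm ha)]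
  refine setIntegral_congr_fun measurableSet_Ioc fun s hs => ?_
  exact norm_sq_l2curve hf (ha.trans hs.1.le)

end Fubini

/-- The convolution in time of an absolutely continuous function of `x` is absolutely continuous. -/
theorem primitiveOn_conv {p q : ℝ} (hpq : p < q) {f f' : ℝ → ℝ → ℝ} (h : HasSpaceDeriv p q f f')
    (hf : L2Continuous p q f) (hf' : L2Continuous p q f')
    (hm : AEStronglyMeasurable (fun z : ℝ × ℝ => f' z.1 z.2)
      ((volume.restrict (Ioo p q)).prod (volume.restrict (Ioi 0))))
    {g : ℝ → ℝ} (hg : Continuous g) {t : ℝ} (ht : 0 ≤ t) :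
    PrimitiveOn p q (fun x => conv g (f x) t) (fun x => conv g (f' x) t) := by
  have hI := integrable_conv_integrand hf'.1 (continuous_l2curve hf'.1 hf'.2) hm hg t
  have hconv : ∀ x, conv g (f' x) t = ∫ s in Ioc 0 t, g (t - s) * f' x s := fun x =>
    intervalIntegral.integral_of_le ht
  have hii : IntervalIntegrable (fun x => conv g (f' x) t) volume p q := by
    rw [intervalIntegrable_iff_integrableOn_Ioo_of_le hpq.le]
    exact hI.integral_prod_left.congr (Eventually.of_forall fun x => (hconv x).symm)
  have hfc := continuousOn_of_spaceDeriv hpq h hf hf'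
  have hslice : ∀ x ∈ Icc p q, IntervalIntegrable (fun s => g (t - s) * f x s) volume 0 t := by
    intro x hx
    refine ContinuousOn.intervalIntegrable ?_
    rw [uIcc_of_le ht]
    refine ContinuousOn.mul (by fun_prop) ?_
    exact hfc.comp (f := fun s : ℝ => (x, s)) (by fun_prop) fun s hs => ⟨hx, hs.1⟩
  -- Write `f(y, s) - f(x, s)` as an integral of `f'` and exchange the integrations in `s` and in
  -- `x`.
  have main : ∀ x ∈ Icc p q, ∀ y ∈ Icc p q, x ≤ y →
      conv g (f y) t - conv g (f x) t = ∫ r in x..y, conv g (f' r) t := by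
    intro x hx y hy hxy
    rw [conv, conv, ← intervalIntegral.integral_sub (hslice y hy) (hslice x hx)]
    have hle : (volume.restrict (Ioc x y)) ≤ volume.restrict (Ioo p q) := by
      rw [restrict_Ioo_eq_restrict_Ioc]
      exact Measure.restrict_mono (Ioc_subset_Ioc hx.1 hy.2) le_rfl
    have hI' : Integrable (fun z : ℝ × ℝ => g (t - z.2) * f' z.1 z.2)
        ((volume.restrict (Ioc x y)).prod (volume.restrict (Ioc 0 t))) :=
      hI.mono_measure (Measure.prod_mono hle le_rfl)
    rw [intervalIntegral.integral_of_le hxy, intervalIntegral.integral_of_le ht]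
    simp only [hconv]
    rw [integral_integral_swap (f := fun x r => g (t - r) * f' x r) hI']
    refine setIntegral_congr_fun measurableSet_Ioc fun s hs => ?_
    rw [← mul_sub, (h s hs.1.le).2 x hx y hy, integral_const_mul, intervalIntegral.integral_of_le hxy]
  refine ⟨hii, fun x hx y hy => ?_⟩
  rcases le_total x y with hxy | hxy
  · exact main x hx y hy hxy
  · rw [intervalIntegral.integral_symm, ← main y hy x hx hxy]; ring

/-- Subadditivity of the square root; it transfers `L²` bounds from the two components of `Ω` to
`Ω`. -/
theorem eLpNorm_two_add_measure_le {α : Type*} [MeasurableSpace α] (f : α → ℝ) (μ ν : Measure α) :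
    eLpNorm f 2 (μ + ν) ≤ eLpNorm f 2 μ + eLpNorm f 2 ν := by
  simp only [eLpNorm_eq_lintegral_rpow_enorm_toReal two_ne_zero ENNReal.ofNat_ne_top,
    lintegral_add_measure]
  exact ENNReal.rpow_add_le_add_rpow _ _ (by norm_num) (by norm_num)

/-! ### The space `L²(Ω)` of the two-component domain. -/

section Omega

variable {L₁ L₂ L₃ : ℝ}

theorem restrict_Omega (h : L₁ < L₂) : volume.restrict (Omega L₁ L₂ L₃)
    = volume.restrict (Ioo 0 L₁) + volume.restrict (Ioo L₂ L₃) := by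
  refine Measure.restrict_union ?_ measurableSet_Ioo
  rw [Set.disjoint_left]
  exact fun x h1 h2 => by linarith [h1.2, h2.1]

theorem memLp_Omega (h : L₁ < L₂) {F : ℝ → ℝ} (h1 : MemLp F 2 (volume.restrict (Ioo 0 L₁)))
    (h2 : MemLp F 2 (volume.restrict (Ioo L₂ L₃))) :
    MemLp F 2 (volume.restrict (Omega L₁ L₂ L₃)) := by
  rw [restrict_Omega h]
  exact ⟨h1.1.add_measure h2.1,
    (eLpNorm_two_add_measure_le _ _ _).trans_lt (ENNReal.add_lt_top.2 ⟨h1.2, h2.2⟩)⟩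

theorem tendsto_eLpNorm_Omega (h : L₁ < L₂) {ι : Type*} {l : Filter ι} {F : ι → ℝ → ℝ}
    (h1 : Tendsto (fun i => eLpNorm (F i) 2 (volume.restrict (Ioo 0 L₁))) l (𝓝 0))
    (h2 : Tendsto (fun i => eLpNorm (F i) 2 (volume.restrict (Ioo L₂ L₃))) l (𝓝 0)) :
    Tendsto (fun i => eLpNorm (F i) 2 (volume.restrict (Omega L₁ L₂ L₃))) l (𝓝 0) := by
  have h3 := h1.add h2
  rw [add_zero] at h3
  refine tendsto_of_tendsto_of_tendsto_of_le_of_le tendsto_const_nhds h3 (fun _ => zero_le) fun i => ?_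
  rw [restrict_Omega h]
  exact eLpNorm_two_add_measure_le _ _ _

theorem aestronglyMeasurable_prod_Omega (h : L₁ < L₂) {G : ℝ × ℝ → ℝ} {κ : Measure ℝ} [SFinite κ]
    (h1 : AEStronglyMeasurable G ((volume.restrict (Ioo 0 L₁)).prod κ))
    (h2 : AEStronglyMeasurable G ((volume.restrict (Ioo L₂ L₃)).prod κ)) :
    AEStronglyMeasurable G ((volume.restrict (Omega L₁ L₂ L₃)).prod κ) := by
  rw [restrict_Omega h, Measure.add_prod]
  exact h1.add_measure h2

theorem restrict_left_le : volume.restrict (Ioo 0 L₁) ≤ volume.restrict (Omega L₁ L₂ L₃) :=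
  Measure.restrict_mono subset_union_left le_rfl

theorem restrict_right_le : volume.restrict (Ioo L₂ L₃) ≤ volume.restrict (Omega L₁ L₂ L₃) :=
  Measure.restrict_mono subset_union_right le_rfl

theorem integral_Omega (hL₁ : 0 ≤ L₁) (h : L₁ < L₂) (h₂₃ : L₂ ≤ L₃) {F : ℝ → ℝ}
    (hF : Integrable F (volume.restrict (Omega L₁ L₂ L₃))) :
    ∫ x in Omega L₁ L₂ L₃, F x = (∫ x in (0 : ℝ)..L₁, F x) + ∫ x in L₂..L₃, F x := by
  rw [restrict_Omega h, integral_add_measure (hF.mono_measure restrict_left_le)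
    (hF.mono_measure restrict_right_le), intervalIntegral.integral_of_le hL₁,
    intervalIntegral.integral_of_le h₂₃, restrict_Ioo_eq_restrict_Ioc, restrict_Ioo_eq_restrict_Ioc]

instance : IsFiniteMeasure (volume.restrict (Omega L₁ L₂ L₃)) :=
  ⟨by
    rw [Measure.restrict_apply_univ]
    exact (measure_union_le _ _).trans_lt (by simp)⟩

end Omega

/-! ### Multiplication operators on `L²`. -/

section MulOp

variable {ν : Measure ℝ}

theorem memLp_bdd_mul {k F : ℝ → ℝ} {c : ℝ} (hF : MemLp F 2 ν) (hk : AEStronglyMeasurable k ν)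
    (hc : ∀ᵐ x ∂ν, ‖k x‖ ≤ c) : MemLp (fun x => k x * F x) 2 ν :=
  hF.of_le_mul (c := c) (hk.mul hF.1) (by
    filter_upwards [hc] with x hx
    rw [norm_mul]
    exact mul_le_mul_of_nonneg_right hx (norm_nonneg _))

/-- Multiplication by a bounded function on `L²(ν)`. -/
def mulOp (k : ℝ → ℝ) (c : ℝ) (hk : AEStronglyMeasurable k ν) (hc : ∀ᵐ x ∂ν, ‖k x‖ ≤ c) :
    Lp ℝ 2 ν →L[ℝ] Lp ℝ 2 ν :=
  LinearMap.mkContinuous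
    { toFun := fun F => (memLp_bdd_mul (Lp.memLp F) hk hc).toLp (fun x => k x * F x)
      map_add' := fun F G => by
        rw [← MemLp.toLp_add, MemLp.toLp_eq_toLp_iff]
        filter_upwards [Lp.coeFn_add F G] with x hx
        simp only [hx, Pi.add_apply]; ring
      map_smul' := fun r F => by
        rw [RingHom.id_apply, ← MemLp.toLp_const_smul, MemLp.toLp_eq_toLp_iff]
        filter_upwards [Lp.coeFn_smul r F] with x hx
        simp only [hx, Pi.smul_apply, smul_eq_mul]; ring }
    c fun F => by
      refine Lp.norm_le_mul_norm_of_ae_le_mul ?_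
      filter_upwards [MemLp.coeFn_toLp (memLp_bdd_mul (Lp.memLp F) hk hc), hc] with x h1 h2
      simp only [LinearMap.coe_mk, AddHom.coe_mk]
      rw [h1, norm_mul]
      exact mul_le_mul_of_nonneg_right h2 (norm_nonneg _)

theorem norm_mulOp_le {k : ℝ → ℝ} {c : ℝ} (hk : AEStronglyMeasurable k ν)
    (hc : ∀ᵐ x ∂ν, ‖k x‖ ≤ c) (F : Lp ℝ 2 ν) : ‖mulOp k c hk hc F‖ ≤ c * ‖F‖ := by
  refine Lp.norm_le_mul_norm_of_ae_le_mul ?_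
  filter_upwards [MemLp.coeFn_toLp (memLp_bdd_mul (Lp.memLp F) hk hc), hc] with x h1 h2
  change ‖((memLp_bdd_mul (Lp.memLp F) hk hc).toLp (fun x => k x * F x) : Lp ℝ 2 ν) x‖ ≤ _
  rw [h1, norm_mul]
  exact mul_le_mul_of_nonneg_right h2 (norm_nonneg _)

theorem mulOp_toLp {k : ℝ → ℝ} {c : ℝ} (hk : AEStronglyMeasurable k ν)
    (hc : ∀ᵐ x ∂ν, ‖k x‖ ≤ c) {F : ℝ → ℝ} (hF : MemLp F 2 ν) :
    mulOp k c hk hc (hF.toLp F) = (memLp_bdd_mul hF hk hc).toLp (fun x => k x * F x) := by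
  change (memLp_bdd_mul (Lp.memLp (hF.toLp F)) hk hc).toLp (fun x => k x * (hF.toLp F) x) = _
  rw [MemLp.toLp_eq_toLp_iff]
  filter_upwards [hF.coeFn_toLp] with x hx
  rw [hx]

theorem inner_mulOp_toLp {k : ℝ → ℝ} {c : ℝ} (hk : AEStronglyMeasurable k ν)
    (hc : ∀ᵐ x ∂ν, ‖k x‖ ≤ c) {F G : ℝ → ℝ} (hF : MemLp F 2 ν) (hG : MemLp G 2 ν) :
    inner ℝ (hG.toLp G) (mulOp k c hk hc (hF.toLp F)) = ∫ x, G x * (k x * F x) ∂ν := by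
  rw [mulOp_toLp, inner_toLp]

end MulOp

theorem norm_l2curve_le_of_bound {ν : Measure ℝ} [IsFiniteMeasure ν] {f : ℝ → ℝ → ℝ}
    (hf : ∀ t, 0 ≤ t → MemLp (fun x => f x t) 2 ν) {t C : ℝ} (ht : 0 ≤ t) (hC : 0 ≤ C)
    (hb : ∀ᵐ x ∂ν, |f x t| ≤ C) : ‖l2curve ν f hf t‖ ≤ (ν univ).toReal ^ (1 / 2 : ℝ) * C := by
  have := Lp.norm_le_of_ae_bound (f := l2curve ν f hf t) hC (by
    filter_upwards [coeFn_l2curve hf ht, hb] with x h1 h2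
    rw [h1]; exact h2)
  refine this.trans (le_of_eq ?_)
  simp [measureUnivNNReal, ENNReal.coe_toNNReal_eq_toReal]

theorem l2norm_le_norm_l2curve {ν : Measure ℝ} {p q : ℝ} (hle : volume.restrict (Ioo p q) ≤ ν)
    {f : ℝ → ℝ → ℝ} (hf : ∀ t, 0 ≤ t → MemLp (fun x => f x t) 2 ν) {t : ℝ} (ht : 0 ≤ t) :
    l2norm p q (fun x => f x t) ≤ ‖l2curve ν f hf t‖ := by
  rw [l2curve_of_nonneg hf ht, Lp.norm_toLp]
  exact ENNReal.toReal_mono (hf t ht).2.ne (eLpNorm_mono_measure _ hle)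

theorem aestronglyMeasurable_of_continuousOn_strip {p q : ℝ} {f : ℝ → ℝ → ℝ}
    (h : ContinuousOn (fun z : ℝ × ℝ => f z.1 z.2) (Icc p q ×ˢ Ici 0)) :
    AEStronglyMeasurable (fun z : ℝ × ℝ => f z.1 z.2)
      ((volume.restrict (Ioo p q)).prod (volume.restrict (Ioi 0))) := by
  have h1 := h.aestronglyMeasurable (μ := (volume : Measure (ℝ × ℝ)))
    (measurableSet_Icc.prod measurableSet_Ici)
  rw [Measure.volume_eq_prod, ← Measure.prod_restrict] at h1
  exact h1.mono_measure (Measure.prod_mono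
    (Measure.restrict_mono Ioo_subset_Icc_self le_rfl)
    (Measure.restrict_mono Ioi_subset_Ici_self le_rfl))

/-- A kernel that is `C¹` on `[0, ∞)` extends to a `C¹` function on the line. -/
theorem exists_kernel_extension {g : ℝ → ℝ} (hg : ContDiffOn ℝ 1 g (Ici 0)) :
    ∃ G G' : ℝ → ℝ, (∀ t, HasDerivAt G (G' t) t) ∧ Continuous G' ∧
      ∀ t, 0 ≤ t → G t = g t ∧ G' t = derivWithin g (Ici 0) t := by
  have hc : ContinuousOn (derivWithin g (Ici 0)) (Ici 0) :=
    hg.continuousOn_derivWithin (uniqueDiffOn_Ici 0) le_rfl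
  set G' : ℝ → ℝ := fun t => derivWithin g (Ici 0) (max t 0) with hG'
  have hG'c : Continuous G' :=
    hc.comp_continuous (f := fun t : ℝ => max t 0) (by fun_prop) fun t => le_max_right t 0
  refine ⟨fun t => g 0 + ∫ s in (0 : ℝ)..t, G' s, G', fun t => ?_, hG'c, fun t ht => ⟨?_, ?_⟩⟩
  · exact (intervalIntegral.integral_hasDerivAt_right (hG'c.intervalIntegrable _ _)
      (hG'c.stronglyMeasurableAtFilter _ _) hG'c.continuousAt).const_add _
  · have := intervalIntegral.integral_eq_sub_of_hasDerivAt_of_le ht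
      (hg.continuousOn.mono Icc_subset_Ici_self) (f' := G') (fun s hs => ?_)
      (hG'c.intervalIntegrable _ _)
    · simp only [this]; ring
    · have hd : DifferentiableWithinAt ℝ g (Ici 0) s :=
        (hg.differentiableOn one_ne_zero) s hs.1.le
      have := hd.hasDerivWithinAt.hasDerivAt (Ici_mem_nhds hs.1)
      simpa only [hG', max_eq_left hs.1.le] using this
  · simp only [hG', max_eq_left ht]

theorem conv_congr {g G : ℝ → ℝ} (h : ∀ t, 0 ≤ t → G t = g t) (f : ℝ → ℝ) {t : ℝ} (ht : 0 ≤ t) :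
    conv G f t = conv g f t := by
  refine intervalIntegral.integral_congr fun s hs => ?_
  rw [uIcc_of_le ht] at hs
  simp only [h (t - s) (by linarith [hs.2])]

theorem box_congr {g G : ℝ → ℝ} (h : ∀ t, 0 ≤ t → G t = g t) (f : ℝ → ℝ) {t : ℝ} (ht : 0 ≤ t) :
    box G f t = box g f t := by
  refine intervalIntegral.integral_congr fun s hs => ?_
  rw [uIcc_of_le ht] at hs
  simp only [h (t - s) (by linarith [hs.2])]

/-! ### Green's formula and the multiplier identities. -/

section Green

variable {L₁ L₂ L₃ : ℝ}

theorem inner_toLp_interval {p q : ℝ} (hpq : p ≤ q) {F G : ℝ → ℝ}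
    (hF : MemLp F 2 (volume.restrict (Ioo p q))) (hG : MemLp G 2 (volume.restrict (Ioo p q))) :
    inner ℝ (hF.toLp F) (hG.toLp G) = ∫ x in p..q, F x * G x := by
  rw [inner_toLp, intervalIntegral.integral_of_le hpq, restrict_Ioo_eq_restrict_Ioc]

theorem inner_toLp_Omega (hL₁ : 0 ≤ L₁) (h : L₁ < L₂) (h₂₃ : L₂ ≤ L₃) {F G : ℝ → ℝ}
    (hF : MemLp F 2 (volume.restrict (Omega L₁ L₂ L₃)))
    (hG : MemLp G 2 (volume.restrict (Omega L₁ L₂ L₃))) :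
    inner ℝ (hF.toLp F) (hG.toLp G)
      = (∫ x in (0 : ℝ)..L₁, F x * G x) + ∫ x in L₂..L₃, F x * G x := by
  rw [inner_toLp, integral_Omega hL₁ h h₂₃ (F := fun x => F x * G x) (hF.integrable_mul hG)]

theorem memLp_intervalIntegrable_mul {p q : ℝ} (hpq : p ≤ q) {F G : ℝ → ℝ}
    (hF : MemLp F 2 (volume.restrict (Ioo p q))) (hG : MemLp G 2 (volume.restrict (Ioo p q))) :
    IntervalIntegrable (fun x => F x * G x) volume p q := by
  rw [intervalIntegrable_iff_integrableOn_Ioo_of_le hpq]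
  exact hF.integrable_mul hG

theorem green_interval {p q : ℝ} (hpq : p ≤ q) {F f G h : ℝ → ℝ} (hF : PrimitiveOn p q F f)
    (hG : PrimitiveOn p q G h)
    (mF : MemLp F 2 (volume.restrict (Ioo p q))) (mf : MemLp f 2 (volume.restrict (Ioo p q)))
    (mG : MemLp G 2 (volume.restrict (Ioo p q))) (mh : MemLp h 2 (volume.restrict (Ioo p q))) :
    inner ℝ (mf.toLp f) (mG.toLp G) + inner ℝ (mF.toLp F) (mh.toLp h) = F q * G q - F p * G p := by
  rw [inner_toLp_interval hpq, inner_toLp_interval hpq, ← (hF.integral_mul_add hG hpq).2,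
    intervalIntegral.integral_add (memLp_intervalIntegrable_mul hpq mf mG)
      (memLp_intervalIntegrable_mul hpq mF mh)]

theorem green_Omega (hL₁ : 0 ≤ L₁) (hL : L₁ < L₂) (h₂₃ : L₂ ≤ L₃) {F f G h : ℝ → ℝ}
    (hF : PrimitiveOn 0 L₁ F f) (hF' : PrimitiveOn L₂ L₃ F f)
    (hG : PrimitiveOn 0 L₁ G h) (hG' : PrimitiveOn L₂ L₃ G h)
    (mF : MemLp F 2 (volume.restrict (Omega L₁ L₂ L₃)))
    (mf : MemLp f 2 (volume.restrict (Omega L₁ L₂ L₃)))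
    (mG : MemLp G 2 (volume.restrict (Omega L₁ L₂ L₃)))
    (mh : MemLp h 2 (volume.restrict (Omega L₁ L₂ L₃))) :
    inner ℝ (mf.toLp f) (mG.toLp G) + inner ℝ (mF.toLp F) (mh.toLp h)
      = (F L₁ * G L₁ - F 0 * G 0) + (F L₃ * G L₃ - F L₂ * G L₂) := by
  have i1 := fun {F : ℝ → ℝ} (m : MemLp F 2 (volume.restrict (Omega L₁ L₂ L₃))) =>
    m.mono_measure restrict_left_le
  have i2 := fun {F : ℝ → ℝ} (m : MemLp F 2 (volume.restrict (Omega L₁ L₂ L₃))) =>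
    m.mono_measure restrict_right_le
  have e1 := green_interval hL₁ hF hG (i1 mF) (i1 mf) (i1 mG) (i1 mh)
  have e2 := green_interval h₂₃ hF' hG' (i2 mF) (i2 mf) (i2 mG) (i2 mh)
  rw [inner_toLp_interval hL₁, inner_toLp_interval hL₁] at e1
  rw [inner_toLp_interval h₂₃, inner_toLp_interval h₂₃] at e2
  rw [inner_toLp_Omega hL₁ hL h₂₃, inner_toLp_Omega hL₁ hL h₂₃]
  linarith

theorem multiplier_interval {p q κ d c : ℝ} (hpq : p ≤ q) {F f : ℝ → ℝ} (hF : PrimitiveOn p q F f)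
    (mF : MemLp F 2 (volume.restrict (Ioo p q))) (mf : MemLp f 2 (volume.restrict (Ioo p q)))
    (hk : AEStronglyMeasurable (fun x => κ * x + d) (volume.restrict (Ioo p q)))
    (hc : ∀ᵐ x ∂(volume.restrict (Ioo p q)), ‖κ * x + d‖ ≤ c) :
    inner ℝ (mf.toLp f) (mulOp (fun x => κ * x + d) c hk hc (mF.toLp F))
      = 1 / 2 * ((κ * q + d) * F q ^ 2 - (κ * p + d) * F p ^ 2) - κ / 2 * ‖mF.toLp F‖ ^ 2 := by
  rw [inner_mulOp_toLp, ← real_inner_self_eq_norm_sq, inner_toLp_interval hpq,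
    ← hF.integral_affine_mul hpq, intervalIntegral.integral_of_le hpq, restrict_Ioo_eq_restrict_Ioc]

/-- The weight that vanishes at the midpoints of both parts of `Ω` and has slope one. -/
def weight (L₁ L₂ L₃ x : ℝ) : ℝ := if x ≤ L₁ then 1 * x + -(L₁ / 2) else 1 * x + -((L₂ + L₃) / 2)

theorem measurable_weight : Measurable (weight L₁ L₂ L₃) :=
  Measurable.ite measurableSet_Iic (by fun_prop) (by fun_prop)

/-- The weight equals plus or minus half the length at the ends of each component, so all four
boundary squares enter with a positive sign. -/
theorem multiplier_Omega {c : ℝ} (hL₁ : 0 ≤ L₁) (hL : L₁ < L₂) (h₂₃ : L₂ ≤ L₃) {F f : ℝ → ℝ}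
    (hF : PrimitiveOn 0 L₁ F f) (hF' : PrimitiveOn L₂ L₃ F f)
    (mF : MemLp F 2 (volume.restrict (Omega L₁ L₂ L₃)))
    (mf : MemLp f 2 (volume.restrict (Omega L₁ L₂ L₃)))
    (hk : AEStronglyMeasurable (weight L₁ L₂ L₃) (volume.restrict (Omega L₁ L₂ L₃)))
    (hc : ∀ᵐ x ∂(volume.restrict (Omega L₁ L₂ L₃)), ‖weight L₁ L₂ L₃ x‖ ≤ c) :
    inner ℝ (mf.toLp f) (mulOp (weight L₁ L₂ L₃) c hk hc (mF.toLp F))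
      = L₁ / 4 * (F L₁ ^ 2 + F 0 ^ 2) + (L₃ - L₂) / 4 * (F L₃ ^ 2 + F L₂ ^ 2)
        - 1 / 2 * ‖mF.toLp F‖ ^ 2 := by
  rw [inner_mulOp_toLp, ← real_inner_self_eq_norm_sq, inner_toLp_Omega hL₁ hL h₂₃,
    integral_Omega hL₁ hL h₂₃ (F := fun x => f x * (weight L₁ L₂ L₃ x * F x))
      (mf.integrable_mul (memLp_bdd_mul mF hk hc))]
  have e1 : ∫ x in (0 : ℝ)..L₁, f x * (weight L₁ L₂ L₃ x * F x)
      = ∫ x in (0 : ℝ)..L₁, f x * ((1 * x + -(L₁ / 2)) * F x) := by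
    refine intervalIntegral.integral_congr fun x hx => ?_
    rw [uIcc_of_le hL₁] at hx
    simp only [weight, if_pos hx.2]
  have e2 : ∫ x in L₂..L₃, f x * (weight L₁ L₂ L₃ x * F x)
      = ∫ x in L₂..L₃, f x * ((1 * x + -((L₂ + L₃) / 2)) * F x) := by
    refine intervalIntegral.integral_congr fun x hx => ?_
    rw [uIcc_of_le h₂₃] at hx
    simp only [weight, if_neg (not_le.2 (hL.trans_le hx.1))]
  rw [e1, e2, hF.integral_affine_mul hL₁, hF'.integral_affine_mul h₂₃]
  ring

/-- Symmetry is needed because the functional pairs the velocity with `M` of the strain rate,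
whereas the multiplier identity has the derivative in the first slot. -/
theorem inner_mulOp_comm {ν : Measure ℝ} {k : ℝ → ℝ} {c : ℝ} (hk : AEStronglyMeasurable k ν)
    (hc : ∀ᵐ x ∂ν, ‖k x‖ ≤ c) {F G : ℝ → ℝ} (hF : MemLp F 2 ν) (hG : MemLp G 2 ν) :
    inner ℝ (hG.toLp G) (mulOp k c hk hc (hF.toLp F))
      = inner ℝ (hF.toLp F) (mulOp k c hk hc (hG.toLp G)) := by
  rw [inner_mulOp_toLp, inner_mulOp_toLp]
  refine integral_congr_ae (Eventually.of_forall fun x => ?_)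
  simp only; ring

end Green

section OmegaCurves

variable {L₁ L₂ L₃ : ℝ} {f f' : ℝ → ℝ → ℝ}

theorem memLp_Omega_of_L2Continuous (h : L₁ < L₂) (h1 : L2Continuous 0 L₁ f)
    (h2 : L2Continuous L₂ L₃ f) (t : ℝ) (ht : 0 ≤ t) :
    MemLp (fun x => f x t) 2 (volume.restrict (Omega L₁ L₂ L₃)) :=
  memLp_Omega h (h1.1 t ht) (h2.1 t ht)

theorem continuous_l2curve_Omega (h : L₁ < L₂) (h1 : L2Continuous 0 L₁ f)
    (h2 : L2Continuous L₂ L₃ f) :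
    Continuous (l2curve (volume.restrict (Omega L₁ L₂ L₃)) f (memLp_Omega_of_L2Continuous h h1 h2)) :=
  continuous_l2curve _ fun t ht => tendsto_eLpNorm_Omega h (h1.2 t ht) (h2.2 t ht)

theorem hasDerivAt_l2curve_Omega (h : L₁ < L₂) (h1 : L2Continuous 0 L₁ f)
    (h2 : L2Continuous L₂ L₃ f) (h1' : L2Continuous 0 L₁ f') (h2' : L2Continuous L₂ L₃ f')
    (d1 : L2HasDeriv 0 L₁ f f') (d2 : L2HasDeriv L₂ L₃ f f') {t : ℝ} (ht : 0 < t) :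
    HasDerivAt (l2curve (volume.restrict (Omega L₁ L₂ L₃)) f (memLp_Omega_of_L2Continuous h h1 h2))
      (l2curve (volume.restrict (Omega L₁ L₂ L₃)) f' (memLp_Omega_of_L2Continuous h h1' h2') t) t :=
  hasDerivAt_l2curve _ _ (fun t ht => tendsto_eLpNorm_Omega h (d1 t ht) (d2 t ht)) ht

end OmegaCurves

/-! ### The transmission problem as an abstract system. -/

namespace Motion.IsRegularOn

variable {w : Motion} {p q : ℝ}

theorem hasDerivAt_val (h : w.IsRegularOn p q) (hpq : p < q) {x t : ℝ} (hx : x ∈ Icc p q)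
    (ht : 0 < t) : HasDerivAt (w.val x) (w.dt x t) t :=
  hasDerivAt_of_spaceDeriv hpq h.val_dx h.dt_dxt h.val_dt h.dx_dxt h.cont_val h.cont_dx h.cont_dt
    h.cont_dxt hx ht

theorem continuousOn_dx (h : w.IsRegularOn p q) (hpq : p < q) :
    ContinuousOn (fun z : ℝ × ℝ => w.dx z.1 z.2) (Icc p q ×ˢ Ici 0) :=
  continuousOn_of_spaceDeriv hpq h.dx_dxx h.cont_dx h.cont_dxx

theorem continuousOn_dt (h : w.IsRegularOn p q) (hpq : p < q) :
    ContinuousOn (fun z : ℝ × ℝ => w.dt z.1 z.2) (Icc p q ×ˢ Ici 0) :=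
  continuousOn_of_spaceDeriv hpq h.dt_dxt h.cont_dt h.cont_dxt

end Motion.IsRegularOn

namespace IsRegularSolution

variable {L₁ L₂ L₃ a b μ₁ μ₂ τ : ℝ} {g : ℝ → ℝ} {u₀ u₁ v₀ v₁ : ℝ → ℝ} {f₀ : ℝ → ℝ → ℝ} {u v : Motion}

/-- Boundary and displacement conditions hold for all positive times, so differentiating them gives
the same conditions for the velocities. -/
theorem boundary_velocity (h : IsRegularSolution L₁ L₂ L₃ a b μ₁ μ₂ τ g u₀ u₁ v₀ v₁ f₀ u v)
    (hL₁ : 0 < L₁) (hL₁₂ : L₁ < L₂) (hL₂₃ : L₂ < L₃) {t : ℝ} (ht : 0 < t) :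
    u.dt 0 t = 0 ∧ u.dt L₃ t = 0 ∧ u.dt L₁ t = v.dt L₁ t ∧ u.dt L₂ t = v.dt L₂ t := by
  have hev : ∀ᶠ s in 𝓝 t, 0 < s := lt_mem_nhds ht
  have key : ∀ {f₁ f₂ : ℝ → ℝ} {d₁ d₂ : ℝ}, HasDerivAt f₁ d₁ t → HasDerivAt f₂ d₂ t →
      (∀ s, 0 < s → f₁ s = f₂ s) → d₁ = d₂ := fun h1 h2 he =>
    h1.unique (h2.congr_of_eventuallyEq (hev.mono he))
  have hu := h.regular_u_left
  have hu' := h.regular_u_right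
  have hv := h.regular_v
  exact ⟨key (hu.hasDerivAt_val hL₁ ⟨le_rfl, hL₁.le⟩ ht) (hasDerivAt_const t 0) h.boundary_left,
    key (hu'.hasDerivAt_val hL₂₃ ⟨hL₂₃.le, le_rfl⟩ ht) (hasDerivAt_const t 0) h.boundary_right,
    key (hu.hasDerivAt_val hL₁ ⟨hL₁.le, le_rfl⟩ ht) (hv.hasDerivAt_val hL₁₂ ⟨le_rfl, hL₁₂.le⟩ ht)
      h.displacement_left,
    key (hu'.hasDerivAt_val hL₂₃ ⟨le_rfl, hL₂₃.le⟩ ht)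
      (hv.hasDerivAt_val hL₁₂ ⟨hL₁₂.le, le_rfl⟩ ht) h.displacement_right⟩

theorem aestronglyMeasurable_dx (h : IsRegularSolution L₁ L₂ L₃ a b μ₁ μ₂ τ g u₀ u₁ v₀ v₁ f₀ u v)
    (hL₁ : 0 < L₁) (hL₁₂ : L₁ < L₂) (hL₂₃ : L₂ < L₃) :
    AEStronglyMeasurable (fun z : ℝ × ℝ => u.dx z.1 z.2)
      ((volume.restrict (Omega L₁ L₂ L₃)).prod (volume.restrict (Ioi 0))) :=
  aestronglyMeasurable_prod_Omega hL₁₂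
    (aestronglyMeasurable_of_continuousOn_strip (h.regular_u_left.continuousOn_dx hL₁))
    (aestronglyMeasurable_of_continuousOn_strip (h.regular_u_right.continuousOn_dx hL₂₃))

theorem aestronglyMeasurable_dt (h : IsRegularSolution L₁ L₂ L₃ a b μ₁ μ₂ τ g u₀ u₁ v₀ v₁ f₀ u v)
    (hL₁ : 0 < L₁) (hL₁₂ : L₁ < L₂) (hL₂₃ : L₂ < L₃) :
    AEStronglyMeasurable (fun z : ℝ × ℝ => u.dt z.1 z.2)
      ((volume.restrict (Omega L₁ L₂ L₃)).prod (volume.restrict (Ioi 0))) :=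
  aestronglyMeasurable_prod_Omega hL₁₂
    (aestronglyMeasurable_of_continuousOn_strip (h.regular_u_left.continuousOn_dt hL₁))
    (aestronglyMeasurable_of_continuousOn_strip (h.regular_u_right.continuousOn_dt hL₂₃))

/-- The viscoelastic stress `σ = a u_x - g * u_x` is absolutely continuous in `x`, and its
derivative is `u_tt + μ₁ u_t + μ₂ u_t(t - τ)`. -/
theorem exists_stress (h : IsRegularSolution L₁ L₂ L₃ a b μ₁ μ₂ τ g u₀ u₁ v₀ v₁ f₀ u v)
    (hL₁ : 0 < L₁) (hL₁₂ : L₁ < L₂) (hL₂₃ : L₂ < L₃) (hτ : 0 < τ) {G : ℝ → ℝ} (hG : Continuous G)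
    (hGg : ∀ t, 0 ≤ t → G t = g t) {t : ℝ} (ht : τ < t) :
    ∃ (σ ρ : ℝ → ℝ) (mσ : MemLp σ 2 (volume.restrict (Omega L₁ L₂ L₃)))
      (mρ : MemLp ρ 2 (volume.restrict (Omega L₁ L₂ L₃))),
      PrimitiveOn 0 L₁ σ ρ ∧ PrimitiveOn L₂ L₃ σ ρ ∧ σ L₁ = b * v.dx L₁ t ∧ σ L₂ = b * v.dx L₂ t ∧
      a • l2curve _ u.dx (memLp_Omega_of_L2Continuous hL₁₂ h.regular_u_left.cont_dx
          h.regular_u_right.cont_dx) t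
        - vconv G (l2curve _ u.dx (memLp_Omega_of_L2Continuous hL₁₂ h.regular_u_left.cont_dx
          h.regular_u_right.cont_dx)) t = mσ.toLp σ ∧
      l2curve _ u.dtt (memLp_Omega_of_L2Continuous hL₁₂ h.regular_u_left.cont_dtt
          h.regular_u_right.cont_dtt) t
        + μ₁ • l2curve _ u.dt (memLp_Omega_of_L2Continuous hL₁₂ h.regular_u_left.cont_dt
          h.regular_u_right.cont_dt) t
        + μ₂ • l2curve _ u.dt (memLp_Omega_of_L2Continuous hL₁₂ h.regular_u_left.cont_dt
          h.regular_u_right.cont_dt) (t - τ) = mρ.toLp ρ := by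
  have ht0 : 0 < t := hτ.trans ht
  have htτ : 0 ≤ t - τ := by linarith
  set mP := memLp_Omega_of_L2Continuous hL₁₂ h.regular_u_left.cont_dx h.regular_u_right.cont_dx
  have mA := memLp_Omega_of_L2Continuous hL₁₂ h.regular_u_left.cont_dtt h.regular_u_right.cont_dtt
  have mV := memLp_Omega_of_L2Continuous hL₁₂ h.regular_u_left.cont_dt h.regular_u_right.cont_dt
  have hae := vconv_ae_eq mP
    (continuous_l2curve_Omega hL₁₂ h.regular_u_left.cont_dx h.regular_u_right.cont_dx)
    (h.aestronglyMeasurable_dx hL₁ hL₁₂ hL₂₃) hG ht0.le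
  have mC : MemLp (fun x => conv G (u.dx x) t) 2 (volume.restrict (Omega L₁ L₂ L₃)) :=
    (Lp.memLp _).ae_eq hae
  have mσ : MemLp (fun x => a * u.dx x t - conv G (u.dx x) t) 2
    (volume.restrict (Omega L₁ L₂ L₃)) := ((mP t ht0.le).const_mul a).sub mC
  have mρ : MemLp (fun x => u.dtt x t + μ₁ * u.dt x t + μ₂ * u.dt x (t - τ)) 2
    (volume.restrict (Omega L₁ L₂ L₃)) :=
    ((mA t ht0.le).add ((mV t ht0.le).const_mul μ₁)).add ((mV _ htτ).const_mul μ₂)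
  have prim : ∀ {p q : ℝ}, p < q → u.IsRegularOn p q →
      volume.restrict (Ioo p q) ≤ volume.restrict (Omega L₁ L₂ L₃) →
      PrimitiveOn p q (fun x => a * u.dx x t - conv G (u.dx x) t)
        (fun x => u.dtt x t + μ₁ * u.dt x t + μ₂ * u.dt x (t - τ)) := by
    intro p q hpq hu hle
    -- The derivative is first `a u_xx - g * u_xx`; the equation of motion then replaces it almost
    -- everywhere.
    refine PrimitiveOn.congr_ae ((PrimitiveOn.const_mul (hu.dx_dxx t ht0.le) a).sub
      (primitiveOn_conv hpq hu.dx_dxx hu.cont_dx hu.cont_dxx hu.meas_dxx hG ht0.le)) hpq.le ?_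
    filter_upwards [MeasureTheory.ae_mono hle (h.eq_u t ht0)] with x hx
    rw [conv_congr hGg _ ht0.le]
    linarith
  refine ⟨_, _, mσ, mρ, prim hL₁ h.regular_u_left restrict_left_le,
    prim hL₂₃ h.regular_u_right restrict_right_le, ?_, ?_, ?_, ?_⟩
  · rw [conv_congr hGg _ ht0.le]; exact h.stress_left t ht0
  · rw [conv_congr hGg _ ht0.le]; exact h.stress_right t ht0
  · have e : vconv G (l2curve _ u.dx mP) t = mC.toLp _ :=
      Lp.ext (hae.trans mC.coeFn_toLp.symm)
    rw [e, l2curve_of_nonneg mP ht0.le, ← MemLp.toLp_const_smul, ← MemLp.toLp_sub]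
    rfl
  · rw [l2curve_of_nonneg _ ht0.le, l2curve_of_nonneg _ ht0.le, l2curve_of_nonneg _ htτ,
      ← MemLp.toLp_const_smul, ← MemLp.toLp_const_smul, ← MemLp.toLp_add, ← MemLp.toLp_add]
    rfl

theorem primitiveOn_stress_v (h : IsRegularSolution L₁ L₂ L₃ a b μ₁ μ₂ τ g u₀ u₁ v₀ v₁ f₀ u v)
    (hL₁₂ : L₁ < L₂) {t : ℝ} (ht : 0 < t) :
    PrimitiveOn L₁ L₂ (fun x => b * v.dx x t) (fun x => v.dtt x t) := by
  refine PrimitiveOn.congr_ae (PrimitiveOn.const_mul (h.regular_v.dx_dxx t ht.le) b) hL₁₂.le ?_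
  filter_upwards [h.eq_v t ht] with x hx
  linarith

end IsRegularSolution

namespace IsRegularSolution

variable {L₁ L₂ L₃ a b μ₁ μ₂ τ α : ℝ} {g : ℝ → ℝ} {u₀ u₁ v₀ v₁ : ℝ → ℝ} {f₀ : ℝ → ℝ → ℝ}
  {u v : Motion}

/-- Poincaré from the clamped end: `u` vanishes at `0`, so its values are integrals of `u_x`. -/
theorem abs_val_le_left (h : IsRegularSolution L₁ L₂ L₃ a b μ₁ μ₂ τ g u₀ u₁ v₀ v₁ f₀ u v)
    (hL₁ : 0 < L₁) (hL₁₂ : L₁ < L₂) {t : ℝ} (ht : 0 < t) {x : ℝ} (hx : x ∈ Icc 0 L₁) :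
    |u.val x t| ≤ √L₁ * ‖l2curve _ u.dx (memLp_Omega_of_L2Continuous hL₁₂
      h.regular_u_left.cont_dx h.regular_u_right.cont_dx) t‖ := by
  have h1 := PrimitiveOn.abs_le_abs_add hL₁.le (h.regular_u_left.val_dx t ht.le)
    (h.regular_u_left.cont_dx.1 t ht.le) hx ⟨le_rfl, hL₁.le⟩
  rw [h.boundary_left t ht, abs_zero, zero_add, sub_zero] at h1
  exact h1.trans (mul_le_mul_of_nonneg_left
    (l2norm_le_norm_l2curve restrict_left_le _ ht.le) (Real.sqrt_nonneg _))

theorem abs_val_le_right (h : IsRegularSolution L₁ L₂ L₃ a b μ₁ μ₂ τ g u₀ u₁ v₀ v₁ f₀ u v)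
    (hL₁₂ : L₁ < L₂) (hL₂₃ : L₂ < L₃) {t : ℝ} (ht : 0 < t) {x : ℝ} (hx : x ∈ Icc L₂ L₃) :
    |u.val x t| ≤ √(L₃ - L₂) * ‖l2curve _ u.dx (memLp_Omega_of_L2Continuous hL₁₂
      h.regular_u_left.cont_dx h.regular_u_right.cont_dx) t‖ := by
  have h1 := PrimitiveOn.abs_le_abs_add hL₂₃.le (h.regular_u_right.val_dx t ht.le)
    (h.regular_u_right.cont_dx.1 t ht.le) hx ⟨hL₂₃.le, le_rfl⟩
  rw [h.boundary_right t ht, abs_zero, zero_add] at h1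
  exact h1.trans (mul_le_mul_of_nonneg_left
    (l2norm_le_norm_l2curve restrict_right_le _ ht.le) (Real.sqrt_nonneg _))

theorem norm_val_le (h : IsRegularSolution L₁ L₂ L₃ a b μ₁ μ₂ τ g u₀ u₁ v₀ v₁ f₀ u v)
    (hL₁ : 0 < L₁) (hL₁₂ : L₁ < L₂) (hL₂₃ : L₂ < L₃) {t : ℝ} (ht : 0 < t) :
    ‖l2curve _ u.val (memLp_Omega_of_L2Continuous hL₁₂
        h.regular_u_left.cont_val h.regular_u_right.cont_val) t‖
      ≤ ((volume.restrict (Omega L₁ L₂ L₃)) univ).toReal ^ (1 / 2 : ℝ) * (√L₃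
        * ‖l2curve _ u.dx (memLp_Omega_of_L2Continuous hL₁₂
          h.regular_u_left.cont_dx h.regular_u_right.cont_dx) t‖) := by
  refine norm_l2curve_le_of_bound _ ht.le (by positivity) ?_
  refine (ae_restrict_iff' (measurableSet_Ioo.union measurableSet_Ioo)).2
    (Eventually.of_forall fun x hx => ?_)
  rcases hx with hx | hx
  · exact (h.abs_val_le_left hL₁ hL₁₂ ht (Ioo_subset_Icc_self hx)).trans
      (mul_le_mul_of_nonneg_right (Real.sqrt_le_sqrt (by linarith)) (norm_nonneg _))
  · exact (h.abs_val_le_right hL₁₂ hL₂₃ ht (Ioo_subset_Icc_self hx)).trans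
      (mul_le_mul_of_nonneg_right (Real.sqrt_le_sqrt (by linarith)) (norm_nonneg _))

theorem norm_val_v_le (h : IsRegularSolution L₁ L₂ L₃ a b μ₁ μ₂ τ g u₀ u₁ v₀ v₁ f₀ u v)
    (hL₁ : 0 < L₁) (hL₁₂ : L₁ < L₂) (hL₂₃ : L₂ < L₃) {t : ℝ} (ht : 0 < t) :
    ‖l2curve _ v.val h.regular_v.cont_val.1 t‖
      ≤ ((volume.restrict (Ioo L₁ L₂)) univ).toReal ^ (1 / 2 : ℝ) * (√L₃
        * (‖l2curve _ u.dx (memLp_Omega_of_L2Continuous hL₁₂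
          h.regular_u_left.cont_dx h.regular_u_right.cont_dx) t‖
          + ‖l2curve _ v.dx h.regular_v.cont_dx.1 t‖)) := by
  refine norm_l2curve_le_of_bound _ ht.le (by positivity) ?_
  refine (ae_restrict_iff' measurableSet_Ioo).2 (Eventually.of_forall fun x hx => ?_)
  have h1 := PrimitiveOn.abs_le_abs_add hL₁₂.le (h.regular_v.val_dx t ht.le)
    (h.regular_v.cont_dx.1 t ht.le) (Ioo_subset_Icc_self hx) ⟨le_rfl, hL₁₂.le⟩
  rw [← h.displacement_left t ht] at h1
  have h2 := (h.abs_val_le_left hL₁ hL₁₂ ht ⟨hL₁.le, le_rfl⟩).trans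
    (mul_le_mul_of_nonneg_right (Real.sqrt_le_sqrt (by linarith : L₁ ≤ L₃)) (norm_nonneg _))
  have h3 := mul_le_mul (Real.sqrt_le_sqrt (by linarith : L₂ - L₁ ≤ L₃))
    (l2norm_le_norm_l2curve le_rfl h.regular_v.cont_dx.1 ht.le) ENNReal.toReal_nonneg
    (Real.sqrt_nonneg _)
  linarith

/-- Pairing the equations with the velocity, with the displacement and with the weighted stress
gives the three identities. In the first two the boundary terms cancel by transmission; in the third
they only have a sign, by `hα` and `hαb`, which is why it is an inequality. -/
theorem exists_coupledSystem (h : IsRegularSolution L₁ L₂ L₃ a b μ₁ μ₂ τ g u₀ u₁ v₀ v₁ f₀ u v)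
    (hL₁ : 0 < L₁) (hL₁₂ : L₁ < L₂) (hL₂₃ : L₂ < L₃) (hb : 0 < b) (hτ : 0 < τ)
    {G : ℝ → ℝ} (hG : Continuous G) (hGg : ∀ t, 0 ≤ t → G t = g t) (hα : 1 ≤ α) (hαb : b ≤ α * a) :
    ∃ (c : ℝ) (M : Lp ℝ 2 (volume.restrict (Omega L₁ L₂ L₃)) →L[ℝ]
        Lp ℝ 2 (volume.restrict (Omega L₁ L₂ L₃)))
      (Mv : Lp ℝ 2 (volume.restrict (Ioo L₁ L₂)) →L[ℝ] Lp ℝ 2 (volume.restrict (Ioo L₁ L₂))),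
      0 < c ∧ CoupledSystem a b μ₁ μ₂ τ α ((L₁ + L₃ - L₂) / (2 * (L₂ - L₁))) c G M Mv
        (l2curve _ u.val (memLp_Omega_of_L2Continuous hL₁₂ h.regular_u_left.cont_val
          h.regular_u_right.cont_val))
        (l2curve _ u.dt (memLp_Omega_of_L2Continuous hL₁₂ h.regular_u_left.cont_dt
          h.regular_u_right.cont_dt))
        (l2curve _ u.dtt (memLp_Omega_of_L2Continuous hL₁₂ h.regular_u_left.cont_dtt
          h.regular_u_right.cont_dtt))
        (l2curve _ u.dx (memLp_Omega_of_L2Continuous hL₁₂ h.regular_u_left.cont_dx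
          h.regular_u_right.cont_dx))
        (l2curve _ u.dxt (memLp_Omega_of_L2Continuous hL₁₂ h.regular_u_left.cont_dxt
          h.regular_u_right.cont_dxt))
        (l2curve _ v.val h.regular_v.cont_val.1) (l2curve _ v.dt h.regular_v.cont_dt.1)
        (l2curve _ v.dtt h.regular_v.cont_dtt.1) (l2curve _ v.dx h.regular_v.cont_dx.1)
        (l2curve _ v.dxt h.regular_v.cont_dxt.1) := by
  set κ := (L₁ + L₃ - L₂) / (2 * (L₂ - L₁)) with hκ
  have hL : 0 < L₂ - L₁ := by linarith
  have hκ0 : 0 < κ := div_pos (by linarith) (by linarith)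
  have hκL : κ * (L₂ - L₁) = (L₁ + L₃ - L₂) / 2 := by rw [hκ]; field_simp
  -- With this `d` the line `-κ x + d` passes through `L₁ / 2` at `L₁` and `-(L₃ - L₂) / 2` at `L₂`,
  -- the values of `weight` on the `Ω` side; `κ` is the slope that makes both possible.
  set d := L₁ / 2 + κ * L₁ with hd
  set m := ((volume.restrict (Omega L₁ L₂ L₃)) univ).toReal ^ (1 / 2 : ℝ) with hm
  set mv := ((volume.restrict (Ioo L₁ L₂)) univ).toReal ^ (1 / 2 : ℝ) with hmv
  have hL₃ : 0 < L₃ := by linarith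
  have hm0 : 0 ≤ m := by positivity
  have hmv0 : 0 ≤ mv := by positivity
  -- `L₃` bounds both weights, and the other two summands are the Poincaré constants of `u` and `v`.
  set c := L₃ + m * √L₃ + mv * √L₃ with hc
  have hcL : L₃ ≤ c := by
    have : 0 ≤ m * √L₃ := by positivity
    have : 0 ≤ mv * √L₃ := by positivity
    linarith
  have hk := (measurable_weight (L₁ := L₁) (L₂ := L₂) (L₃ := L₃)).aestronglyMeasurable
    (μ := volume.restrict (Omega L₁ L₂ L₃))
  have hkc : ∀ᵐ x ∂(volume.restrict (Omega L₁ L₂ L₃)), ‖weight L₁ L₂ L₃ x‖ ≤ c := by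
    refine (ae_restrict_iff' (measurableSet_Ioo.union measurableSet_Ioo)).2
      (Eventually.of_forall fun x hx => ?_)
    rw [Real.norm_eq_abs, weight, abs_le]
    rcases hx with hx | hx
    · rw [if_pos hx.2.le]
      constructor <;> linarith [hx.1, hx.2]
    · rw [if_neg (not_le.2 (hL₁₂.trans hx.1))]
      constructor <;> linarith [hx.1, hx.2]
  have hkv : AEStronglyMeasurable (fun x => -κ * x + d) (volume.restrict (Ioo L₁ L₂)) :=
    (by fun_prop : Continuous fun x : ℝ => -κ * x + d).aestronglyMeasurable
  have hkvc : ∀ᵐ x ∂(volume.restrict (Ioo L₁ L₂)), ‖-κ * x + d‖ ≤ c := by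
    refine (ae_restrict_iff' measurableSet_Ioo).2 (Eventually.of_forall fun x hx => ?_)
    have h1 := mul_le_mul_of_nonneg_left hx.1.le hκ0.le
    have h2 := mul_le_mul_of_nonneg_left hx.2.le hκ0.le
    rw [Real.norm_eq_abs, abs_le]
    constructor <;> linarith
  refine ⟨c, mulOp (weight L₁ L₂ L₃) c hk hkc, mulOp (fun x => -κ * x + d) c hkv hkvc,
    by linarith, ?_⟩
  have hul := h.regular_u_left
  have hur := h.regular_u_right
  have hv := h.regular_v
  have mP := memLp_Omega_of_L2Continuous hL₁₂ hul.cont_dx hur.cont_dx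
  have mQ := memLp_Omega_of_L2Continuous hL₁₂ hul.cont_dxt hur.cont_dxt
  have mV := memLp_Omega_of_L2Continuous hL₁₂ hul.cont_dt hur.cont_dt
  have mU := memLp_Omega_of_L2Continuous hL₁₂ hul.cont_val hur.cont_val
  refine
    { cont_V := continuous_l2curve_Omega hL₁₂ hul.cont_dt hur.cont_dt
      cont_P := continuous_l2curve_Omega hL₁₂ hul.cont_dx hur.cont_dx
      deriv_U := fun t ht => hasDerivAt_l2curve_Omega hL₁₂ hul.cont_val hur.cont_val hul.cont_dt
        hur.cont_dt hul.val_dt hur.val_dt ht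
      deriv_V := fun t ht => hasDerivAt_l2curve_Omega hL₁₂ hul.cont_dt hur.cont_dt hul.cont_dtt
        hur.cont_dtt hul.dt_dtt hur.dt_dtt ht
      deriv_P := fun t ht => hasDerivAt_l2curve_Omega hL₁₂ hul.cont_dx hur.cont_dx hul.cont_dxt
        hur.cont_dxt hul.dx_dxt hur.dx_dxt ht
      deriv_Uv := fun t ht => hasDerivAt_l2curve _ _ hv.val_dt ht
      deriv_Vv := fun t ht => hasDerivAt_l2curve _ _ hv.dt_dtt ht
      deriv_Pv := fun t ht => hasDerivAt_l2curve _ _ hv.dx_dxt ht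
      power := fun t ht => ?_
      virial := fun t ht => ?_
      multiplier := fun t ht => ?_
      poincare := fun t ht => ?_
      poincare_v := fun t ht => ?_
      norm_M := norm_mulOp_le hk hkc
      norm_Mv := norm_mulOp_le hkv hkvc }
  · have ht0 : 0 < t := hτ.trans ht
    obtain ⟨σ, ρ, mσ, mρ, p1, p2, s1, s2, eS, eR⟩ := h.exists_stress hL₁ hL₁₂ hL₂₃ hτ hG hGg ht
    obtain ⟨b0, b3, b1, b2⟩ := h.boundary_velocity hL₁ hL₁₂ hL₂₃ ht0
    rw [eS, eR, l2curve_of_nonneg _ ht0.le, l2curve_of_nonneg _ ht0.le,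
      green_Omega hL₁.le hL₁₂ hL₂₃.le p1 p2 (hul.dt_dxt t ht0.le) (hur.dt_dxt t ht0.le)
        mσ mρ (mV t ht0.le) (mQ t ht0.le)]
    have e := green_interval hL₁₂.le (h.primitiveOn_stress_v hL₁₂ ht0) (hv.dt_dxt t ht0.le)
      ((hv.cont_dx.1 t ht0.le).const_mul b) (hv.cont_dtt.1 t ht0.le) (hv.cont_dt.1 t ht0.le)
      (hv.cont_dxt.1 t ht0.le)
    have e' : ((hv.cont_dx.1 t ht0.le).const_mul b).toLp _ = b • l2curve _ v.dx hv.cont_dx.1 t := by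
      rw [l2curve_of_nonneg _ ht0.le, ← MemLp.toLp_const_smul]; rfl
    rw [e', real_inner_smul_left, ← l2curve_of_nonneg hv.cont_dtt.1 ht0.le,
      ← l2curve_of_nonneg hv.cont_dt.1 ht0.le, ← l2curve_of_nonneg hv.cont_dxt.1 ht0.le] at e
    rw [add_assoc, e, s1, s2, b0, b1, b2, b3]
    ring
  · have ht0 : 0 < t := hτ.trans ht
    obtain ⟨σ, ρ, mσ, mρ, p1, p2, s1, s2, eS, eR⟩ := h.exists_stress hL₁ hL₁₂ hL₂₃ hτ hG hGg ht
    have b0 := h.boundary_left t ht0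
    have b3 := h.boundary_right t ht0
    have b1 := h.displacement_left t ht0
    have b2 := h.displacement_right t ht0
    rw [eS, eR, l2curve_of_nonneg _ ht0.le, l2curve_of_nonneg _ ht0.le,
      green_Omega hL₁.le hL₁₂ hL₂₃.le p1 p2 (hul.val_dx t ht0.le) (hur.val_dx t ht0.le)
        mσ mρ (mU t ht0.le) (mP t ht0.le)]
    have e := green_interval hL₁₂.le (h.primitiveOn_stress_v hL₁₂ ht0) (hv.val_dx t ht0.le)
      ((hv.cont_dx.1 t ht0.le).const_mul b) (hv.cont_dtt.1 t ht0.le) (hv.cont_val.1 t ht0.le)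
      (hv.cont_dx.1 t ht0.le)
    have e' : ((hv.cont_dx.1 t ht0.le).const_mul b).toLp _ = b • l2curve _ v.dx hv.cont_dx.1 t := by
      rw [l2curve_of_nonneg _ ht0.le, ← MemLp.toLp_const_smul]; rfl
    rw [e', real_inner_smul_left, ← l2curve_of_nonneg hv.cont_dtt.1 ht0.le,
      ← l2curve_of_nonneg hv.cont_val.1 ht0.le, ← l2curve_of_nonneg hv.cont_dx.1 ht0.le] at e
    rw [add_assoc, e, s1, s2, b0, b1, b2, b3]
    ring
  · have ht0 : 0 < t := hτ.trans ht
    obtain ⟨σ, ρ, mσ, mρ, p1, p2, s1, s2, eS, eR⟩ := h.exists_stress hL₁ hL₁₂ hL₂₃ hτ hG hGg ht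
    obtain ⟨b0, b3, b1, b2⟩ := h.boundary_velocity hL₁ hL₁₂ hL₂₃ ht0
    have e1 := multiplier_Omega hL₁.le hL₁₂ hL₂₃.le p1 p2 mσ mρ hk hkc
    have e2 := multiplier_Omega hL₁.le hL₁₂ hL₂₃.le (hul.dt_dxt t ht0.le) (hur.dt_dxt t ht0.le)
      (mV t ht0.le) (mQ t ht0.le) hk hkc
    rw [inner_mulOp_comm, ← l2curve_of_nonneg mV ht0.le, ← l2curve_of_nonneg mQ ht0.le] at e2
    have e3 := multiplier_interval (κ := -κ) (d := d) hL₁₂.le (h.primitiveOn_stress_v hL₁₂ ht0)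
      ((hv.cont_dx.1 t ht0.le).const_mul b) (hv.cont_dtt.1 t ht0.le) hkv hkvc
    have e' : ((hv.cont_dx.1 t ht0.le).const_mul b).toLp _ = b • l2curve _ v.dx hv.cont_dx.1 t := by
      rw [l2curve_of_nonneg _ ht0.le, ← MemLp.toLp_const_smul]; rfl
    rw [e', map_smul, real_inner_smul_right, norm_smul, mul_pow, Real.norm_of_nonneg hb.le,
      ← l2curve_of_nonneg hv.cont_dtt.1 ht0.le] at e3
    have e4 := multiplier_interval (κ := -κ) (d := d) hL₁₂.le (hv.dt_dxt t ht0.le)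
      (hv.cont_dt.1 t ht0.le) (hv.cont_dxt.1 t ht0.le) hkv hkvc
    rw [inner_mulOp_comm, ← l2curve_of_nonneg hv.cont_dt.1 ht0.le,
      ← l2curve_of_nonneg hv.cont_dxt.1 ht0.le] at e4
    have w1 : -κ * L₁ + d = L₁ / 2 := by rw [hd]; ring
    have w2 : -κ * L₂ + d = -((L₃ - L₂) / 2) := by rw [hd]; linarith
    rw [w1, w2] at e3 e4
    rw [eS, eR, e1, e2, e4, b0, b1, b2, b3, s1, s2]
    -- The stress at the outer ends is unknown but enters with the favourable sign (`q0`, `q3`). At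
    -- the interfaces the stress squares carry the factor `α - 1` and the velocity squares `α a -
    -- b`.
    have hα' : 0 ≤ α := by linarith
    have q0 : 0 ≤ α * (L₁ * σ 0 ^ 2) := by positivity
    have q3 : 0 ≤ α * ((L₃ - L₂) * σ L₃ ^ 2) :=
      mul_nonneg hα' (mul_nonneg (by linarith) (sq_nonneg _))
    have r1 : 0 ≤ (α - 1) * (L₁ * (b * v.dx L₁ t) ^ 2) :=
      mul_nonneg (by linarith) (by positivity)
    have r2 : 0 ≤ (α - 1) * ((L₃ - L₂) * (b * v.dx L₂ t) ^ 2) :=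
      mul_nonneg (by linarith) (mul_nonneg (by linarith) (sq_nonneg _))
    have r3 : 0 ≤ (α * a - b) * (L₁ * v.dt L₁ t ^ 2) :=
      mul_nonneg (by linarith) (by positivity)
    have r4 : 0 ≤ (α * a - b) * ((L₃ - L₂) * v.dt L₂ t ^ 2) :=
      mul_nonneg (by linarith) (mul_nonneg (by linarith) (sq_nonneg _))
    linarith
  · refine (h.norm_val_le hL₁ hL₁₂ hL₂₃ (hτ.trans ht)).trans ?_
    rw [← mul_assoc]
    refine mul_le_mul_of_nonneg_right ?_ (norm_nonneg _)
    have : 0 ≤ mv * √L₃ := by positivity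
    linarith
  · refine (h.norm_val_v_le hL₁ hL₁₂ hL₂₃ (hτ.trans ht)).trans ?_
    rw [← mul_assoc]
    refine mul_le_mul_of_nonneg_right ?_ (by positivity)
    have : 0 ≤ m * √L₃ := by positivity
    linarith

end IsRegularSolution

/-! ### Integrability of the kernel and the limit of `β`. -/

namespace G1

variable {a : ℝ} {g : ℝ → ℝ}

theorem continuousOn (h : G1 a g) : ContinuousOn g (Ici 0) := h.contDiff.continuousOn

theorem intervalIntegrable (h : G1 a g) {x y : ℝ} (hx : 0 ≤ x) (hy : 0 ≤ y) :
    IntervalIntegrable g volume x y :=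
  (h.continuousOn.mono fun _ hs => (le_min hx hy).trans hs.1).intervalIntegrable

/-- Positivity of `β` bounds the integrals of `g ≥ 0` over `[0, t]` by `a`. -/
theorem integrableOn (h : G1 a g) : IntegrableOn g (Ioi 0) := by
  refine integrableOn_Ioi_of_intervalIntegral_norm_bounded (l := atTop) (b := fun t : ℝ => t) a 0
    (fun t => ?_) tendsto_id ?_
  · rcases le_total 0 t with ht | ht
    · exact (intervalIntegrable_iff_integrableOn_Ioc_of_le ht).1 (h.intervalIntegrable le_rfl ht)
    · simp [Ioc_eq_empty (not_lt.2 ht)]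
  · filter_upwards [eventually_ge_atTop 0] with t ht
    have e : ∫ s in (0 : ℝ)..t, ‖g s‖ = ∫ s in (0 : ℝ)..t, g s := by
      refine intervalIntegral.integral_congr fun s hs => ?_
      rw [uIcc_of_le ht] at hs
      exact Real.norm_of_nonneg (h.nonneg s hs.1)
    have := h.beta_pos t ht
    rw [beta] at this
    rw [e]; linarith

theorem beta0_le_beta (h : G1 a g) {t : ℝ} (ht : 0 ≤ t) : beta0 a g ≤ beta a g t := by
  rw [beta, beta0, intervalIntegral.integral_of_le ht]
  have := setIntegral_mono_set h.integrableOn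
    ((ae_restrict_iff' measurableSet_Ioi).2 (Eventually.of_forall fun s hs => h.nonneg s hs.le))
    (LE.le.eventuallyLE (Ioc_subset_Ioi_self (a := t) (b := 0)))
  linarith

theorem tendsto_beta (h : G1 a g) : Tendsto (beta a g) atTop (𝓝 (beta0 a g)) :=
  (intervalIntegral_tendsto_integral_Ioi 0 h.integrableOn tendsto_id).const_sub a

theorem beta_congr {G : ℝ → ℝ} (hGg : ∀ t, 0 ≤ t → G t = g t) {t : ℝ} (ht : 0 ≤ t) :
    a - ∫ s in (0 : ℝ)..t, G s = beta a g t := by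
  rw [beta]
  congr 1
  refine intervalIntegral.integral_congr fun s hs => ?_
  rw [uIcc_of_le ht] at hs
  exact hGg s hs.1

end G1

/-! ### The concrete energy: identification and boundedness. -/

theorem integral_delayed_sq {τ : ℝ} (hτ : 0 < τ) (u : Motion) (x t : ℝ) :
    ∫ ρ in (0 : ℝ)..1, delayed τ u x ρ t ^ 2 = τ⁻¹ * ∫ s in (t - τ)..t, u.dt x s ^ 2 := by
  simp only [delayed]
  rw [intervalIntegral.integral_comp_sub_mul (fun s => u.dt x s ^ 2) hτ.ne' t]
  simp

theorem continuous_vbox {H : Type*} [NormedAddCommGroup H] [InnerProductSpace ℝ H] [CompleteSpace H]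
    {g : ℝ → ℝ} {f : ℝ → H} (hg : Continuous g) (hf : Continuous f) : Continuous (vbox g f) := by
  have h1 : Continuous fun t => ∫ s in (0 : ℝ)..t, g s :=
    intervalIntegral.continuous_primitive (fun _ _ => hg.intervalIntegrable _ _) 0
  have h2 := continuous_vconv hg hf
  have h3 := continuous_vconv hg (f := fun s => ‖f s‖ ^ 2) (by fun_prop)
  refine Continuous.congr (f := fun t => (∫ s in (0 : ℝ)..t, g s) * ‖f t‖ ^ 2
    - 2 * inner ℝ (f t) (vconv g f t) + vconv g (fun s => ‖f s‖ ^ 2) t) (by fun_prop) fun t => ?_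
  rw [vbox_eq hg hf]

namespace IsRegularSolution

variable {L₁ L₂ L₃ a b μ₁ μ₂ τ ζ : ℝ} {g : ℝ → ℝ} {u₀ u₁ v₀ v₁ : ℝ → ℝ} {f₀ : ℝ → ℝ → ℝ}
  {u v : Motion}

theorem energy_eq (h : IsRegularSolution L₁ L₂ L₃ a b μ₁ μ₂ τ g u₀ u₁ v₀ v₁ f₀ u v)
    (hL₁ : 0 < L₁) (hL₁₂ : L₁ < L₂) (hL₂₃ : L₂ < L₃) {G : ℝ → ℝ} (hG : Continuous G)
    (hGg : ∀ t, 0 ≤ t → G t = g t) {t : ℝ} (ht : 0 ≤ t) :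
    energy L₁ L₂ L₃ a b τ ζ g u v t
      = 1 / 2 * ‖l2curve _ u.dt (memLp_Omega_of_L2Continuous hL₁₂ h.regular_u_left.cont_dt
          h.regular_u_right.cont_dt) t‖ ^ 2
        + 1 / 2 * (a - ∫ s in (0 : ℝ)..t, G s)
          * ‖l2curve _ u.dx (memLp_Omega_of_L2Continuous hL₁₂ h.regular_u_left.cont_dx
          h.regular_u_right.cont_dx) t‖ ^ 2
        + 1 / 2 * vbox G (l2curve _ u.dx (memLp_Omega_of_L2Continuous hL₁₂
          h.regular_u_left.cont_dx h.regular_u_right.cont_dx)) t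
        + 1 / 2 * (‖l2curve _ v.dt h.regular_v.cont_dt.1 t‖ ^ 2
          + b * ‖l2curve _ v.dx h.regular_v.cont_dx.1 t‖ ^ 2)
        + (ζ / 2) * ∫ x in Omega L₁ L₂ L₃, ∫ ρ in (0 : ℝ)..1, delayed τ u x ρ t ^ 2 := by
  have e1 : ∫ x in L₁..L₂, (v.dt x t ^ 2 + b * v.dx x t ^ 2)
      = (∫ x in Ioo L₁ L₂, v.dt x t ^ 2) + b * ∫ x in Ioo L₁ L₂, v.dx x t ^ 2 := by
    rw [intervalIntegral.integral_of_le hL₁₂.le, ← restrict_Ioo_eq_restrict_Ioc, integral_add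
      (h.regular_v.cont_dt.1 t ht).integrable_sq ((h.regular_v.cont_dx.1 t ht).integrable_sq.const_mul b),
      integral_const_mul]
  rw [energy, G1.beta_congr hGg ht, norm_sq_l2curve _ ht, norm_sq_l2curve _ ht, norm_sq_l2curve _ ht,
    norm_sq_l2curve _ ht, e1, vbox_eq_integral _
      (continuous_l2curve_Omega hL₁₂ h.regular_u_left.cont_dx h.regular_u_right.cont_dx)
      (h.aestronglyMeasurable_dx hL₁ hL₁₂ hL₂₃) hG ht]
  simp only [box_congr hGg _ ht]

theorem energy_eq_systemEnergy (h : IsRegularSolution L₁ L₂ L₃ a b μ₁ μ₂ τ g u₀ u₁ v₀ v₁ f₀ u v)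
    (hL₁ : 0 < L₁) (hL₁₂ : L₁ < L₂) (hL₂₃ : L₂ < L₃) (hτ : 0 < τ) {G : ℝ → ℝ} (hG : Continuous G)
    (hGg : ∀ t, 0 ≤ t → G t = g t) {t : ℝ} (ht : τ ≤ t) :
    energy L₁ L₂ L₃ a b τ ζ g u v t = systemEnergy a b τ ζ G
      (l2curve _ u.dt (memLp_Omega_of_L2Continuous hL₁₂ h.regular_u_left.cont_dt
          h.regular_u_right.cont_dt))
      (l2curve _ u.dx (memLp_Omega_of_L2Continuous hL₁₂ h.regular_u_left.cont_dx
          h.regular_u_right.cont_dx))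
      (l2curve _ v.dt h.regular_v.cont_dt.1) (l2curve _ v.dx h.regular_v.cont_dx.1) t := by
  rw [h.energy_eq hL₁ hL₁₂ hL₂₃ hG hGg (hτ.le.trans ht), systemEnergy,
    integral_norm_sq_l2curve _
      (continuous_l2curve_Omega hL₁₂ h.regular_u_left.cont_dt h.regular_u_right.cont_dt)
      (h.aestronglyMeasurable_dt hL₁ hL₁₂ hL₂₃) (by linarith : 0 ≤ t - τ) (by linarith)]
  simp only [integral_delayed_sq hτ, integral_const_mul]
  field_simp

/-- For `t < τ` the delay window reaches into the history, where only square integrability of `f₀`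
is available. Every window with `0 ≤ t ≤ T` lies in `[-τ, T]`, so one bounds it by the integral over
the whole interval. -/
theorem exists_delayed_bound (h : IsRegularSolution L₁ L₂ L₃ a b μ₁ μ₂ τ g u₀ u₁ v₀ v₁ f₀ u v)
    (hL₁ : 0 < L₁) (hL₁₂ : L₁ < L₂) (hL₂₃ : L₂ < L₃) (hτ : 0 < τ) (T : ℝ) :
    ∃ C, ∀ t, 0 ≤ t → t ≤ T →
      ∫ x in Omega L₁ L₂ L₃, ∫ ρ in (0 : ℝ)..1, delayed τ u x ρ t ^ 2 ≤ C := by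
  have hT : Integrable (fun z : ℝ × ℝ => u.dt z.1 z.2 ^ 2)
      ((volume.restrict (Omega L₁ L₂ L₃)).prod (volume.restrict (Ioc 0 T))) :=
    integrable_sq_prod (memLp_Omega_of_L2Continuous hL₁₂ h.regular_u_left.cont_dt
      h.regular_u_right.cont_dt)
      (continuous_l2curve_Omega hL₁₂ h.regular_u_left.cont_dt h.regular_u_right.cont_dt)
      (h.aestronglyMeasurable_dt hL₁ hL₁₂ hL₂₃) le_rfl
  have hf : Integrable (fun z : ℝ × ℝ => f₀ z.1 z.2 ^ 2)
      ((volume.restrict (Omega L₁ L₂ L₃)).prod (volume.restrict (Ioc (-τ) 0))) := by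
    have := h.history_memLp.integrable_sq
    rwa [restrict_Ioo_eq_restrict_Ioc] at this
  refine ⟨∫ x in Omega L₁ L₂ L₃, τ⁻¹ * ((∫ s in Ioc (-τ) 0, f₀ x s ^ 2)
    + ∫ s in Ioc 0 T, u.dt x s ^ 2), fun t ht htT => ?_⟩
  simp only [integral_delayed_sq hτ]
  refine integral_mono_of_nonneg (Eventually.of_forall fun x => ?_)
    ((hf.integral_prod_left.add hT.integral_prod_left).const_mul _) ?_
  · exact mul_nonneg (by positivity)
      (intervalIntegral.integral_nonneg (by linarith) fun s _ => sq_nonneg _)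
  filter_upwards [hf.prod_right_ae, hT.prod_right_ae,
    ae_restrict_mem (measurableSet_Ioo.union measurableSet_Ioo)] with x h1 h2 hx
  have e : EqOn (fun s => f₀ x s ^ 2) (fun s => u.dt x s ^ 2) (Ioc (-τ) 0) := fun s hs => by
    have := h.initial_history x hx (s + τ) ⟨by linarith [hs.1], by linarith [hs.2]⟩
    rw [add_sub_cancel_right] at this
    simp only [this]
  have i1 : IntervalIntegrable (fun s => u.dt x s ^ 2) volume (-τ) 0 := by
    rw [intervalIntegrable_iff_integrableOn_Ioc_of_le (by linarith)]
    exact IntegrableOn.congr_fun h1 e measurableSet_Ioc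
  have i2 : IntervalIntegrable (fun s => u.dt x s ^ 2) volume 0 T := by
    rw [intervalIntegrable_iff_integrableOn_Ioc_of_le (ht.trans htT)]
    exact h2
  refine mul_le_mul_of_nonneg_left ?_ (by positivity)
  rw [setIntegral_congr_fun measurableSet_Ioc e, ← intervalIntegral.integral_of_le (by linarith),
    ← intervalIntegral.integral_of_le (ht.trans htT),
    intervalIntegral.integral_add_adjacent_intervals i1 i2]
  exact intervalIntegral.integral_mono_interval (by linarith) (by linarith) htT
    (Eventually.of_forall fun s => sq_nonneg _) (i1.trans i2)

theorem exists_energy_bound (h : IsRegularSolution L₁ L₂ L₃ a b μ₁ μ₂ τ g u₀ u₁ v₀ v₁ f₀ u v)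
    (hL₁ : 0 < L₁) (hL₁₂ : L₁ < L₂) (hL₂₃ : L₂ < L₃) (hτ : 0 < τ) (hζ : 0 ≤ ζ) {G : ℝ → ℝ}
    (hG : Continuous G) (hGg : ∀ t, 0 ≤ t → G t = g t) (T : ℝ) :
    ∃ C, 0 ≤ C ∧ ∀ t, 0 ≤ t → t ≤ T → energy L₁ L₂ L₃ a b τ ζ g u v t ≤ C := by
  obtain ⟨C₁, hC₁⟩ := h.exists_delayed_bound hL₁ hL₁₂ hL₂₃ hτ T
  have c1 := continuous_l2curve_Omega hL₁₂ h.regular_u_left.cont_dt h.regular_u_right.cont_dt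
  have c2 := continuous_l2curve_Omega hL₁₂ h.regular_u_left.cont_dx h.regular_u_right.cont_dx
  have c3 := continuous_l2curve h.regular_v.cont_dt.1 h.regular_v.cont_dt.2
  have c4 := continuous_l2curve h.regular_v.cont_dx.1 h.regular_v.cont_dx.2
  have c5 := continuous_vbox hG c2
  have c6 : Continuous fun t => ∫ s in (0 : ℝ)..t, G s :=
    intervalIntegral.continuous_primitive (fun _ _ => hG.intervalIntegrable _ _) 0
  obtain ⟨C₂, hC₂⟩ := (isCompact_Icc (a := 0) (b := T)).exists_bound_of_continuousOn
    (f := fun t => 1 / 2 * ‖l2curve _ u.dt (memLp_Omega_of_L2Continuous hL₁₂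
          h.regular_u_left.cont_dt h.regular_u_right.cont_dt) t‖ ^ 2
        + 1 / 2 * (a - ∫ s in (0 : ℝ)..t, G s)
          * ‖l2curve _ u.dx (memLp_Omega_of_L2Continuous hL₁₂ h.regular_u_left.cont_dx
          h.regular_u_right.cont_dx) t‖ ^ 2
        + 1 / 2 * vbox G (l2curve _ u.dx (memLp_Omega_of_L2Continuous hL₁₂
          h.regular_u_left.cont_dx h.regular_u_right.cont_dx)) t
        + 1 / 2 * (‖l2curve _ v.dt h.regular_v.cont_dt.1 t‖ ^ 2
          + b * ‖l2curve _ v.dx h.regular_v.cont_dx.1 t‖ ^ 2))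
    (by fun_prop : Continuous _).continuousOn
  refine ⟨max 0 (C₂ + ζ / 2 * C₁), le_max_left _ _, fun t ht htT => le_trans ?_ (le_max_right _ _)⟩
  rw [h.energy_eq hL₁ hL₁₂ hL₂₃ hG hGg ht]
  exact add_le_add ((le_abs_self _).trans (hC₂ t ⟨ht, htT⟩))
    (mul_le_mul_of_nonneg_left (hC₁ t ht htT) (by positivity))

end IsRegularSolution

end ViscoTransmission

end

/-! ### The decay theorem. -/

theorem theorem2p2
    (L₁ L₂ L₃ a b μ₁ μ₂ τ ζ : ℝ)
    (hL₁ : 0 < L₁) (hL₁₂ : L₁ < L₂) (hL₂₃ : L₂ < L₃)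
    (ha : 0 < a) (hb : 0 < b) (hμ₁ : 0 < μ₁) (hμ₂ : 0 < μ₂) (hτ : 0 < τ)
    (hζ : τ * μ₂ < ζ) (hζ' : ζ < τ * (2 * μ₁ - μ₂))
    (g ξ : ℝ → ℝ)
    (hμ : μ₂ < μ₁)
    (hG1 : ViscoTransmission.G1 a g) (hG2 : ViscoTransmission.G2 g ξ)
    (hb' : 4 * (L₂ - L₁) / (L₁ + L₃ - L₂) * ViscoTransmission.beta0 a g < b)
    (ha' : 4 * (L₂ - L₁) / (L₁ + L₃ - L₂) * ViscoTransmission.beta0 a g < a)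
    (u₀ u₁ v₀ v₁ : ℝ → ℝ) (f₀ : ℝ → ℝ → ℝ)
    (u v : ViscoTransmission.Motion)
    (huv : ViscoTransmission.IsRegularSolution L₁ L₂ L₃ a b μ₁ μ₂ τ g u₀ u₁ v₀ v₁ f₀ u v) :
    ∃ γ₀ γ₂ : ℝ, 0 < γ₀ ∧ 0 < γ₂ ∧
      ∀ γ₁ : ℝ, 0 < γ₁ → γ₁ < γ₀ → ∀ t : ℝ, 0 ≤ t →
        ViscoTransmission.energy L₁ L₂ L₃ a b τ ζ g u v t
          ≤ γ₂ * Real.exp (-γ₁ * ∫ s in (0 : ℝ)..t, ξ s) := by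
  obtain ⟨G, G', hG, hG', hGg⟩ := ViscoTransmission.exists_kernel_extension hG1.contDiff
  have hGc : Continuous G := continuous_iff_continuousAt.2 fun t => (hG t).continuousAt
  have hGg0 : ∀ t, 0 ≤ t → G t = g t := fun t ht => (hGg t ht).1
  have hβ₀ := hG1.beta0_pos
  set β₀ := ViscoTransmission.beta0 a g with hβ₀def
  have hd : 0 < L₂ - L₁ := sub_pos.2 hL₁₂
  have hs : 0 < L₁ + L₃ - L₂ := by linarith
  have hαb : b ≤ max 1 (b / a) * a := by
    rw [← div_le_iff₀ ha]; exact le_max_right _ _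
  -- The bound on `b` treats the value `1` of the maximum; the bound on `a`, multiplied by `b / a`,
  -- treats the value `b / a`.
  have hκ : max 1 (b / a) * β₀ < (L₁ + L₃ - L₂) / (2 * (L₂ - L₁)) * b / 2 := by
    have key : ∀ r : ℝ, 4 * (L₂ - L₁) / (L₁ + L₃ - L₂) * β₀ < r →
        β₀ < (L₁ + L₃ - L₂) / (2 * (L₂ - L₁)) * r / 2 := fun r hr => by
      rw [div_mul_eq_mul_div, div_lt_iff₀ hs] at hr
      rw [div_mul_eq_mul_div, div_div, lt_div_iff₀ (by positivity)]
      linarith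
    rw [max_mul_of_nonneg _ _ hβ₀.le, max_lt_iff, one_mul]
    refine ⟨key b hb', ?_⟩
    calc b / a * β₀ < b / a * ((L₁ + L₃ - L₂) / (2 * (L₂ - L₁)) * a / 2) :=
          mul_lt_mul_of_pos_left (key a ha') (by positivity)
      _ = _ := by field_simp
  obtain ⟨c, M, Mv, hc, hsys⟩ := huv.exists_coupledSystem hL₁ hL₁₂ hL₂₃ hb hτ hGc hGg0
    (le_max_left 1 (b / a)) hαb
  obtain ⟨T, γ, C, hT, hγ, hdec⟩ := hsys.exists_energy_decay ha hb hμ₁ hμ₂ hτ hζ hζ'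
    (lt_max_of_lt_left one_pos) hc hβ₀ hκ hG hG'
    (fun t ht => (hGg0 t ht).symm ▸ hG1.nonneg t ht) ((hGg0 0 le_rfl).symm ▸ hG1.pos_zero)
    hG2.nonneg hG2.antitone hG2.differentiable
    (fun t ht => by rw [(hGg t ht).1, (hGg t ht).2]; exact hG2.deriv_le t ht)
    (fun t ht => by
      rw [ViscoTransmission.G1.beta_congr hGg0 ht]; exact hG1.beta0_le_beta ht)
    (by
      filter_upwards [eventually_ge_atTop 0,
        hG1.tendsto_beta.eventually_le_const (by linarith : β₀ < 3 / 2 * β₀)] with t ht hle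
      rwa [ViscoTransmission.G1.beta_congr hGg0 ht])
  have hζ0 : 0 ≤ ζ := (by positivity : 0 ≤ τ * μ₂).trans hζ.le
  obtain ⟨K, hK, hbd⟩ := huv.exists_energy_bound hL₁ hL₁₂ hL₂₃ hτ hζ0 hGc hGg0 T
  have hξi : ∀ t, 0 ≤ t → 0 ≤ ∫ s in (0 : ℝ)..t, ξ s := fun t ht =>
    intervalIntegral.integral_nonneg ht fun s hs => hG2.nonneg s hs.1
  -- `|C|` serves for `t ≥ T`. For `t ≤ T` the energy is at most `K`, and the factor `exp (γ ∫₀ᵀ ξ)`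
  -- compensates the decaying exponential because `γ₁ < γ`. The `1` makes the constant positive.
  refine ⟨γ, |C| + K * Real.exp (γ * ∫ s in (0 : ℝ)..T, ξ s) + 1, hγ, by positivity,
    fun γ₁ hγ₁ hlt t ht => ?_⟩
  have hE := Real.exp_pos (-γ₁ * ∫ s in (0 : ℝ)..t, ξ s)
  rw [add_mul, add_mul]
  rcases le_total T t with hTt | htT
  · rw [huv.energy_eq_systemEnergy hL₁ hL₁₂ hL₂₃ hτ hGc hGg0 (hT.le.trans hTt)]
    calc _ ≤ C * Real.exp (-γ * ∫ s in (0 : ℝ)..t, ξ s) := hdec t hTt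
      _ ≤ |C| * Real.exp (-γ₁ * ∫ s in (0 : ℝ)..t, ξ s) := by
        refine mul_le_mul (le_abs_self C) (Real.exp_le_exp.2 ?_) (Real.exp_pos _).le (abs_nonneg C)
        exact mul_le_mul_of_nonneg_right (neg_le_neg hlt.le) (hξi t ht)
      _ ≤ _ := by
        have : 0 ≤ K * Real.exp (γ * ∫ s in (0 : ℝ)..T, ξ s) *
          Real.exp (-γ₁ * ∫ s in (0 : ℝ)..t, ξ s) := by positivity
        linarith
  · have hmono : ∫ s in (0 : ℝ)..t, ξ s ≤ ∫ s in (0 : ℝ)..T, ξ s := by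
      have hii : ∀ x y : ℝ, 0 ≤ x → 0 ≤ y → IntervalIntegrable ξ volume x y := fun x y hx hy =>
        (hG2.differentiable.continuousOn.mono
          fun s hs => (le_min hx hy).trans hs.1).intervalIntegrable
      have hT0 := ht.trans htT
      rw [← intervalIntegral.integral_add_adjacent_intervals (hii 0 t le_rfl ht) (hii t T ht hT0)]
      exact le_add_of_nonneg_right (intervalIntegral.integral_nonneg htT fun s hs =>
        hG2.nonneg s (ht.trans hs.1))
    have hone : 1 ≤ Real.exp (γ * ∫ s in (0 : ℝ)..T, ξ s) *
        Real.exp (-γ₁ * ∫ s in (0 : ℝ)..t, ξ s) := by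
      rw [← Real.exp_add, Real.one_le_exp_iff]
      have := mul_le_mul hlt.le hmono (hξi t ht) hγ.le
      linarith
    have hKle := le_mul_of_one_le_right hK hone
    have hC0 : 0 ≤ |C| * Real.exp (-γ₁ * ∫ s in (0 : ℝ)..t, ξ s) := by positivity
    rw [← mul_assoc] at hKle
    linarith [hbd t ht htT]
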